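/- Let $T$ be a complete first-order theory in a language $L$, and let $|L|$ be the number of $L$-formulas. A *sort* is a finite tuple $x$ of distinguished variables together with a finite set $\gamma$ of $L$-formulas $\varphi(x,y)$, where $y$ is a tuple of parameter variables. For $M\models T$ let $S_\gamma(M)$ be the set of $\gamma$-types over $M$, i.e. of the sets of formulas $\pm\varphi(x,b)$ ($\varphi\in\gamma$, $b\in M$) satisfied by a tuple of an elementary extension of $M$. The *pattern language* $\mathcal L$ has these sorts and, for each $t=(\varphi_1(x_1,y),\dots,\varphi_k(x_k,y);\alpha(y))$ with each $\varphi_i$ an element of $\gamma_i$ or the negation of one (up to a substitution of parameter variables) and $\alpha$ any formula, a relation symbol $\mathcal R_t$; in $S(M)=(S_\gamma(M))_\gamma$, $$\mathcal R_t(p_1,\dots,p_k)\iff\neg(\exists b\in\alpha(M))\ \bigwedge_i\varphi_i(x_i,b)\in p_i .$$ A *positive primitive* (pp) formula is $\exists\bar z\bigwedge_j\theta_j$ with $\theta_j$ atomic; the *primitive universal theory* of a structure is the set of negations of pp sentences true in it. A model $A$ of such a theory is *existentially closed* (e.c.) if for every homomorphism $f:A\to B$ into a model, every pp formula true of $f(a)$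 in $B$ is true of $a$ in $A$; it is *universal* if every model has a homomorphism into it. **Theorem.** 1. The $S(M)$, $M\models T$, all have the same primitive universal theory $\mathcal T$. 2. $\mathcal T$ has a universal existentially closed model $\mathcal J$ (the core $\mathrm{co}(T)$ of $T$), and it is unique up to isomorphism. For every sort $\gamma$ and every $M\models T$ we have $|\mathcal J_\gamma|\le|S_\gamma(M)|$, and altogether $|\mathcal J|\le 2^{|L|}$. 3. Give each sort of $\mathcal J$ the pp topology, with pre-basic open sets $\{x:\neg R(x,c)\}$ ($R$ pp, $c$ a tuple of $\mathcal J$), and $G=\mathrm{Aut}(\mathcal J)$ the topology with pre-basic open sets $\{g:\neg R(ga,b)\}$ ($R$ pp, $a,b$ tuples of $\mathcal J$). Let $\mathfrak g\trianglelefteq G$ be the group of infinitesimal automorphisms, i.e. of those $g$ with $g(\overline U)=\overline U$ for every open subset $U$ of a sort. Then $\mathcal G=G/\mathfrak g$, with the quotient topology, is a compact Hausdorff topological group. 4. A *Hausdorff imaginary sort* of $\mathcal J$ is a quotient $P/E$, where $P$ is a subset of a sort defined by a conjunction (possibly infinite) of pp formulas without parameters, and $E$ is an equivalence relation on $P$ defined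 in the same way, such that $P/E$ is Hausdorff in the quotient topology. Let $\mathcal J_h$ be the union of the Hausdorff imaginary sorts, with the images of all pp definable relations, and give $\mathrm{Aut}(\mathcal J_h)$ the topology of pointwise convergence. Then $\mathrm{Aut}(\mathcal J_h)$ is a compact Hausdorff topological group, and restriction is a continuous surjective homomorphism $\rho:G\to\mathrm{Aut}(\mathcal J_h)$ with $\ker\rho\le\mathfrak g$. 5. Call $a,a'$ *Lascar neighbours* if for every formula $D(u)$ consistent with $T$ and every finite set $\Delta$ of formulas $\varphi(x,u)$ they have the same $\Delta$-type over some realization of $D$. Let $L_1(p,p')$ be the relation on types over $M$ saying that $p(x)\cup p'(x')$ is consistent with "$x,x'$ are Lascar neighbours"; it is an intersection of pp definable relations of $\mathcal L$, and so makes sense in $\mathcal J$. Let $L_1\subseteq G$ be the set of $g$ with $L_1(p,g(p))$ for all $p\in\mathcal J$. Then $L_1$ and its images in $\mathcal G$ and in $\mathrm{Aut}(\mathcal J_h)$ are closed. 6. Let $M\models T$ be sufficiently saturated ($\kappa$-saturated and strongly $\kappa$-homogeneous for some $\kappa>2^{|L|}$), let $G_{\mathrm{Las}}=\mathrm{Aut}(M)/\mathrm{Aut}_L(M)$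 be the Lascar group of $T$, where $\mathrm{Aut}_L(M)$ is generated by the automorphisms fixing pointwise an elementary submodel, and let $j:\mathcal J\to S(M)$ be a homomorphism. There is a unique homomorphism $\Phi:\mathcal G\to G_{\mathrm{Las}}$ which is surjective, has as its kernel the subgroup generated by the image of $L_1$, and is canonical in the following sense: for all $\sigma\in\mathrm{Aut}(M)$ and all homomorphisms $r:S(M)\to\mathcal J$ with $r\circ j=\mathrm{id}$, $\Phi$ maps the class of the automorphism $r\circ\sigma\circ j$ of $\mathcal J$ to the class of $\sigma$. The same holds with $\mathrm{Aut}(\mathcal J_h)$ and $\rho$ in place of $\mathcal G$ and $G\to\mathcal G$. -/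

import Mathlib

open FirstOrder FirstOrder.Language

universe u v w a b c d

noncomputable section

namespace Patterns

/-! ### Many-sorted relational languages, primitive positive formulas, existentially closed models -/

/-- A many-sorted relational language: a set of sorts and a set of relation symbols,
each with an arity and a list of sorts for its arguments. -/
structure RelLang where
  /-- the sorts -/
  Sorts : Type a
  /-- the relation symbols -/
  Rel : Type b
  /-- the arity of a relation symbol -/
  arity : Rel → ℕ
  /-- the sorts of the arguments of a relation symbol -/
  dom : (R : Rel) → Fin (arity R) → Sorts

/-- A structure for a many-sorted relational language. -/
structure Str (𝓛 : RelLang.{a, b}) where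
  /-- the sorts of the structure -/
  carrier : 𝓛.Sorts → Type c
  /-- the interpretation of the relation symbols -/
  rel : (R : 𝓛.Rel) → ((i : Fin (𝓛.arity R)) → carrier (𝓛.dom R i)) → Prop

section General

variable {𝓛 : RelLang.{a, b}}

/-- The (sorted) family of variables `x₁, …, xₙ`, where `xᵢ` has sort `σ i`. -/
def Ctx {n : ℕ} (σ : Fin n → 𝓛.Sorts) (s : 𝓛.Sorts) : Type :=
  {i : Fin n // σ i = s}

/-- The assignment of the variables `x₁, …, xₙ` given by a tuple of elements. -/
def tuple {A : 𝓛.Sorts → Type c} {n : ℕ} {σ : Fin n → 𝓛.Sorts} (x : ∀ i, A (σ i))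
    (s : 𝓛.Sorts) (i : Ctx σ s) : A s :=
  i.2 ▸ x i.1

/-- Atomic formulas (equality allowed) in a sorted family of variables. -/
inductive Atom (𝓛 : RelLang.{a, b}) (V : 𝓛.Sorts → Type d) : Type (max a b d)
  | rel (R : 𝓛.Rel) (x : ∀ i, V (𝓛.dom R i)) : Atom 𝓛 V
  | eq {s : 𝓛.Sorts} (x y : V s) : Atom 𝓛 V

/-- Truth of an atomic formula under an assignment. -/
def Atom.Realize {V : 𝓛.Sorts → Type d} (A : Str.{a, b, c} 𝓛) (v : ∀ s, V s → A.carrier s) :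
    Atom 𝓛 V → Prop
  | .rel R x => A.rel R fun i => v _ (x i)
  | .eq x y => v _ x = v _ y

/-- A primitive positive formula `∃ y₁ … yₙ, ⋀ⱼ atomⱼ` with free variables in the family `V`. -/
structure PP (𝓛 : RelLang.{a, b}) (V : 𝓛.Sorts → Type d) where
  /-- the number of quantified variables -/
  n : ℕ
  /-- the sorts of the quantified variables -/
  σ : Fin n → 𝓛.Sorts
  /-- the conjuncts -/
  atoms : List (Atom 𝓛 fun s => V s ⊕ Ctx σ s)

/-- Truth of a primitive positive formula under an assignment of its free variables. -/
def PP.Realize {V : 𝓛.Sorts → Type d} (A : Str.{a, b, c} 𝓛) (φ : PP 𝓛 V)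
    (v : ∀ s, V s → A.carrier s) : Prop :=
  ∃ y : ∀ i, A.carrier (φ.σ i), ∀ α ∈ φ.atoms,
    α.Realize A fun s => Sum.elim (v s) (tuple y s)

/-- Primitive positive sentences. -/
abbrev PPSentence (𝓛 : RelLang.{a, b}) := PP 𝓛 (fun _ => Empty)

/-- Truth of a primitive positive sentence. -/
def Str.Sat (A : Str.{a, b, c} 𝓛) (φ : PPSentence 𝓛) : Prop :=
  φ.Realize A fun _ e => e.elim

/-- A primitive universal theory, i.e. a theory axiomatized by negations of primitive positive
sentences. It is given by the set of the primitive positive sentences whose negation it contains. -/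
abbrev PUTheory (𝓛 : RelLang.{a, b}) := Set (PPSentence 𝓛)

/-- `A` is a model of the primitive universal theory `Θ`. -/
def Str.IsModel (A : Str.{a, b, c} 𝓛) (Θ : PUTheory 𝓛) : Prop :=
  ∀ φ ∈ Θ, ¬ A.Sat φ

/-- The primitive universal theory of a structure. -/
def Str.puTheory (A : Str.{a, b, c} 𝓛) : PUTheory 𝓛 :=
  {φ | ¬ A.Sat φ}

/-- Homomorphisms of structures. -/
structure Hom (A B : Str.{a, b, c} 𝓛) where
  /-- the underlying maps, sort by sort -/
  toFun : ∀ s, A.carrier s → B.carrier s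
  /-- relations are preserved -/
  map_rel : ∀ R x, A.rel R x → B.rel R fun i => toFun _ (x i)

/-- Isomorphisms of structures. -/
structure Iso (A B : Str.{a, b, c} 𝓛) where
  /-- the underlying bijections, sort by sort -/
  toEquiv : ∀ s, A.carrier s ≃ B.carrier s
  /-- relations are preserved in both directions -/
  map_rel : ∀ R x, A.rel R x ↔ B.rel R fun i => toEquiv _ (x i)

/-- `A` is an existentially closed model of `Θ`: whenever `f : A → B` is a homomorphism into a
model of `Θ`, each primitive positive formula true in `B` of the image of a tuple of `A` is
true in `A` of this tuple. -/
def IsExistentiallyClosed (Θ : PUTheory 𝓛) (A : Str.{a, b, c} 𝓛) : Prop :=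
  A.IsModel Θ ∧ ∀ B : Str.{a, b, c} 𝓛, B.IsModel Θ → ∀ f : Hom A B,
    ∀ (n : ℕ) (σ : Fin n → 𝓛.Sorts) (φ : PP 𝓛 (Ctx σ)) (x : ∀ i, A.carrier (σ i)),
      φ.Realize B (tuple fun i => f.toFun _ (x i)) → φ.Realize A (tuple x)

/-- `A` is a universal existentially closed model of `Θ`: it is existentially closed, and every
model of `Θ` has a homomorphism into it. -/
def IsUniversalEC (Θ : PUTheory 𝓛) (A : Str.{a, b, c} 𝓛) : Prop :=
  IsExistentiallyClosed Θ A ∧ ∀ B : Str.{a, b, c} 𝓛, B.IsModel Θ → Nonempty (Hom B A)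

/-! ### Automorphisms and the pp topology -/

/-- The automorphism group, as a subgroup of the product of the symmetric groups of the sorts. -/
def autSubgroup (A : Str.{a, b, c} 𝓛) : Subgroup (∀ s, Equiv.Perm (A.carrier s)) where
  carrier := {g | ∀ R x, A.rel R (fun i => g _ (x i)) ↔ A.rel R x}
  mul_mem' {g h} hg hh R x := (hg R fun i => h _ (x i)).trans (hh R x)
  one_mem' _ _ := Iff.rfl
  inv_mem' {g} hg R x := by
    have := hg R fun i => g⁻¹ _ (x i)
    simpa using this.symm

/-- The automorphism group of a structure. -/
def Aut (A : Str.{a, b, c} 𝓛) : Type (max a c) := autSubgroup A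

instance (A : Str.{a, b, c} 𝓛) : Group (Aut A) := inferInstanceAs (Group (autSubgroup A))

/-- The action of an automorphism on a sort. -/
def Aut.app {A : Str.{a, b, c} 𝓛} (g : Aut A) (s : 𝓛.Sorts) : Equiv.Perm (A.carrier s) := g.1 s

/-- The pp topology on a sort: the sets `{x | ¬ R(x, c₁, …, cₖ)}`, with `R` primitive positive and
`c₁, …, cₖ` in the structure, form a pre-basis of open sets. -/
instance ppTopology (A : Str.{a, b, c} 𝓛) (s : 𝓛.Sorts) : TopologicalSpace (A.carrier s) :=
  TopologicalSpace.generateFrom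
    {U | ∃ (k : ℕ) (σ : Fin k → 𝓛.Sorts) (c : ∀ i, A.carrier (σ i))
      (φ : PP 𝓛 fun s' => Ctx (fun _ : Fin 1 => s) s' ⊕ Ctx σ s'),
      U = {x | ¬ φ.Realize A fun s' => Sum.elim (tuple (fun _ => x) s') (tuple c s')}}

/-- The topology of pointwise convergence on the automorphism group: the sets
`{g | ¬ R(g a₁, …, g aₙ, b₁, …, bₘ)}` with `R` primitive positive form a pre-basis. -/
instance autTopology (A : Str.{a, b, c} 𝓛) : TopologicalSpace (Aut A) :=
  TopologicalSpace.generateFrom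
    {U | ∃ (n m : ℕ) (σ : Fin n → 𝓛.Sorts) (τ : Fin m → 𝓛.Sorts)
      (x : ∀ i, A.carrier (σ i)) (y : ∀ i, A.carrier (τ i))
      (φ : PP 𝓛 fun s => Ctx σ s ⊕ Ctx τ s),
      U = {g | ¬ φ.Realize A fun s =>
        Sum.elim (tuple (fun i => g.app _ (x i)) s) (tuple y s)}}

/-- The group `𝔤` of infinitesimal automorphisms: those that stabilize the closure of any
open set. -/
def infinitesimal (A : Str.{a, b, c} 𝓛) : Subgroup (Aut A) where
  carrier := {g | ∀ s, ∀ U : Set (A.carrier s), IsOpen U → g.app s '' closure U = closure U}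
  mul_mem' {g h} hg hh s U hU := by
    have : (g * h).app s '' closure U = g.app s '' (h.app s '' closure U) := by
      rw [← Set.image_comp]; rfl
    rw [this, hh s U hU, hg s U hU]
  one_mem' s U _ := Set.image_id _
  inv_mem' {g} hg s U hU := by
    have h : g⁻¹.app s '' (g.app s '' closure U) = closure U := by
      rw [← Set.image_comp]
      convert Set.image_id _
      ext x
      exact (g.app s).symm_apply_apply x
    rwa [hg s U hU] at h

lemma tuple_app {A : Str.{a, b, c} 𝓛} (g : Aut A) {n : ℕ} {σ : Fin n → 𝓛.Sorts}
    (x : ∀ i, A.carrier (σ i)) (s : 𝓛.Sorts) (i : Ctx σ s) :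
    tuple (fun i => g.app _ (x i)) s i = g.app s (tuple x s i) := by
  obtain ⟨i, rfl⟩ := i
  rfl

lemma PP.realize_of_app {V : 𝓛.Sorts → Type d} {A : Str.{a, b, c} 𝓛} (g : Aut A) (φ : PP 𝓛 V)
    (v : ∀ s, V s → A.carrier s) (h : φ.Realize A v) :
    φ.Realize A fun s x => g.app s (v s x) := by
  obtain ⟨y, hy⟩ := h
  refine ⟨fun i => g.app _ (y i), fun α hα => ?_⟩
  have key : (fun s => Sum.elim (fun x => g.app s (v s x)) (tuple (fun i => g.app _ (y i)) s)) =
      fun s x => g.app s (Sum.elim (v s) (tuple y s) x) := by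
    funext s x
    rcases x with x | x
    · rfl
    · exact tuple_app g y s x
  rw [key]
  have := hy α hα
  cases α with
  | rel R x => exact (g.2 R _).2 this
  | eq x y => exact congrArg (g.app _) this

lemma Aut.continuous_app {A : Str.{a, b, c} 𝓛} (g : Aut A) (s : 𝓛.Sorts) :
    Continuous (g.app s) := by
  refine continuous_generateFrom_iff.2 ?_
  rintro _ ⟨k, σ, c, φ, rfl⟩
  refine TopologicalSpace.isOpen_generateFrom_of_mem
    ⟨k, σ, fun i => g⁻¹.app _ (c i), φ, ?_⟩
  ext x
  refine not_congr ⟨fun h => ?_, fun h => ?_⟩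
  · convert PP.realize_of_app g⁻¹ φ _ h using 1
    funext s' y
    rcases y with ⟨y, rfl⟩ | y
    · exact ((g.app _).symm_apply_apply x).symm
    · exact tuple_app g⁻¹ c s' y
  · convert PP.realize_of_app g φ _ h using 1
    funext s' y
    rcases y with ⟨y, rfl⟩ | ⟨y, rfl⟩
    · rfl
    · exact ((g.app _).apply_symm_apply (c y)).symm

instance infinitesimal_normal (A : Str.{a, b, c} 𝓛) : (infinitesimal A).Normal where
  conj_mem g hg k s U hU := by
    let e : A.carrier s ≃ₜ A.carrier s :=
      { toEquiv := k.app s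
        continuous_toFun := k.continuous_app s
        continuous_invFun := k⁻¹.continuous_app s }
    have hV : IsOpen (e.symm '' U) := e.symm.isOpenMap U hU
    have h1 := hg s _ hV
    have h2 : closure (e.symm '' U) = e.symm '' closure U := (e.symm.image_closure U).symm
    have h3 : (k * g * k⁻¹).app s '' closure U = e '' (g.app s '' (e.symm '' closure U)) := by
      rw [← Set.image_comp, ← Set.image_comp]; rfl
    rw [h3, ← h2, h1, h2, ← Set.image_comp]
    simp

/-! ### Hausdorff imaginary sorts -/

/-- A Hausdorff imaginary sort of `A`: a quotient `P / E`, where `P` is the set of solutions of a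
partial pp type on a sort, `E` is the restriction to `P` of an intersection of pp definable
relations and is an equivalence relation on `P`, and `P / E` is Hausdorff in the topology induced
by the pp topology. -/
structure HausdorffImaginary (A : Str.{a, b, c} 𝓛) where
  /-- the sort -/
  sort : 𝓛.Sorts
  /-- the domain of the imaginary sort -/
  P : Set (A.carrier sort)
  /-- the equivalence relation -/
  E : A.carrier sort → A.carrier sort → Prop
  P_pp : ∃ Φ : Set (PP 𝓛 (Ctx fun _ : Fin 1 => sort)),
    ∀ x, x ∈ P ↔ ∀ φ ∈ Φ, φ.Realize A (tuple fun _ => x)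
  E_pp : ∃ Φ : Set (PP 𝓛 (Ctx fun _ : Fin 2 => sort)),
    ∀ x ∈ P, ∀ y ∈ P, E x y ↔ ∀ φ ∈ Φ, φ.Realize A (tuple ![x, y])
  equivalence : Equivalence fun x y : P => E x y
  hausdorff : T2Space (Quotient (Setoid.mk (fun x y : P => E x y) equivalence))

namespace HausdorffImaginary

variable {A : Str.{a, b, c} 𝓛}

/-- The equivalence relation on the domain of an imaginary sort. -/
def setoid (h : HausdorffImaginary A) : Setoid h.P := ⟨fun x y => h.E x y, h.equivalence⟩

/-- The elements of an imaginary sort. -/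
abbrev Elem (h : HausdorffImaginary A) : Type c := Quotient h.setoid

/-- The relation induced on imaginary sorts by a pp formula, i.e. the image of the relation that
the formula defines. -/
def inducedRel {k : ℕ} (h : Fin k → HausdorffImaginary A)
    (φ : PP 𝓛 (Ctx fun i => (h i).sort)) (x : ∀ i, (h i).Elem) : Prop :=
  ∃ y : ∀ i, (h i).P, (∀ i, Quotient.mk (h i).setoid (y i) = x i) ∧
    φ.Realize A (tuple fun i => (y i).1)

end HausdorffImaginary

/-- The automorphism group of the union `A_h` of the Hausdorff imaginary sorts of `A`, with all
relations induced by pp formulas. -/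
def autHSubgroup (A : Str.{a, b, c} 𝓛) :
    Subgroup (∀ h : HausdorffImaginary A, Equiv.Perm h.Elem) where
  carrier := {f | ∀ (k : ℕ) (h : Fin k → HausdorffImaginary A)
    (φ : PP 𝓛 (Ctx fun i => (h i).sort)) (x : ∀ i, (h i).Elem),
      HausdorffImaginary.inducedRel h φ (fun i => f (h i) (x i)) ↔
        HausdorffImaginary.inducedRel h φ x}
  mul_mem' {f g} hf hg k h φ x := (hf k h φ fun i => g (h i) (x i)).trans (hg k h φ x)
  one_mem' _ _ _ _ := Iff.rfl
  inv_mem' {f} hf k h φ x := by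
    have := hf k h φ fun i => f⁻¹ (h i) (x i)
    simpa using this.symm

/-- The group `Aut(A_h)`. -/
def AutH (A : Str.{a, b, c} 𝓛) : Type (max a c) := autHSubgroup A

instance (A : Str.{a, b, c} 𝓛) : Group (AutH A) := inferInstanceAs (Group (autHSubgroup A))

/-- The action of an element of `Aut(A_h)` on an imaginary sort. -/
def AutH.app {A : Str.{a, b, c} 𝓛} (f : AutH A) (h : HausdorffImaginary A) :
    Equiv.Perm h.Elem := f.1 h

/-- The topology of pointwise convergence on `Aut(A_h)`. -/
instance autHTopology (A : Str.{a, b, c} 𝓛) : TopologicalSpace (AutH A) :=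
  TopologicalSpace.induced
    (fun (f : AutH A) (h : HausdorffImaginary A) (x : h.Elem) => (f.app h x : h.Elem))
    inferInstance

end General

/-! ### The pattern language and the type spaces -/

section Pattern

variable (L : FirstOrder.Language.{u, v})

/-- A sort of the pattern language: a finite tuple of distinguished variables `x₁, …, xₙ` and a
finite set `γ` of formulas `φ(x, y)`, with `y = (y₀, y₁, …)` the parameter variables. -/
structure PatSort where
  /-- the number of distinguished variables -/
  n : ℕ
  /-- the formulas -/
  γ : Finset (L.Formula (Fin n ⊕ ℕ))

/-- A formula "of the sort `γ`": an element of `γ` or its negation, with the parameter variables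
substituted by `yᵢ ↦ y_{ρ i}`. -/
structure PatFormula where
  /-- the sort -/
  sort : PatSort L
  /-- the formula -/
  φ : sort.γ
  /-- `true` for the formula, `false` for its negation -/
  pos : Bool
  /-- the substitution of parameter variables -/
  ρ : ℕ → ℕ

/-- The index `t = (φ₁, …, φₖ; α)` of a relation symbol `R_t`. -/
structure PatRel where
  /-- the number of arguments -/
  k : ℕ
  /-- the formulas `φᵢ(xᵢ, y)` -/
  φ : Fin k → PatFormula L
  /-- the formula `α(y)` -/
  α : L.Formula ℕ

/-- The language of definable patterns. -/
def patLang : RelLang.{max u v, max u v} where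
  Sorts := PatSort L
  Rel := PatRel L
  arity t := t.k
  dom t i := (t.φ i).sort

variable {L}

/-- The `γ`-types over a model `M`. A type `p` is given by the sets
`(d_p x) φ(x, y) = {b | φ(x, b) ∈ p}` for `φ ∈ γ`; it has to be the type of a tuple of an
elementary extension of `M`. -/
def GammaType (M : Type w) [L.Structure M] (s : PatSort L) : Type (max u v w) :=
  {p : s.γ → Set (ℕ → M) //
    ∃ (N : Type (max u v w)) (_ : L.Structure N) (f : M ↪ₑ[L] N) (e : Fin s.n → N),
      ∀ (φ : s.γ) (b : ℕ → M), b ∈ p φ ↔ φ.1.Realize (Sum.elim e (f ∘ b))}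

/-- `φ(x, b) ∈ p`, for a formula `φ` of the sort of `p`. -/
def GammaType.Mem {M : Type w} [L.Structure M] (φ : PatFormula L) (b : ℕ → M)
    (p : GammaType M φ.sort) : Prop :=
  (b ∘ φ.ρ ∈ p.1 φ.φ) ↔ φ.pos = true

/-- The type spaces `S(M)` as a structure for the pattern language: `R_t` holds of
`(p₁, …, pₖ)` if there is no `b ∈ α(M)` with `φᵢ(xᵢ, b) ∈ pᵢ` for all `i`. -/
def typeSpace (M : Type w) [L.Structure M] :
    Str.{max u v, max u v, max u v w} (patLang L) where
  carrier s := GammaType M s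
  rel t p := ¬ ∃ b : ℕ → M, t.α.Realize b ∧ ∀ i : Fin t.k, GammaType.Mem (t.φ i) b (p i)

/-- The theory `𝒯` of `T`-patterns: the common primitive universal theory of all type spaces
`S(M)`, for `M` a model of `T`. -/
def patTheory (T : L.Theory) : PUTheory (patLang L) :=
  {φ | ∀ (M : Type (max u v w)) [L.Structure M] [Nonempty M], M ⊨ T →
    φ ∈ (typeSpace.{u, v, max u v w} M).puTheory}

end Pattern

/-! ### The Lascar neighbour relation -/

section Lascar

variable {L : FirstOrder.Language.{u, v}}

/-- The formula `∃ z, D(z) ∧ ⋀_{φ ∈ Δ} (φ(x, z) ↔ φ(x', z))` in the variables `x, x'`: the tuples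
`x` and `x'` have the same `Δ`-type over some realization of `D`. -/
def sameTypeFormula {n k : ℕ} (D : L.Formula (Fin k)) (Δ : Finset (L.Formula (Fin n ⊕ Fin k))) :
    L.Formula (Fin (n + n) ⊕ ℕ) :=
  Formula.iExs (Fin k)
    (D.relabel (Sum.inr : Fin k → (Fin (n + n) ⊕ ℕ) ⊕ Fin k) ⊓
      Formula.iInf fun φ : Δ =>
        (φ.1.relabel (Sum.map (Sum.inl ∘ Fin.castAdd n) id)).iff
          (φ.1.relabel (Sum.map (Sum.inl ∘ Fin.natAdd n) id)))

/-- `φ(x, y)`, as a formula in the distinguished variables `x, x'`. -/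
def leftFormula {n : ℕ} (φ : L.Formula (Fin n ⊕ ℕ)) : L.Formula (Fin (n + n) ⊕ ℕ) :=
  φ.relabel (Sum.map (Fin.castAdd n) id)

/-- `φ(x', y)`, as a formula in the distinguished variables `x, x'`. -/
def rightFormula {n : ℕ} (φ : L.Formula (Fin n ⊕ ℕ)) : L.Formula (Fin (n + n) ⊕ ℕ) :=
  φ.relabel (Sum.map (Fin.natAdd n) id)

open Classical in
/-- The sort in the variables `x, x'` generated by `φ(x, y)` and `φ(x', y)` for `φ` in the sort `s`,
and by a further formula `θ`. -/
def pairSort (s : PatSort L) (θ : L.Formula (Fin (s.n + s.n) ⊕ ℕ)) : PatSort L where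
  n := s.n + s.n
  γ := insert θ (s.γ.image leftFormula ∪ s.γ.image rightFormula)

lemma mem_pairSort (s : PatSort L) (θ : L.Formula (Fin (s.n + s.n) ⊕ ℕ)) :
    θ ∈ (pairSort s θ).γ := by
  classical
  exact Finset.mem_insert_self _ _

lemma left_mem_pairSort (s : PatSort L) (θ : L.Formula (Fin (s.n + s.n) ⊕ ℕ)) (φ : s.γ) :
    leftFormula φ.1 ∈ (pairSort s θ).γ := by
  classical
  exact Finset.mem_insert_of_mem (Finset.mem_union_left _ (Finset.mem_image_of_mem _ φ.2))

lemma right_mem_pairSort (s : PatSort L) (θ : L.Formula (Fin (s.n + s.n) ⊕ ℕ)) (φ : s.γ) :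
    rightFormula φ.1 ∈ (pairSort s θ).γ := by
  classical
  exact Finset.mem_insert_of_mem (Finset.mem_union_right _ (Finset.mem_image_of_mem _ φ.2))

variable (A : Str.{max u v, max u v, c} (patLang L))

/-- `R_{¬θ}(q)`, expressing that `θ ∈ q`, for a formula `θ` without parameters. -/
def Contains {s : PatSort L} (θ : s.γ) (q : A.carrier s) : Prop :=
  A.rel ⟨1, fun _ => ⟨s, θ, false, id⟩, ⊤⟩ fun _ => q

/-- `R_{(φ, ψ)}(q, p)`. -/
def OmitsPair (φ ψ : PatFormula L) (q : A.carrier φ.sort) (p : A.carrier ψ.sort) : Prop :=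
  A.rel ⟨2, ![φ, ψ], ⊤⟩
    (Fin.cons q (Fin.cons p finZeroElim) : (i : Fin 2) → A.carrier (![φ, ψ] i).sort)

/-- `R_{(φ, ¬ψ)}(q, p) ∧ R_{(¬φ, ψ)}(q, p)`, expressing that `φ(x, b) ∈ q` if and only if
`ψ(x', b) ∈ p`, for all `b`. -/
def SameDef {s s' : PatSort L} (φ : s.γ) (ψ : s'.γ) (q : A.carrier s) (p : A.carrier s') : Prop :=
  ∀ ε : Bool, OmitsPair A ⟨s, φ, ε, id⟩ ⟨s', ψ, !ε, id⟩ q p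

/-- The Lascar neighbour relation `L₁(p, p')`, as an intersection of pp definable relations of the
pattern language. In `S(M)` it says that `p(x)` and `p'(x')` have a common extension `q(x, x')` that
implies that `x, x'` are Lascar neighbours, i.e. that for each formula `D` consistent with `T` and
each finite set `Δ` of formulas, `x` and `x'` have the same `Δ`-type over some realization
of `D`. (By compactness one `D` and `Δ` at a time suffices.) -/
def LascarNeighbours (T : L.Theory) {s : PatSort L} (p p' : A.carrier s) : Prop :=
  ∀ (k : ℕ) (D : L.Formula (Fin k)) (Δ : Finset (L.Formula (Fin s.n ⊕ Fin k))),
    T ⊨ᵇ (Formula.iExs (Fin k) (D.relabel (Sum.inr : Fin k → Empty ⊕ Fin k)) : L.Sentence) →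
      ∃ q : A.carrier (pairSort s (sameTypeFormula D Δ)),
        Contains A ⟨_, mem_pairSort s (sameTypeFormula D Δ)⟩ q ∧
        ∀ φ : s.γ,
          SameDef A ⟨_, left_mem_pairSort s (sameTypeFormula D Δ) φ⟩ φ q p ∧
          SameDef A ⟨_, right_mem_pairSort s (sameTypeFormula D Δ) φ⟩ φ q p'

/-- The set `L₁` of automorphisms that move each element to a Lascar neighbour. -/
def lascarSet (T : L.Theory) : Set (Aut A) :=
  {g | ∀ (s : PatSort L) (p : A.carrier s), LascarNeighbours A T p (g.app s p)}

end Lascar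

/-! ### The Lascar group -/

section LascarGroup

variable (L : FirstOrder.Language.{u, v}) (M : Type w) [L.Structure M]

/-- The automorphism group of a first-order structure. -/
def modelAut : Subgroup (Equiv.Perm M) where
  carrier := {σ | ∃ e : M ≃[L] M, ∀ x, e x = σ x}
  mul_mem' := by
    rintro σ τ ⟨e, he⟩ ⟨f, hf⟩
    exact ⟨e.comp f, fun x => by simp [he, hf]⟩
  one_mem' := ⟨.refl L M, fun _ => rfl⟩
  inv_mem' := by
    rintro σ ⟨e, he⟩
    refine ⟨e.symm, fun x => ?_⟩
    apply e.injective
    rw [e.apply_symm_apply, he]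
    exact (σ.apply_symm_apply x).symm

/-- The group of strong Lascar automorphisms, generated by the automorphisms that fix an elementary
submodel pointwise. -/
def strongAut : Subgroup (modelAut L M) :=
  Subgroup.closure {σ | ∃ N : L.ElementarySubstructure M, ∀ x ∈ N, σ.1 x = x}

instance strongAut_normal : (strongAut L M).Normal where
  conj_mem σ hσ τ := by
    induction hσ using Subgroup.closure_induction with
    | mem σ h =>
      obtain ⟨N, hN⟩ := h
      obtain ⟨e, he⟩ := τ.2
      have hel : (N.toSubstructure.map e.toEmbedding.toHom).IsElementary := by
        intro n φ x
        let f := e.toEmbedding.substructureEquivMap N.toSubstructure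
        have h1 : ((↑) ∘ x : Fin n → M) = e ∘ ((↑) ∘ (f.symm ∘ x)) := by
          funext i
          have : f (f.symm (x i)) = x i := f.apply_symm_apply (x i)
          exact (congrArg Subtype.val this).symm
        rw [h1, StrongHomClass.realize_formula e φ, N.isElementary' φ,
          StrongHomClass.realize_formula f.symm φ]
      refine Subgroup.subset_closure ⟨⟨_, hel⟩, ?_⟩
      rintro _ ⟨y, hy, rfl⟩
      have h2 : τ.1⁻¹ (e y) = y := by
        rw [he]
        exact τ.1.symm_apply_apply y
      change τ.1 (σ.1 (τ.1⁻¹ (e y))) = e y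
      rw [h2, hN y hy, he]
    | one => simp
    | mul a b _ _ ha hb =>
      have : τ * (a * b) * τ⁻¹ = (τ * a * τ⁻¹) * (τ * b * τ⁻¹) := by group
      rw [this]
      exact mul_mem ha hb
    | inv a _ ha =>
      have : τ * a⁻¹ * τ⁻¹ = (τ * a * τ⁻¹)⁻¹ := by group
      rw [this]
      exact inv_mem ha

/-- The Lascar group `Aut(M) / Aut_L(M)` (for `M` sufficiently saturated). -/
abbrev LascarGroup : Type w := modelAut L M ⧸ strongAut L M

/-- `M` is sufficiently saturated: for some `κ > 2 ^ |L|`, where `|L|` is the number of formulas,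
`M` is `κ`-saturated and strongly `κ`-homogeneous. -/
def SufficientlySaturated : Prop :=
  ∃ κ : Cardinal.{w},
    Cardinal.lift.{w} (2 ^ max Cardinal.aleph0 L.card) < Cardinal.lift.{max u v} κ ∧
    (∀ A : Set M, Cardinal.mk A < κ → ∀ Γ : Set (L.Formula (A ⊕ Unit)),
      (∀ Γ₀ : Finset (L.Formula (A ⊕ Unit)), ↑Γ₀ ⊆ Γ →
        ∃ m : M, ∀ φ ∈ Γ₀, φ.Realize (Sum.elim (↑) fun _ => m)) →
      ∃ m : M, ∀ φ ∈ Γ, φ.Realize (Sum.elim (↑) fun _ => m)) ∧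
    (∀ A : Set M, Cardinal.mk A < κ → ∀ f : A → M,
      (∀ φ : L.Formula A, φ.Realize ((↑) : A → M) ↔ φ.Realize f) →
      ∃ σ : modelAut L M, ∀ x : A, σ.1 x = f x)

variable {L M}

/-- The action of `Aut(M)` on types over `M`: `φ(x, b) ∈ σ p` if and only if
`φ(x, σ⁻¹ b) ∈ p`. -/
def GammaType.act (σ : modelAut L M) {s : PatSort L} (p : GammaType M s) : GammaType M s :=
  ⟨fun φ => {b | σ.1.symm ∘ b ∈ p.1 φ}, by
    obtain ⟨N, _, f, e, h⟩ := p.2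
    obtain ⟨τ, hτ⟩ := σ.2
    refine ⟨N, inferInstance, f.comp τ.symm.toElementaryEmbedding, e, fun φ b => ?_⟩
    have : f ∘ (σ.1.symm ∘ b) = f.comp τ.symm.toElementaryEmbedding ∘ b := by
      funext i
      refine congrArg f ?_
      apply σ.1.injective
      rw [← hτ (τ.symm.toElementaryEmbedding (b i))]
      exact (σ.1.apply_symm_apply (b i)).trans (τ.apply_symm_apply (b i)).symm
    rw [← this]
    exact h φ (σ.1.symm ∘ b)⟩

end LascarGroup

/-- Let `j : J → S(M)` be a homomorphism and `π` a homomorphism from `Aut(J)` to a group `H`. The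
homomorphism `Φ` from `H` to the Lascar group is induced by `j` if it maps the image in `H` of the
automorphism `r ∘ σ ∘ j` of `J` to the class of `σ`, for all `σ ∈ Aut(M)` and all retractions
`r : S(M) → J` of `j`. -/
def IsInducedBy {L : FirstOrder.Language.{u, v}} {M : Type w} [L.Structure M]
    {J : Str.{max u v, max u v, max u v w} (patLang L)} (j : Hom J (typeSpace M))
    {H : Type d} [Group H] (π : Aut J →* H) (Φ : H →* LascarGroup L M) : Prop :=
  ∀ r : Hom (typeSpace M) J, (∀ s x, r.toFun s (j.toFun s x) = x) →
    ∀ (σ : modelAut L M) (g : Aut J),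
      (∀ s x, g.app s x = r.toFun s (GammaType.act σ (j.toFun s x))) →
        Φ (π g) = (σ : LascarGroup L M)

end Patterns
end
open Patterns

universe e

noncomputable section

/-! The engine is compactness of the type spaces. Every type over $M$ is the limit of an ultrafilter
of tuples of $M$, so each $S_\gamma(M)$ is compact Hausdorff. Since $\mathcal R_t$ asserts that a
pattern is absent, atomic relations are closed, and so are pp relations, as projections along
compact factors. Hence a finitely satisfiable set of pp formulas with parameters is satisfiable in
$S(M)$ (`exists_realize_of_finite`), and every model of the primitive universal theory of $S(M)$
maps to $S(M)$ (`nonempty_hom_of_isModel`). Elementarily equivalent $M,N$ are linked by ultrafilters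
of maps that are elementary in the limit; these induce homomorphisms between the type spaces, so the
theory is common.

The endomorphisms of $S(M)$ form a compact right topological semigroup. The image of an idempotent
in a minimal left ideal is the core: by minimality each homomorphism from it to a model splits
(`exists_isCore`), which implies universality, existential closedness and uniqueness.

As a retract of $S(M)$ the core inherits compactness for pp types and closure of pp relations under
disjunction, and its endomorphisms are automorphisms (`IsCompactCore`). So pp types whose unknowns
are automorphisms are realized as soon as they are finitely consistent
(`IsCompactCore.exists_auts`). This gives compactness of $G$, surjectivity of restriction, and pp
types defining orbits. A Hausdorff quotient of $G$ is a topological group because division is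
continuous on a compact refinement of $G\times G$ that maps onto its square by a quotient map.
Orbits modulo $\mathfrak g$ are Hausdorff imaginary sorts, whence the bound on $\ker\rho$.

For the Lascar group, the key is `lNat_of_comp_eq`: two homomorphisms into $S(M)$ that become equal
after a further homomorphism send each element to Lascar neighbours. Call $g\in G$ and
$\sigma\in\mathrm{Aut}(M)$ related if $jg$ and $\sigma j$ differ by chains of neighbours of bounded
length. Every $g$ is related to some $\sigma$ (`exists_related`), because $g$ preserves the patterns
present in types and saturation realizes them by one small tuple. If $\sigma$ is related to $1$, a
bounded chain of types unwinds, by saturation, to a chain of copies of a small submodel, so $\sigma$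
is strong (`Related.mem_strongAut`). Thus $g\mapsto[\sigma]$ is a well-defined homomorphism. It
kills $\mathfrak g$ because an infinitesimal automorphism moves each element by at most two steps
(`exists_lNat_of_mem_infinitesimal`). -/

namespace Patterns

/-! ### Calculus of primitive positive formulas. -/

section Formulas

variable {𝓛 : RelLang.{a, b}} {V : 𝓛.Sorts → Type d} {W : 𝓛.Sorts → Type e}

lemma exists_tuple_eq {A : 𝓛.Sorts → Type c} {n : ℕ} {σ : Fin n → 𝓛.Sorts}
    (w : ∀ s, Ctx σ s → A s) : ∃ y : ∀ i, A (σ i), tuple y = w :=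
  ⟨fun i => w _ ⟨i, rfl⟩, by funext s ⟨i, hi⟩; subst hi; rfl⟩

lemma comp_tuple {A : 𝓛.Sorts → Type c} {B : 𝓛.Sorts → Type e} {n : ℕ} {σ : Fin n → 𝓛.Sorts}
    (f : ∀ s, A s → B s) (y : ∀ i, A (σ i)) (s : 𝓛.Sorts) (i : Ctx σ s) :
    tuple (fun i => f _ (y i)) s i = f s (tuple y s i) := by
  obtain ⟨i, rfl⟩ := i
  rfl

/-- Renaming of variables in an atomic formula. -/
def Atom.map (f : ∀ s, V s → W s) : Atom 𝓛 V → Atom 𝓛 W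
  | .rel R x => .rel R fun i => f _ (x i)
  | .eq x y => .eq (f _ x) (f _ y)

lemma Atom.realize_map (A : Str.{a, b, c} 𝓛) (f : ∀ s, V s → W s) (α : Atom 𝓛 V)
    (w : ∀ s, W s → A.carrier s) :
    (α.map f).Realize A w ↔ α.Realize A fun s x => w s (f s x) := by
  cases α <;> rfl

lemma Atom.realize_hom {A B : Str.{a, b, c} 𝓛} (f : Hom A B) (α : Atom 𝓛 V)
    (v : ∀ s, V s → A.carrier s) (h : α.Realize A v) :
    α.Realize B fun s x => f.toFun s (v s x) := by
  cases α with
  | rel R x => exact f.map_rel R _ h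
  | eq x y => exact congrArg (f.toFun _) h

lemma Atom.forall_realize_map (A : Str.{a, b, c} 𝓛) (f : ∀ s, V s → W s) (l : List (Atom 𝓛 V))
    (w : ∀ s, W s → A.carrier s) :
    (∀ α ∈ l.map (Atom.map f), α.Realize A w) ↔ ∀ α ∈ l, α.Realize A fun s x => w s (f s x) := by
  simp only [List.forall_mem_map, Atom.realize_map]

/-- Renaming of the free variables of a primitive positive formula. -/
def PP.map (f : ∀ s, V s → W s) (φ : PP 𝓛 V) : PP 𝓛 W :=
  ⟨φ.n, φ.σ, φ.atoms.map (Atom.map fun s => Sum.map (f s) id)⟩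

lemma PP.realize_map (A : Str.{a, b, c} 𝓛) (f : ∀ s, V s → W s) (φ : PP 𝓛 V)
    (w : ∀ s, W s → A.carrier s) :
    (φ.map f).Realize A w ↔ φ.Realize A fun s x => w s (f s x) := by
  refine exists_congr fun (y : ∀ i, A.carrier (φ.σ i)) => ?_
  have : (fun s x => Sum.elim (w s) (tuple y s) (Sum.map (f s) id x)) =
      fun s => Sum.elim (fun x => w s (f s x)) (tuple y s) := by
    funext s x
    cases x <;> rfl
  refine (Atom.forall_realize_map A _ φ.atoms _).trans ?_
  exact iff_of_eq (congrArg (fun v => ∀ α ∈ φ.atoms, α.Realize A v) this)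

lemma PP.realize_hom {A B : Str.{a, b, c} 𝓛} (f : Hom A B) (φ : PP 𝓛 V)
    (v : ∀ s, V s → A.carrier s) (h : φ.Realize A v) :
    φ.Realize B fun s x => f.toFun s (v s x) := by
  obtain ⟨y, hy⟩ := h
  refine ⟨fun i => f.toFun _ (y i), fun α hα => ?_⟩
  convert Atom.realize_hom f α _ (hy α hα) using 1
  funext s x
  cases x with
  | inl x => rfl
  | inr x => exact comp_tuple f.toFun y s x

/-- The conjunction of a list of atomic formulas. -/
def PP.ofAtoms (l : List (Atom 𝓛 V)) : PP 𝓛 V :=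
  ⟨0, finZeroElim, l.map (Atom.map fun _ => Sum.inl)⟩

lemma PP.realize_ofAtoms (A : Str.{a, b, c} 𝓛) (l : List (Atom 𝓛 V))
    (v : ∀ s, V s → A.carrier s) :
    (PP.ofAtoms l).Realize A v ↔ ∀ α ∈ l, α.Realize A v := by
  exact ⟨fun ⟨y, h⟩ => (Atom.forall_realize_map A (fun s => Sum.inl (β := Ctx finZeroElim s)) l
      fun s => Sum.elim (v s) (tuple y s)).1 h,
    fun h => ⟨fun i => i.elim0, (Atom.forall_realize_map A _ _ _).2 h⟩⟩

/-- The variables of the concatenation of two contexts. -/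
def ctxAppend {m n : ℕ} (τ : Fin m → 𝓛.Sorts) (σ : Fin n → 𝓛.Sorts) (s : 𝓛.Sorts) :
    Ctx τ s ⊕ Ctx σ s → Ctx (Fin.append τ σ) s
  | .inl i => ⟨Fin.castAdd n i.1, (Fin.append_left τ σ i.1).trans i.2⟩
  | .inr i => ⟨Fin.natAdd m i.1, (Fin.append_right τ σ i.1).trans i.2⟩

lemma exists_tuple_append {A : 𝓛.Sorts → Type c} {m n : ℕ} {τ : Fin m → 𝓛.Sorts}
    {σ : Fin n → 𝓛.Sorts} (w : ∀ s, Ctx τ s → A s) (z : ∀ s, Ctx σ s → A s) :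
    ∃ y : ∀ i, A (Fin.append τ σ i), ∀ s x,
      tuple y s (ctxAppend τ σ s x) = Sum.elim (w s) (z s) x := by
  obtain ⟨y, hy⟩ := exists_tuple_eq (σ := Fin.append τ σ) (A := A) fun s i =>
    Fin.addCases (motive := fun i => Fin.append τ σ i = s → A s)
      (fun i h => w s ⟨i, (Fin.append_left τ σ i).symm.trans h⟩)
      (fun i h => z s ⟨i, (Fin.append_right τ σ i).symm.trans h⟩) i.1 i.2
  refine ⟨y, fun s x => ?_⟩
  rw [hy]
  cases x with
  | inl x =>
    simp only [ctxAppend, Sum.elim_inl]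
    rw [Fin.addCases_left]
    rfl
  | inr x =>
    simp only [ctxAppend, Sum.elim_inr]
    rw [Fin.addCases_right]
    rfl

/-- Conjunction. -/
def PP.and (φ ψ : PP 𝓛 V) : PP 𝓛 V :=
  ⟨φ.n + ψ.n, Fin.append φ.σ ψ.σ,
    φ.atoms.map (Atom.map fun s => Sum.map id fun x => ctxAppend φ.σ ψ.σ s (.inl x)) ++
    ψ.atoms.map (Atom.map fun s => Sum.map id fun x => ctxAppend φ.σ ψ.σ s (.inr x))⟩

lemma PP.realize_and (A : Str.{a, b, c} 𝓛) (φ ψ : PP 𝓛 V) (v : ∀ s, V s → A.carrier s) :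
    (φ.and ψ).Realize A v ↔ φ.Realize A v ∧ ψ.Realize A v := by
  have key : ∀ (y : ∀ i, A.carrier (Fin.append φ.σ ψ.σ i)) (w : ∀ s, Ctx φ.σ s → A.carrier s)
      (z : ∀ s, Ctx ψ.σ s → A.carrier s),
      (∀ s x, tuple y s (ctxAppend φ.σ ψ.σ s x) = Sum.elim (w s) (z s) x) →
      ((∀ α ∈ (φ.and ψ).atoms, α.Realize A fun s => Sum.elim (v s) (tuple y s)) ↔
        (∀ α ∈ φ.atoms, α.Realize A fun s => Sum.elim (v s) (w s)) ∧
        ∀ α ∈ ψ.atoms, α.Realize A fun s => Sum.elim (v s) (z s)) := by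
    intro y w z h
    have h1 : (fun s x => Sum.elim (v s) (tuple y s)
        (Sum.map id (fun x => ctxAppend φ.σ ψ.σ s (.inl x)) x)) =
        fun s => Sum.elim (v s) (w s) := by
      funext s x
      cases x with
      | inl x => rfl
      | inr x => exact h s (.inl x)
    have h2 : (fun s x => Sum.elim (v s) (tuple y s)
        (Sum.map id (fun x => ctxAppend φ.σ ψ.σ s (.inr x)) x)) =
        fun s => Sum.elim (v s) (z s) := by
      funext s x
      cases x with
      | inl x => rfl
      | inr x => exact h s (.inr x)
    rw [← h1, ← h2]
    refine List.forall_mem_append.trans (and_congr ?_ ?_) <;>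
      exact Atom.forall_realize_map A _ _ _
  constructor
  · rintro ⟨y, hy⟩
    obtain ⟨y1, h1⟩ := exists_tuple_eq (A := A.carrier) (σ := φ.σ)
      fun s x => tuple y s (ctxAppend φ.σ ψ.σ s (.inl x))
    obtain ⟨y2, h2⟩ := exists_tuple_eq (A := A.carrier) (σ := ψ.σ)
      fun s x => tuple y s (ctxAppend φ.σ ψ.σ s (.inr x))
    have := (key y (tuple y1) (tuple y2) (by
      rw [h1, h2]
      rintro s (x | x) <;> rfl)).1 hy
    exact ⟨⟨y1, this.1⟩, ⟨y2, this.2⟩⟩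
  · rintro ⟨⟨y1, h1⟩, ⟨y2, h2⟩⟩
    obtain ⟨y, hy⟩ := exists_tuple_append (tuple y1) (tuple y2)
    exact ⟨y, (key y _ _ hy).2 ⟨h1, h2⟩⟩

/-- The conjunction of a list of primitive positive formulas. -/
def PP.conj : List (PP 𝓛 V) → PP 𝓛 V
  | [] => PP.ofAtoms []
  | φ :: l => φ.and (PP.conj l)

lemma PP.realize_conj (A : Str.{a, b, c} 𝓛) (l : List (PP 𝓛 V)) (v : ∀ s, V s → A.carrier s) :
    (PP.conj l).Realize A v ↔ ∀ φ ∈ l, φ.Realize A v := by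
  induction l with
  | nil => simp [PP.conj, PP.realize_ofAtoms]
  | cons φ l ih => simp [PP.conj, PP.realize_and, ih]

/-- Existential quantification over the variables of a context. -/
def PP.exCtx {m : ℕ} {τ : Fin m → 𝓛.Sorts} (φ : PP 𝓛 fun s => V s ⊕ Ctx τ s) : PP 𝓛 V :=
  ⟨m + φ.n, Fin.append τ φ.σ, φ.atoms.map (Atom.map fun s =>
    Sum.elim (Sum.elim .inl fun x => .inr (ctxAppend τ φ.σ s (.inl x)))
      fun x => .inr (ctxAppend τ φ.σ s (.inr x)))⟩

lemma PP.realize_exCtx (A : Str.{a, b, c} 𝓛) {m : ℕ} {τ : Fin m → 𝓛.Sorts}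
    (φ : PP 𝓛 fun s => V s ⊕ Ctx τ s) (v : ∀ s, V s → A.carrier s) :
    φ.exCtx.Realize A v ↔ ∃ y : ∀ i, A.carrier (τ i),
      φ.Realize A fun s => Sum.elim (v s) (tuple y s) := by
  have key : ∀ (y : ∀ i, A.carrier (Fin.append τ φ.σ i)) (w : ∀ s, Ctx τ s → A.carrier s)
      (z : ∀ s, Ctx φ.σ s → A.carrier s),
      (∀ s x, tuple y s (ctxAppend τ φ.σ s x) = Sum.elim (w s) (z s) x) →
      ((∀ α ∈ φ.exCtx.atoms, α.Realize A fun s => Sum.elim (v s) (tuple y s)) ↔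
        ∀ α ∈ φ.atoms, α.Realize A fun s => Sum.elim (Sum.elim (v s) (w s)) (z s)) := by
    intro y w z h
    have h1 : (fun s x => Sum.elim (v s) (tuple y s)
        (Sum.elim (Sum.elim .inl fun x => .inr (ctxAppend τ φ.σ s (.inl x)))
          (fun x => .inr (ctxAppend τ φ.σ s (.inr x))) x)) =
        fun s => Sum.elim (Sum.elim (v s) (w s)) (z s) := by
      funext s x
      rcases x with (x | x) | x
      · rfl
      · exact h s (.inl x)
      · exact h s (.inr x)
    rw [← h1]
    exact Atom.forall_realize_map A _ _ _
  constructor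
  · rintro ⟨y, hy⟩
    obtain ⟨y1, h1⟩ := exists_tuple_eq (A := A.carrier) (σ := τ)
      fun s x => tuple y s (ctxAppend τ φ.σ s (.inl x))
    obtain ⟨y2, h2⟩ := exists_tuple_eq (A := A.carrier) (σ := φ.σ)
      fun s x => tuple y s (ctxAppend τ φ.σ s (.inr x))
    exact ⟨y1, y2, (key y (tuple y1) (tuple y2) (by
      rw [h1, h2]
      rintro s (x | x) <;> rfl)).1 hy⟩
  · rintro ⟨y1, y2, h⟩
    obtain ⟨y, hy⟩ := exists_tuple_append (tuple y1) (tuple y2)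
    exact ⟨y, (key y _ _ hy).2 h⟩

/-- The list holds the variables from `W` that occur. The renaming `f` is quantified after the list,
so that a single `f` can later serve all atoms of a pp formula. -/
lemma Atom.exists_support {X : 𝓛.Sorts → Type c} (α : Atom 𝓛 fun s => (V s ⊕ W s) ⊕ X s) :
    ∃ l : List (Σ s, W s), ∀ (U : 𝓛.Sorts → Type) (f : ∀ s, U s → W s),
      (∀ p ∈ l, ∃ u, f p.1 u = p.2) → ∃ α' : Atom 𝓛 fun s => (V s ⊕ U s) ⊕ X s,
        α'.map (fun s => Sum.map (Sum.map id (f s)) id) = α := by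
  have key : ∀ (s : 𝓛.Sorts) (x : (V s ⊕ W s) ⊕ X s), ∃ l : List (Σ s, W s),
      ∀ (U : 𝓛.Sorts → Type) (f : ∀ s, U s → W s), (∀ p ∈ l, ∃ u, f p.1 u = p.2) →
        ∃ x' : (V s ⊕ U s) ⊕ X s, Sum.map (Sum.map id (f s)) id x' = x := by
    rintro s ((x | x) | x)
    · exact ⟨[], fun U f _ => ⟨.inl (.inl x), rfl⟩⟩
    · refine ⟨[⟨s, x⟩], fun U f h => ?_⟩
      obtain ⟨y, hy⟩ := h _ (List.mem_singleton_self _)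
      exact ⟨.inl (.inr y), by simp only [Sum.map_inl, Sum.map_inr, hy]⟩
    · exact ⟨[], fun U f _ => ⟨.inr x, rfl⟩⟩
  cases α with
  | rel R x =>
    choose l hl using fun i => key _ (x i)
    refine ⟨(List.finRange _).flatMap l, fun U f h => ?_⟩
    choose x' hx' using fun i => hl i U f fun p hp =>
      h p (List.mem_flatMap.2 ⟨i, List.mem_finRange i, hp⟩)
    exact ⟨.rel R x', by simp only [Atom.map, hx']⟩
  | eq x y =>
    obtain ⟨l, hl⟩ := key _ x
    obtain ⟨l', hl'⟩ := key _ y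
    refine ⟨l ++ l', fun U f h => ?_⟩
    obtain ⟨x', hx⟩ := hl U f fun p hp => h p (List.mem_append_left _ hp)
    obtain ⟨y', hy⟩ := hl' U f fun p hp => h p (List.mem_append_right _ hp)
    exact ⟨.eq x' y', by simp only [Atom.map, hx, hy]⟩

/-- A primitive positive formula depends on finitely many of its free variables. -/
lemma PP.exists_support (φ : PP 𝓛 fun s => V s ⊕ W s) :
    ∃ (m : ℕ) (τ : Fin m → 𝓛.Sorts) (f : ∀ s, Ctx τ s → W s) (φ' : PP 𝓛 fun s => V s ⊕ Ctx τ s),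
      (∀ s, Function.Injective (f s)) ∧ φ'.map (fun s => Sum.map id (f s)) = φ := by
  classical
  choose l hl using fun α : Atom 𝓛 fun s => (V s ⊕ W s) ⊕ Ctx φ.σ s => α.exists_support
  -- Without duplicates the renaming is injective, so an assignment of the new variables extends to
  -- all of `W`.
  let L := (φ.atoms.flatMap l).dedup
  let f : ∀ s, Ctx (fun i : Fin L.length => (L.get i).1) s → W s := fun s i => i.2 ▸ (L.get i.1).2
  have hf : ∀ p ∈ L, ∃ u, f p.1 u = p.2 := by
    intro p hp
    obtain ⟨i, rfl⟩ := List.mem_iff_get.1 hp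
    exact ⟨⟨i, rfl⟩, rfl⟩
  have : φ.atoms ∈ Set.range (List.map
      (Atom.map (𝓛 := 𝓛) fun s => Sum.map (Sum.map (id : V s → V s) (f s)) (id : Ctx φ.σ s → _))) := by
    rw [Set.range_list_map]
    intro α hα
    exact hl α _ f fun p hp => hf p (List.mem_dedup.2 (List.mem_flatMap.2 ⟨α, hα, hp⟩))
  obtain ⟨l', hl'⟩ := this
  refine ⟨_, _, f, ⟨φ.n, φ.σ, l'⟩, ?_, by rw [PP.map, hl']⟩
  rintro s ⟨i, rfl⟩ ⟨i', hi'⟩ h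
  refine Subtype.ext ((List.nodup_dedup (φ.atoms.flatMap l)).injective_get ?_)
  refine Sigma.ext hi'.symm ?_
  exact (heq_of_eq h).trans (eqRec_heq hi' _)

/-- Existential closedness is defined for finite contexts only; this makes it available for formulas
in any family of variables. -/
lemma PP.exists_ctx (φ : PP 𝓛 V) :
    ∃ (m : ℕ) (τ : Fin m → 𝓛.Sorts) (f : ∀ s, Ctx τ s → V s) (φ' : PP 𝓛 (Ctx τ)),
      ∀ (A : Str.{a, b, c} 𝓛) (v : ∀ s, V s → A.carrier s),
        φ.Realize A v ↔ φ'.Realize A fun s x => v s (f s x) := by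
  obtain ⟨m, τ, f, φ', -, h⟩ := PP.exists_support (V := fun _ => Empty) (φ.map fun _ => Sum.inr)
  refine ⟨m, τ, f, φ'.map fun s => Sum.elim Empty.elim id, fun A v => ?_⟩
  have h1 : φ.Realize A v ↔
      (φ.map fun _ => Sum.inr).Realize A fun s => Sum.elim (Empty.elim : Empty → _) (v s) := by
    rw [PP.realize_map]
    rfl
  rw [h1, ← h, PP.realize_map, PP.realize_map]
  have : (fun s (x : Empty ⊕ Ctx τ s) => Sum.elim (Empty.elim : Empty → A.carrier s) (v s)
      (Sum.map id (f s) x)) = fun s x => v s (f s (Sum.elim Empty.elim id x)) := by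
    funext s x
    rcases x with x | x
    · exact x.elim
    · rfl
  rw [this]

/-- Existential quantification over a family of variables. -/
def PP.exs (φ : PP 𝓛 fun s => V s ⊕ W s) : PP 𝓛 V :=
  φ.exists_support.choose_spec.choose_spec.choose_spec.choose.exCtx

/-- `PP.exs` quantifies only the variables that occur. The two directions are asymmetric since the
other variables also need values, which exist when the sorts are nonempty. -/
lemma PP.realize_exs (A : Str.{a, b, c} 𝓛) (φ : PP 𝓛 fun s => V s ⊕ W s)
    (v : ∀ s, V s → A.carrier s) :
    ((∃ w : ∀ s, W s → A.carrier s, φ.Realize A fun s => Sum.elim (v s) (w s)) →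
      φ.exs.Realize A v) ∧
    ((∀ s, Nonempty (A.carrier s)) → φ.exs.Realize A v →
      ∃ w : ∀ s, W s → A.carrier s, φ.Realize A fun s => Sum.elim (v s) (w s)) := by
  classical
  obtain ⟨hf, h⟩ := φ.exists_support.choose_spec.choose_spec.choose_spec.choose_spec
  rw [PP.exs]
  generalize φ.exists_support.choose_spec.choose_spec.choose_spec.choose = φ' at h ⊢
  generalize φ.exists_support.choose_spec.choose_spec.choose = f at hf h
  have key : ∀ w : ∀ s, W s → A.carrier s, (φ.Realize A fun s => Sum.elim (v s) (w s)) ↔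
      φ'.Realize A fun s => Sum.elim (v s) fun x => w s (f s x) := by
    intro w
    have e := PP.realize_map A (fun s => Sum.map id (f s)) φ' fun s => Sum.elim (v s) (w s)
    rw [h] at e
    refine e.trans ?_
    have : (fun s x => Sum.elim (v s) (w s) (Sum.map id (f s) x)) =
        fun s => Sum.elim (v s) fun x => w s (f s x) := by
      funext s x
      cases x <;> rfl
    rw [this]
  rw [PP.realize_exCtx]
  refine ⟨?_, fun hA => ?_⟩
  · rintro ⟨w, hw⟩
    obtain ⟨y, hy⟩ := exists_tuple_eq (A := A.carrier) fun s x => w s (f s x)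
    exact ⟨y, by rw [hy]; exact (key w).1 hw⟩
  · rintro ⟨y, hy⟩
    refine ⟨fun s => Function.extend (f s) (tuple y s) fun _ => (hA s).some, (key _).2 ?_⟩
    simpa only [(hf _).extend_apply] using hy

lemma PP.realize_exs_of {A : Str.{a, b, c} 𝓛} {φ : PP 𝓛 fun s => V s ⊕ W s}
    {v : ∀ s, V s → A.carrier s} (w : ∀ s, W s → A.carrier s)
    (h : φ.Realize A fun s => Sum.elim (v s) (w s)) : φ.exs.Realize A v :=
  (φ.realize_exs A v).1 ⟨w, h⟩

lemma PP.exists_of_realize_exs {A : Str.{a, b, c} 𝓛} (hA : ∀ s, Nonempty (A.carrier s))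
    {φ : PP 𝓛 fun s => V s ⊕ W s} {v : ∀ s, V s → A.carrier s} (h : φ.exs.Realize A v) :
    ∃ w : ∀ s, W s → A.carrier s, φ.Realize A fun s => Sum.elim (v s) (w s) :=
  (φ.realize_exs A v).2 hA h

lemma IsExistentiallyClosed.reflect {Θ : PUTheory 𝓛} {A B : Str.{a, b, c} 𝓛}
    (hA : IsExistentiallyClosed Θ A) (hB : B.IsModel Θ) (f : Hom A B) (φ : PP 𝓛 V)
    (v : ∀ s, V s → A.carrier s) (h : φ.Realize B fun s x => f.toFun s (v s x)) :
    φ.Realize A v := by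
  obtain ⟨m, τ, g, φ', h'⟩ := φ.exists_ctx
  obtain ⟨y, hy⟩ := exists_tuple_eq (A := A.carrier) fun s x => v s (g s x)
  rw [h', ← hy]
  refine hA.2 B hB f _ _ _ _ ?_
  rw [h'] at h
  convert h using 1
  funext s x
  rw [comp_tuple f.toFun y, hy]

end Formulas

section Homs

variable {𝓛 : RelLang.{a, b}}

/-- The identity homomorphism. -/
def Hom.id (A : Str.{a, b, c} 𝓛) : Hom A A := ⟨fun _ x => x, fun _ _ h => h⟩

/-- Composition of homomorphisms. -/
def Hom.comp {A B C : Str.{a, b, c} 𝓛} (g : Hom B C) (f : Hom A B) : Hom A C :=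
  ⟨fun s x => g.toFun s (f.toFun s x), fun R _ h => g.map_rel R _ (f.map_rel R _ h)⟩

/-- An automorphism as a homomorphism. -/
def Aut.toHom {A : Str.{a, b, c} 𝓛} (g : Aut A) : Hom A A :=
  ⟨fun s => g.app s, fun R x h => (g.2 R x).2 h⟩

lemma Str.Sat.hom {A B : Str.{a, b, c} 𝓛} (f : Hom A B) {φ : PPSentence 𝓛} (h : A.Sat φ) :
    B.Sat φ := by
  have := PP.realize_hom f φ _ h
  have e : (fun s (x : Empty) => f.toFun s (x.elim : A.carrier s)) = fun s x => x.elim := by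
    funext s x
    exact x.elim
  rwa [e] at this

lemma Str.IsModel.of_hom {Θ : PUTheory 𝓛} {A B : Str.{a, b, c} 𝓛} (hB : B.IsModel Θ)
    (f : Hom A B) : A.IsModel Θ :=
  fun φ hφ h => hB φ hφ (h.hom f)

/-- The positive primitive definable predicates on assignments. -/
def IsPP {V : 𝓛.Sorts → Type d} (A : Str.{a, b, c} 𝓛) (X : (∀ s, V s → A.carrier s) → Prop) :
    Prop :=
  ∃ φ : PP 𝓛 V, ∀ v, X v ↔ φ.Realize A v

namespace IsPP

variable {V : 𝓛.Sorts → Type d} {W : 𝓛.Sorts → Type e} {A : Str.{a, b, c} 𝓛}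
  {X Y : (∀ s, V s → A.carrier s) → Prop}

lemma of_atom (α : Atom 𝓛 V) : IsPP A fun v => α.Realize A v :=
  ⟨PP.ofAtoms [α], fun v => by simp [PP.realize_ofAtoms]⟩

lemma and (hX : IsPP A X) (hY : IsPP A Y) : IsPP A fun v => X v ∧ Y v := by
  obtain ⟨φ, hφ⟩ := hX
  obtain ⟨ψ, hψ⟩ := hY
  exact ⟨φ.and ψ, fun v => (and_congr (hφ v) (hψ v)).trans (PP.realize_and A φ ψ v).symm⟩

lemma forall_finite {ι : Type*} [Finite ι] {X : ι → (∀ s, V s → A.carrier s) → Prop}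
    (hX : ∀ i, IsPP A (X i)) : IsPP A fun v => ∀ i, X i v := by
  choose φ hφ using hX
  have := Fintype.ofFinite ι
  refine ⟨PP.conj ((Finset.univ : Finset ι).toList.map φ), fun v => ?_⟩
  simp [PP.realize_conj, hφ]

lemma exists_elem {s : 𝓛.Sorts} {X : (∀ s, V s → A.carrier s) → A.carrier s → Prop}
    (hX : IsPP (V := fun t => V t ⊕ Ctx (fun _ : Fin 1 => s) t) A
      fun v => X (fun t x => v t (.inl x)) (v s (.inr ⟨0, rfl⟩))) :
    IsPP A fun v => ∃ x, X v x := by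
  obtain ⟨φ, hφ⟩ := hX
  refine ⟨φ.exCtx, fun v => ?_⟩
  rw [PP.realize_exCtx]
  constructor
  · rintro ⟨x, hx⟩
    exact ⟨fun _ => x, (hφ _).1 hx⟩
  · rintro ⟨y, hy⟩
    exact ⟨y 0, (hφ _).2 hy⟩

end IsPP

end Homs

/-! ### Ultrafilters, and first-order formulas in arbitrary families of variables. -/

section Ultrafilters

lemma exists_ultrafilter_mem {ι : Type*} {X : Type*} (S : ι → Set X)
    (h : ∀ t : Finset ι, ∃ x, ∀ i ∈ t, x ∈ S i) : ∃ U : Ultrafilter X, ∀ i, S i ∈ U := by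
  have : (Filter.generate (Set.range S)).NeBot := by
    refine Filter.generate_neBot_iff.2 fun t ht hfin => ?_
    obtain ⟨t', rfl⟩ := Set.subset_range_iff_exists_image_eq.1 ht
    obtain ⟨t'', -, ht'', h2⟩ := Set.exists_subset_image_finite_and.1
      ⟨S '' t', subset_rfl, hfin, rfl⟩
    obtain ⟨x, hx⟩ := h ht''.toFinset
    refine ⟨x, ?_⟩
    rw [h2]
    rintro _ ⟨i, hi, rfl⟩
    exact hx i (by simpa using hi)
  refine ⟨Ultrafilter.of (Filter.generate (Set.range S)), fun i => ?_⟩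
  exact Ultrafilter.of_le _ (Filter.mem_generate_of_mem ⟨i, rfl⟩)

end Ultrafilters

section FirstOrderFormulas

variable {L : FirstOrder.Language.{u, v}} {M : Type w} [L.Structure M]

lemma realize_congr {α : Type d} (φ : L.Formula α) :
    ∃ F : Finset α, ∀ (M : Type w) [L.Structure M] (x y : α → M), (∀ i ∈ F, x i = y i) →
      (φ.Realize x ↔ φ.Realize y) := by
  classical
  refine ⟨φ.freeVarFinset, fun M _ x y h => ?_⟩
  have h1 := BoundedFormula.realize_restrictFreeVar (φ := φ) (f := id) (v := fun i => x i)
    (xs := default) x fun _ => rfl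
  have h2 := BoundedFormula.realize_restrictFreeVar (φ := φ) (f := id) (v := fun i => x i)
    (xs := default) y fun i => h i i.2
  exact h1.symm.trans h2

open Classical in
/-- The variables of the second kind that occur in a formula. -/
def innerVars {α : Type d} {β : Type e} (φ : L.Formula (α ⊕ β)) : Finset β :=
  φ.freeVarFinset.preimage Sum.inr Sum.inr_injective.injOn

open Classical in
/-- The restriction of the variables to those that occur in a formula. -/
def toInnerVars {α : Type d} {β : Type e} (φ : L.Formula (α ⊕ β)) :
    φ.freeVarFinset → α ⊕ innerVars φ
  | ⟨.inl a, _⟩ => .inl a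
  | ⟨.inr b, h⟩ => .inr ⟨b, Finset.mem_preimage.2 h⟩

open Classical in
/-- Existential quantification over an arbitrary family of variables. -/
def fexs {α : Type d} {β : Type e} (φ : L.Formula (α ⊕ β)) : L.Formula α :=
  Formula.iExs (innerVars φ) (φ.restrictFreeVar (toInnerVars φ))

lemma realize_fexs {α : Type d} {β : Type e} (φ : L.Formula (α ⊕ β)) [Nonempty M] (x : α → M) :
    (fexs φ).Realize x ↔ ∃ y : β → M, φ.Realize (Sum.elim x y) := by
  classical
  rw [fexs, Formula.realize_iExs]
  have key : ∀ (z : innerVars φ → M) (y : β → M), (∀ i, z i = y i) →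
      ((Formula.Realize (φ.restrictFreeVar (toInnerVars φ)) (Sum.elim x z)) ↔
          φ.Realize (Sum.elim x y)) := by
    intro z y h
    refine BoundedFormula.realize_restrictFreeVar _ ?_
    rintro ⟨i | i, hi⟩
    · rfl
    · exact h _
  constructor
  · rintro ⟨z, hz⟩
    refine ⟨fun i => if h : i ∈ innerVars φ then z ⟨i, h⟩ else Classical.arbitrary M,
      (key z _ ?_).1 hz⟩
    rintro ⟨i, hi⟩
    rw [dif_pos hi]
  · rintro ⟨y, hy⟩
    exact ⟨fun i => y i, (key _ y fun _ => rfl).2 hy⟩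

/-- The conjunction of a finite set of formulas. -/
def fconj {α : Type d} (t : Finset (L.Formula α)) : L.Formula α :=
  Formula.iInf fun φ : t => φ.1

lemma realize_fconj {α : Type d} (t : Finset (L.Formula α)) (x : α → M) :
    (fconj t).Realize x ↔ ∀ φ ∈ t, φ.Realize x := by
  simp [fconj, Formula.realize_iInf]

open Classical in
/-- A formula expressing that finitely many instances of formulas, or their negations, have a
common solution. -/
def commonSolution {N : Type e} {n : ℕ} {ι : Type d} [Finite ι] (φ : ι → L.Formula (Fin n ⊕ ℕ))
    (b : ι → ℕ → N) (ε : ι → Prop) : L.Formula N :=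
  Formula.iExs (Fin n) (Formula.iInf fun i =>
    if ε i then (φ i).relabel (Sum.elim .inr (.inl ∘ b i)) else
      ((φ i).relabel (Sum.elim .inr (.inl ∘ b i))).not)

lemma realize_commonSolution {N : Type e} {n : ℕ} {ι : Type d} [Finite ι]
    (φ : ι → L.Formula (Fin n ⊕ ℕ)) (b : ι → ℕ → N) (ε : ι → Prop) (f : N → M) :
    (commonSolution φ b ε).Realize f ↔
      ∃ e : Fin n → M, ∀ i, (φ i).Realize (Sum.elim e (f ∘ b i)) ↔ ε i := by
  rw [commonSolution, Formula.realize_iExs]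
  refine exists_congr fun e => ?_
  rw [Formula.realize_iInf]
  refine forall_congr' fun i => ?_
  have : Sum.elim f e ∘ Sum.elim .inr (.inl ∘ b i) = Sum.elim e (f ∘ b i) := by
    funext x
    cases x <;> rfl
  by_cases h : ε i
  · simp [h, Formula.realize_relabel, this]
  · simp [h, Formula.realize_relabel, this]

end FirstOrderFormulas

/-! ### Types as ultrafilter limits; compactness of type spaces and homomorphisms between them. -/

section Types

variable {L : FirstOrder.Language.{u, v}} {M : Type w} [L.Structure M]
  {N : Type w} [L.Structure N] {s : PatSort L}

lemma GammaType.exists_ultrafilter_of_finite (p : s.γ → Set (ℕ → M))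
    (h : ∀ t : Finset (s.γ × (ℕ → M)), ∃ e : Fin s.n → M, ∀ x ∈ t,
      x.1.1.Realize (Sum.elim e x.2) ↔ x.2 ∈ p x.1) :
    ∃ U : Ultrafilter (Fin s.n → M), ∀ φ b,
      b ∈ p φ ↔ ∀ᶠ e in (U : Filter _), φ.1.Realize (Sum.elim e b) := by
  obtain ⟨U, hU⟩ := exists_ultrafilter_mem (fun x : s.γ × (ℕ → M) =>
    {e : Fin s.n → M | x.1.1.Realize (Sum.elim e x.2) ↔ x.2 ∈ p x.1}) h
  refine ⟨U, fun φ b => ?_⟩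
  have h1 := hU (φ, b)
  constructor
  · intro hb
    filter_upwards [h1] with e he using he.2 hb
  · intro hb
    obtain ⟨e, he, he'⟩ := ((Filter.Eventually.and hb h1)).exists
    exact he'.1 he

/-- The type over `M` determined by an ultrafilter on tuples of `M`. -/
def GammaType.ofUltrafilter [Nonempty M] (s : PatSort L) (U : Ultrafilter (Fin s.n → M)) :
    GammaType M s :=
  ⟨fun φ => {b | ∀ᶠ e in (U : Filter _), φ.1.Realize (Sum.elim e b)}, by
    -- The type is realized in the ultrapower by the class of the coordinate functions. The
    -- ultrapower is lifted afterwards to the universe prescribed by `GammaType`.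
    let N := (U : Filter (Fin s.n → M)).Product fun _ => M
    let c : ((Fin s.n → M) → M) → N := fun x => x
    have hc : ∀ {α : Type} (φ : L.Formula α) (x : α → (Fin s.n → M) → M),
        φ.Realize (c ∘ x) ↔ ∀ᶠ e in (U : Filter _), φ.Realize fun i => x i e := fun φ x =>
      Ultraproduct.realize_formula_cast (u := U) (M := fun _ => M) φ x
    let f : M ↪ₑ[L] N := ⟨fun m => c fun _ => m, fun n φ x =>
      (hc φ fun i _ => x i).trans Filter.eventually_const⟩
    let g : ULift.{max u v} N ≃ N := Equiv.ulift
    let : L.Structure (ULift.{max u v} N) := g.symm.inducedStructure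
    let k : N ≃[L] ULift.{max u v} N := g.symm.inducedStructureEquiv
    refine ⟨ULift.{max u v} N, inferInstance, k.toElementaryEmbedding.comp f,
      fun i => k (c fun e => e i), ?_⟩
    intro φ b
    have e1 : Sum.elim (fun i => k (c fun e => e i)) (k.toElementaryEmbedding.comp f ∘ b) =
        k.toElementaryEmbedding ∘ (c ∘ Sum.elim (fun i e => e i) fun j _ => b j) := by
      funext i
      cases i <;> rfl
    rw [e1, k.toElementaryEmbedding.map_formula, hc]
    refine Filter.eventually_congr (Filter.Eventually.of_forall fun e => ?_)
    refine iff_of_eq (congrArg _ ?_)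
    funext i
    cases i <;> rfl⟩

lemma GammaType.mem_ofUltrafilter [Nonempty M] (U : Ultrafilter (Fin s.n → M)) (φ : s.γ)
    (b : ℕ → M) : b ∈ (ofUltrafilter s U).1 φ ↔
      ∀ᶠ e in (U : Filter _), φ.1.Realize (Sum.elim e b) := Iff.rfl

/-- A finite part of `p` is solvable in an elementary extension of `M`, hence in `M`, so the
solution sets generate a proper filter. -/
lemma GammaType.exists_eq_ofUltrafilter [Nonempty M] (p : GammaType M s) :
    ∃ U, p = ofUltrafilter s U := by
  obtain ⟨N, _, f, e, h⟩ := p.2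
  obtain ⟨U, hU⟩ := exists_ultrafilter_of_finite p.1 fun t => by
    have h1 := (realize_commonSolution (fun x : t => x.1.1.1) (fun x => x.1.2)
      (fun x => x.1.2 ∈ p.1 x.1.1) f).2 ⟨e, fun x => (h _ _).symm⟩
    have h2 := (f.map_formula _ id).1 h1
    obtain ⟨e', he'⟩ := (realize_commonSolution (M := M) _ _ _ id).1 h2
    exact ⟨e', fun x hx => he' ⟨x, hx⟩⟩
  exact ⟨U, Subtype.ext (funext fun φ => Set.ext fun b => hU φ b)⟩

lemma GammaType.ext {p q : GammaType M s}
    (h : ∀ φ b, b ∈ p.1 φ ↔ b ∈ q.1 φ) : p = q :=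
  Subtype.ext (funext fun φ => Set.ext (h φ))

/-- Membership of a formula in a type depends on finitely many parameters. -/
lemma GammaType.mem_congr (φ : s.γ) : ∃ F : Finset ℕ, ∀ (M : Type w) [L.Structure M]
    (p : GammaType M s) (b b' : ℕ → M), (∀ k ∈ F, b k = b' k) →
      (b ∈ p.1 φ ↔ b' ∈ p.1 φ) := by
  obtain ⟨F, hF⟩ := realize_congr φ.1
  refine ⟨F.preimage Sum.inr Sum.inr_injective.injOn, fun M _ p b b' h => ?_⟩
  obtain ⟨N, _, f, e, hp⟩ := p.2
  rw [hp, hp]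
  refine hF N _ _ ?_
  rintro (i | i) hi
  · rfl
  · exact congrArg f (h i (by simpa using hi))

open Classical in
/-- The Stone topology on types. -/
instance stoneTopology : TopologicalSpace (GammaType M s) :=
  TopologicalSpace.induced
    (fun p (x : s.γ × (ℕ → M)) => (decide (x.2 ∈ p.1 x.1) : Bool)) inferInstance

lemma GammaType.isClopen_mem (φ : s.γ) (b : ℕ → M) :
    IsClopen {p : GammaType M s | b ∈ p.1 φ} := by
  classical
  have h0 : Continuous fun (p : GammaType M s) (x : s.γ × (ℕ → M)) =>
    (decide (x.2 ∈ p.1 x.1) : Bool) := continuous_induced_dom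
  have h : Continuous fun p : GammaType M s => (decide (b ∈ p.1 φ) : Bool) :=
    (continuous_apply (φ, b)).comp h0
  have : {p : GammaType M s | b ∈ p.1 φ} =
      (fun p : GammaType M s => (decide (b ∈ p.1 φ) : Bool)) ⁻¹' {true} := by
    ext p
    simp
  rw [this]
  exact (isClopen_discrete _).preimage h

instance : T2Space (GammaType M s) := by
  refine T2Space.of_injective_continuous (f := fun p (x : s.γ × (ℕ → M)) =>
    (@decide (x.2 ∈ p.1 x.1) (Classical.propDecidable _) : Bool)) ?_ continuous_induced_dom
  intro p q h
  refine GammaType.ext fun φ b => ?_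
  simpa using congrFun h (φ, b)

/-- The type space is the continuous image, under `GammaType.ofUltrafilter`, of the compact space of
ultrafilters. -/
instance [Nonempty M] : CompactSpace (GammaType M s) := by
  classical
  have hc : Continuous (GammaType.ofUltrafilter (M := M) s) := by
    refine continuous_induced_rng.2 (continuous_pi fun x => ?_)
    refine (continuous_bool_rng true).2 ?_
    have : (((fun p (x : s.γ × (ℕ → M)) => (decide (x.2 ∈ p.1 x.1) : Bool)) ∘
        GammaType.ofUltrafilter (M := M) s) · x) ⁻¹' {true} =
        {U | {e | x.1.1.Realize (Sum.elim e x.2)} ∈ U} := by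
      ext U
      simp only [Function.comp_apply, Set.mem_preimage, Set.mem_singleton_iff, decide_eq_true_eq]
      rfl
    rw [this]
    exact ⟨ultrafilter_isClosed_basic _, ultrafilter_isOpen_basic _⟩
  rw [← isCompact_univ_iff]
  have : (Set.univ : Set (GammaType M s)) =
      Set.range (GammaType.ofUltrafilter (M := M) s) := by
    ext p
    obtain ⟨U, rfl⟩ := p.exists_eq_ofUltrafilter
    simp
  rw [this]
  exact isCompact_range hc

lemma nonempty_typeSpace (M : Type w) [L.Structure M] [Nonempty M] (s : (patLang L).Sorts) :
    Nonempty ((typeSpace M).carrier s) :=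
  ⟨GammaType.ofUltrafilter (L := L) s (pure fun _ => Classical.arbitrary M)⟩

lemma GammaType.isClopen_Mem (φ : PatFormula L) (b : ℕ → M) :
    IsClopen {p : GammaType M φ.sort | GammaType.Mem φ b p} := by
  have h := GammaType.isClopen_mem φ.φ (b ∘ φ.ρ)
  by_cases hp : φ.pos = true
  · simpa [GammaType.Mem, hp] using h
  · simp only [GammaType.Mem, hp]
    simpa [Set.compl_def] using h.compl

/-- This is where the negation in $\mathcal R_t$ matters: for each parameter tuple, containing
finitely many given formulas is a clopen condition, and $\mathcal R_t$ is an intersection of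
complements of such conditions. Equality is closed because the space is Hausdorff. -/
lemma isClosed_atom {X : Type*} [TopologicalSpace X] {V : PatSort L → Type d}
    (α : Atom (patLang L) V) (F : X → ∀ s, V s → GammaType M s)
    (hF : ∀ s i, Continuous fun x => F x s i) :
    IsClosed {x | α.Realize (typeSpace M) (F x)} := by
  cases α with
  | rel t i =>
    have : {x | Atom.Realize (typeSpace M) (F x) (.rel t i)} =
        ⋂ b : {b : ℕ → M // t.α.Realize b},
          (⋂ l : Fin t.k, {x | GammaType.Mem (t.φ l) b.1 (F x _ (i l))})ᶜ := by
      ext x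
      simp only [Set.mem_ofPred_eq, Set.mem_iInter, Set.mem_compl_iff, Subtype.forall]
      exact ⟨fun h b hb h' => h ⟨b, hb, h'⟩, fun h ⟨b, hb, h'⟩ => h b hb h'⟩
    rw [this]
    refine isClosed_iInter fun b => ?_
    refine (isOpen_iInter_of_finite fun l => ?_).isClosed_compl
    exact (GammaType.isClopen_Mem (t.φ l) b.1).isOpen.preimage (hF _ _)
  | @eq s i j =>
    let s' : PatSort L := s 
    exact (isClosed_eq (hF s' i) (hF s' j) : IsClosed {x | (F x s' i : GammaType M s') = F x s' j})

/-- The quantified variables range over a compact product, and projection along a compact factor is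
a closed map. -/
lemma isClosed_realize [Nonempty M] {X : Type*} [TopologicalSpace X] {V : PatSort L → Type d}
    (φ : PP (patLang L) V) (F : X → ∀ s, V s → GammaType M s)
    (hF : ∀ s i, Continuous fun x => F x s i) :
    IsClosed {x | φ.Realize (typeSpace M) (F x)} := by
  let σ : Fin φ.n → PatSort L := φ.σ
  let C : Set (X × ∀ i, GammaType M (σ i)) :=
    ⋂ α ∈ φ.atoms, {z | α.Realize (typeSpace M) fun s =>
      Sum.elim (F z.1 s) (tuple z.2 s)}
  have hC : IsClosed C := by
    refine isClosed_biInter fun α _ => ?_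
    refine isClosed_atom α (fun (z : X × ∀ i, GammaType M (σ i)) s =>
      Sum.elim (F z.1 s) (tuple z.2 s)) ?_
    rintro s (i | ⟨i, rfl⟩)
    · exact (hF s i).comp continuous_fst
    · exact (continuous_apply i).comp continuous_snd
  have : {x | φ.Realize (typeSpace M) (F x)} = Prod.fst '' C := by
    ext x
    simp only [C, Set.mem_image, Set.mem_iInter, Set.mem_ofPred_eq, Prod.exists, exists_and_right,
      exists_eq_right]
    rfl
  rw [this]
  exact isClosedMap_fst_of_compactSpace _ hC

/-- Type spaces are positively compact. -/
lemma exists_realize_of_finite [Nonempty M] {V : PatSort L → Type d}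
    (Γ : Set (PP (patLang L) fun s => V s ⊕ GammaType M s))
    (h : ∀ l : List (PP (patLang L) fun s => V s ⊕ GammaType M s),
      (∀ φ ∈ l, φ ∈ Γ) → ∃ x : ∀ s, V s → GammaType M s, ∀ φ ∈ l,
        φ.Realize (typeSpace M) fun s => Sum.elim (x s) id) :
    ∃ x : ∀ s, V s → GammaType M s, ∀ φ ∈ Γ,
      φ.Realize (typeSpace M) fun s => Sum.elim (x s) id := by
  let X := ∀ p : Σ s, V s, GammaType M p.1
  let C : Γ → Set X := fun φ =>
    {x | φ.1.Realize (typeSpace M) fun s => Sum.elim (fun i => x ⟨s, i⟩) id}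
  have hC : ∀ φ, IsClosed (C φ) := by
    intro φ
    refine isClosed_realize φ.1 (fun (x : X) s => Sum.elim (fun i => x ⟨s, i⟩) id) ?_
    rintro s (i | i)
    · exact continuous_apply (A := fun p : Σ s, V s => GammaType M p.1)
        (⟨s, i⟩ : Σ s, V s)
    · exact continuous_const
  obtain ⟨x, hx⟩ := CompactSpace.iInter_nonempty hC fun t => by
    obtain ⟨x, hx⟩ := h (t.toList.map Subtype.val) (by simp; tauto)
    refine ⟨fun p => x p.1 p.2, Set.mem_iInter₂.2 fun φ hφ => ?_⟩
    exact hx φ.1 (List.mem_map.2 ⟨φ, Finset.mem_toList.2 hφ, rfl⟩)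
  exact ⟨fun s i => x ⟨s, i⟩, fun φ hφ => Set.mem_iInter.1 hx ⟨φ, hφ⟩⟩

/-- An ultrafilter of maps `N → M` that is elementary in the limit. -/
def IsApprox (L : FirstOrder.Language.{u, v}) {N M : Type*} [L.Structure N] [L.Structure M]
    {I : Type*} (U : Ultrafilter I) (f : I → N → M) : Prop :=
  ∀ ψ : L.Formula N, ψ.Realize (id : N → N) → ∀ᶠ i in (U : Filter I), ψ.Realize (f i)

lemma IsApprox.realize {I : Type*} {U : Ultrafilter I} {f : I → N → M} (h : IsApprox L U f)
    {α : Type*} (ψ : L.Formula α) (x : α → N) :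
    (∀ᶠ i in (U : Filter I), ψ.Realize (f i ∘ x)) ↔ ψ.Realize x := by
  have key : ∀ ψ : L.Formula α, ψ.Realize x → ∀ᶠ i in (U : Filter I), ψ.Realize (f i ∘ x) := by
    intro ψ hψ
    have := h (ψ.relabel x) (by rwa [Formula.realize_relabel])
    simpa only [Formula.realize_relabel] using this
  refine ⟨fun h1 => ?_, key ψ⟩
  by_contra h2
  obtain ⟨i, hi, hi'⟩ := (h1.and (key ψ.not (by rwa [Formula.realize_not]))).exists
  rw [Formula.realize_not] at hi'
  exact hi' hi

/-- A finite part of the pulled back type is solvable over $f_i\circ b$ in `M` for almost all `i`.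
Solvability is a first-order statement about the parameters, so it passes to `N` in the limit. -/
lemma IsApprox.exists_ultrafilter [Nonempty M] {I : Type*} {U : Ultrafilter I} {f : I → N → M}
    (h : IsApprox L U f) (s : PatSort L) (p : GammaType M s) :
    ∃ W : Ultrafilter (Fin s.n → N), ∀ φ b, (∀ᶠ i in (U : Filter I), f i ∘ b ∈ p.1 φ) ↔
      ∀ᶠ e in (W : Filter _), φ.1.Realize (Sum.elim e b) := by
  refine GammaType.exists_ultrafilter_of_finite (s := s)
    (fun φ => {b : ℕ → N | ∀ᶠ i in (U : Filter I), f i ∘ b ∈ p.1 φ}) fun t => ?_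
  have h1 : ∀ᶠ i in (U : Filter I), ∀ x : t, (f i ∘ x.1.2 ∈ p.1 x.1.1 ↔
      ∀ᶠ i in (U : Filter I), f i ∘ x.1.2 ∈ p.1 x.1.1) := by
    refine Filter.eventually_all.2 fun x => ?_
    by_cases hx : ∀ᶠ i in (U : Filter I), f i ∘ x.1.2 ∈ p.1 x.1.1
    · filter_upwards [hx] with i hi using iff_of_true hi hx
    · filter_upwards [Ultrafilter.eventually_not.2 hx] with i hi using iff_of_false hi hx
  obtain ⟨W, hW⟩ := GammaType.exists_eq_ofUltrafilter p
  have h2 : ∀ᶠ i in (U : Filter I), (commonSolution (fun x : t => x.1.1.1) (fun x => x.1.2)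
      fun x => ∀ᶠ i in (U : Filter I), f i ∘ x.1.2 ∈ p.1 x.1.1).Realize (f i) := by
    filter_upwards [h1] with i hi
    rw [realize_commonSolution]
    have h3 : ∀ᶠ e in (W : Filter _), ∀ x : t,
        (x.1.1.1.Realize (Sum.elim e (f i ∘ x.1.2)) ↔ f i ∘ x.1.2 ∈ p.1 x.1.1) := by
      refine Filter.eventually_all.2 fun x => ?_
      have h4 : f i ∘ x.1.2 ∈ p.1 x.1.1 ↔
          ∀ᶠ e in (W : Filter _), x.1.1.1.Realize (Sum.elim e (f i ∘ x.1.2)) := by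
        rw [hW]
        exact GammaType.mem_ofUltrafilter W x.1.1 (f i ∘ x.1.2)
      by_cases hx : f i ∘ x.1.2 ∈ p.1 x.1.1
      · filter_upwards [h4.1 hx] with e he using iff_of_true he hx
      · filter_upwards [Ultrafilter.eventually_not.2 (mt h4.2 hx)] with e he using
          iff_of_false he hx
    obtain ⟨e, he⟩ := h3.exists
    exact ⟨e, fun x => (he x).trans (hi x)⟩
  obtain ⟨e, he⟩ := (realize_commonSolution _ _ _ id).1 ((h.realize _ id).1 h2)
  exact ⟨e, fun x hx => he ⟨x, hx⟩⟩

/-- The homomorphism of type spaces induced by an ultrafilter of maps. -/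
def IsApprox.hom [Nonempty M] [Nonempty N] {I : Type*} {U : Ultrafilter I} {f : I → N → M}
    (h : IsApprox L U f) : Hom (typeSpace (L := L) M) (typeSpace N) where
  toFun s p := ⟨fun φ => {b | ∀ᶠ i in (U : Filter I), f i ∘ b ∈ p.1 φ}, by
    obtain ⟨W, hW⟩ := h.exists_ultrafilter s p
    have e : (fun φ => {b | ∀ᶠ i in (U : Filter I), f i ∘ b ∈ p.1 φ}) =
        (GammaType.ofUltrafilter (L := L) s W).1 := funext fun φ => Set.ext fun b => hW φ b
    exact e ▸ (GammaType.ofUltrafilter (L := L) s W).2⟩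
  map_rel t p hp := by
    rintro ⟨b, hb, hb'⟩
    have h1 := (h.realize t.α b).2 hb
    have h2 : ∀ᶠ i in (U : Filter I), ∀ l : Fin t.k, GammaType.Mem (t.φ l) (f i ∘ b) (p l) := by
      refine Filter.eventually_all.2 fun l => ?_
      have h3 := hb' l
      by_cases hl : (t.φ l).pos = true
      · have h4 : ∀ᶠ i in (U : Filter I), f i ∘ (b ∘ (t.φ l).ρ) ∈ (p l).1 (t.φ l).φ := h3.2 hl
        filter_upwards [h4] with i hi using iff_of_true hi hl
      · have h4 : ¬ ∀ᶠ i in (U : Filter I), f i ∘ (b ∘ (t.φ l).ρ) ∈ (p l).1 (t.φ l).φ :=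
          mt h3.1 hl
        filter_upwards [Ultrafilter.eventually_not.2 h4] with i hi using iff_of_false hi hl
    obtain ⟨i, hi, hi'⟩ := (h1.and h2).exists
    exact hp ⟨_, hi, hi'⟩

lemma IsApprox.mem_hom [Nonempty M] [Nonempty N] {I : Type*} {U : Ultrafilter I} {f : I → N → M}
    (h : IsApprox L U f) (p : GammaType M s) (φ : s.γ) (b : ℕ → N) :
    b ∈ (h.hom.toFun s p : GammaType N s).1 φ ↔
      ∀ᶠ i in (U : Filter I), f i ∘ b ∈ p.1 φ := Iff.rfl

/-- Each finite part of the elementary diagram of `N` is satisfiable in `M`, since its existential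
closure is a sentence true in `N`. -/
lemma exists_isApprox [Nonempty M] [Nonempty N] (h : M ≅[L] N) :
    ∃ U : Ultrafilter (N → M), IsApprox L U fun f => f := by
  have hfin : ∀ t : Finset {ψ : L.Formula N // ψ.Realize (id : N → N)},
      ∃ f : N → M, ∀ ψ ∈ t, f ∈ {f : N → M | ψ.1.Realize f} := by
    intro t
    let χ : L.Formula (Empty ⊕ N) := (Formula.iInf fun ψ : t => ψ.1.1).relabel .inr
    have key : ∀ (K : Type w) [L.Structure K] [Nonempty K],
        (K ⊨ (fexs χ : L.Sentence)) ↔ ∃ f : N → K, ∀ ψ ∈ t, ψ.1.Realize f := by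
      intro K _ _
      refine (realize_fexs χ _).trans (exists_congr fun f => ?_)
      simp only [χ, Formula.realize_relabel, Sum.elim_comp_inr, Formula.realize_iInf]
      exact ⟨fun h ψ hψ => h ⟨ψ, hψ⟩, fun h ψ => h ψ.1 ψ.2⟩
    exact (key M).1 ((elementarilyEquivalent_iff.1 h _).2 ((key N).2 ⟨id, fun ψ _ => ψ.2⟩))
  obtain ⟨U, hU⟩ := exists_ultrafilter_mem _ hfin
  exact ⟨U, fun ψ hψ => hU ⟨ψ, hψ⟩⟩

/-- The restriction of types along an elementary embedding. -/
def restrictHom [Nonempty M] [Nonempty N] (f : N ↪ₑ[L] M) :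
    Hom (typeSpace (L := L) M) (typeSpace N) :=
  IsApprox.hom (I := Unit) (U := pure ()) (f := fun _ => f) fun ψ hψ =>
    (f.map_formula ψ id).2 hψ

end Types

/-! ### The common theory of the type spaces, and homomorphisms from its models. -/

section Models

variable {L : FirstOrder.Language.{u, v}} {T : L.Theory}

lemma nonempty_hom_typeSpace (hT : T.IsComplete) (M N : Type w) [L.Structure M] [L.Structure N]
    [Nonempty M] [Nonempty N] (hM : M ⊨ T) (hN : N ⊨ T) :
    Nonempty (Hom (typeSpace (L := L) M) (typeSpace N)) := by
  have h : M ≅[L] N := elementarilyEquivalent_iff.2 fun φ =>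
    (hT.realize_sentence_iff φ M).trans (hT.realize_sentence_iff φ N).symm
  obtain ⟨U, hU⟩ := exists_isApprox h
  exact ⟨hU.hom⟩

lemma isModel_puTheory {𝓛 : RelLang.{a, b}} (A : Str.{a, b, c} 𝓛) : A.IsModel A.puTheory :=
  fun _ h => h

lemma puTheory_typeSpace (hT : T.IsComplete) (M : Type (max u v w)) [L.Structure M] [Nonempty M]
    (hM : M ⊨ T) : (typeSpace.{u, v, max u v w} M).puTheory = patTheory.{u, v, w} T := by
  ext φ
  refine ⟨fun h N _ _ hN hφ => ?_, fun h => h M hM⟩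
  obtain ⟨f⟩ := nonempty_hom_typeSpace hT N M hN hM
  exact h (hφ.hom f)

/-- Every model of the primitive universal theory of a type space maps to the type space. -/
lemma nonempty_hom_of_isModel {M : Type w} [L.Structure M]
    [Nonempty M] {A : Str.{max u v, max u v, max u v w} (patLang L)}
    (hA : A.IsModel (typeSpace M).puTheory) : Nonempty (Hom A (typeSpace M)) := by
  let C : (Σ R, {x // A.rel R x}) → PP (patLang L) fun s => A.carrier s ⊕ GammaType M s := fun z =>
    PP.ofAtoms [.rel z.1 fun i => .inl (z.2.1 i)]
  obtain ⟨x, hx⟩ := exists_realize_of_finite (M := M) (Set.range C) fun l hl => by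
    have : ∃ l' : List (Σ R, {x // A.rel R x}), l'.map C = l := by
      have : l ∈ Set.range (List.map C) := by
        rw [Set.range_list_map]
        exact hl
      exact this
    obtain ⟨l', rfl⟩ := this
    -- Reading the elements of `A` as quantified variables turns finitely many relations true in `A`
    -- into a pp sentence true in `A`, hence true in the type space.
    let φ : PP (patLang L) fun s => Empty ⊕ A.carrier s :=
      PP.ofAtoms (l'.map fun z => .rel z.1 fun i => .inr (z.2.1 i))
    let φ' : PPSentence (patLang L) := φ.exs
    have hφ : A.Sat φ' := by
      refine PP.realize_exs_of (fun _ => id) ?_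
      simp only [φ, PP.realize_ofAtoms, List.forall_mem_map]
      exact fun z _ => z.2.2
    have hφ' : (typeSpace M).Sat φ' := by
      by_contra h
      exact hA φ' h hφ
    obtain ⟨x, hx⟩ := PP.exists_of_realize_exs (nonempty_typeSpace M) hφ'
    refine ⟨x, ?_⟩
    simp only [φ, PP.realize_ofAtoms, List.forall_mem_map] at hx
    simp only [C, List.forall_mem_map, PP.realize_ofAtoms, List.mem_singleton, forall_eq]
    exact hx
  refine ⟨⟨x, fun R y hy => ?_⟩⟩
  have := hx _ ⟨⟨R, y, hy⟩, rfl⟩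
  simp only [C, PP.realize_ofAtoms, List.mem_singleton, forall_eq] at this
  exact this

end Models

/-! ### Minimal left ideals, and the formal properties of cores. -/

section Semigroups

/-- A compact right topological semigroup has an idempotent in a minimal left ideal. -/
lemma exists_idempotent_minimal {E : Type*} [Nonempty E] [Semigroup E] [TopologicalSpace E]
    [CompactSpace E] [T2Space E] (hc : ∀ r : E, Continuous (· * r)) :
    ∃ u : E, u * u = u ∧ ∀ e : E, ∃ e' : E, e' * (e * u) = u := by
  let S : Set (Set E) := {I | IsClosed I ∧ I.Nonempty ∧ ∀ e, ∀ f ∈ I, e * f ∈ I}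
  obtain ⟨I, -, hI⟩ := zorn_superset_nonempty S (fun C hC hchain hne => by
    have : Nonempty C := hne.to_subtype
    refine ⟨⋂₀ C, ⟨isClosed_sInter fun I hI => (hC hI).1, ?_, fun e f hf I hI => ?_⟩,
      fun I hI => Set.sInter_subset_of_mem hI⟩
    · rw [Set.sInter_eq_iInter]
      refine IsCompact.nonempty_iInter_of_directed_nonempty_isCompact_isClosed _
        (DirectedOn.directed_val (IsChain.directedOn hchain.symm)) (fun I => (hC I.2).2.1)
        (fun I => (hC I.2).1.isCompact) fun I => (hC I.2).1
    · exact (hC hI).2.2 e f (hf I hI)) Set.univ ⟨isClosed_univ, Set.univ_nonempty, by simp⟩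
  -- `E * f` is a closed left ideal contained in `I`, so it equals `I` by minimality.
  have hr : ∀ f ∈ I, Set.range (fun e => e * f) = I := by
    intro f hf
    refine hI.eq_of_subset ⟨(isCompact_range (hc f)).isClosed, Set.range_nonempty _, ?_⟩ ?_
    · rintro e _ ⟨e', rfl⟩
      exact ⟨e * e', mul_assoc _ _ _⟩
    · rintro _ ⟨e, rfl⟩
      exact hI.prop.2.2 e f hf
  obtain ⟨u, hu, huu⟩ := exists_idempotent_in_compact_subsemigroup hc I hI.prop.2.1
    hI.prop.1.isCompact fun x _ y hy => hI.prop.2.2 x y hy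
  refine ⟨u, huu, fun e => ?_⟩
  rw [← hr (e * u) (hI.prop.2.2 e u hu)] at hu
  exact hu

end Semigroups

section Cores

variable {𝓛 : RelLang.{a, b}}

/-- A universal model such that all homomorphisms from it to models split. -/
structure IsCore (Θ : PUTheory 𝓛) (J : Str.{a, b, c} 𝓛) : Prop where
  isModel : J.IsModel Θ
  universal : ∀ B : Str.{a, b, c} 𝓛, B.IsModel Θ → Nonempty (Hom B J)
  split : ∀ B : Str.{a, b, c} 𝓛, B.IsModel Θ → ∀ f : Hom J B,
    ∃ g : Hom B J, ∀ s x, g.toFun s (f.toFun s x) = x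

lemma IsCore.isUniversalEC {Θ : PUTheory 𝓛} {J : Str.{a, b, c} 𝓛} (hJ : IsCore Θ J) :
    IsUniversalEC Θ J := by
  refine ⟨⟨hJ.isModel, fun B hB f n σ φ x h => ?_⟩, hJ.universal⟩
  obtain ⟨g, hg⟩ := hJ.split B hB f
  have := PP.realize_hom g φ _ h
  convert this using 1
  funext s i
  rw [comp_tuple f.toFun, hg]

/-- Splitting gives one composite. For the other, `k` is injective because existential closedness of
`J'` reflects equality. -/
lemma IsCore.exists_inverse {Θ : PUTheory 𝓛} {J J' : Str.{a, b, c} 𝓛} (hJ : IsCore Θ J)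
    (hJ' : IsUniversalEC Θ J') : ∃ (h : Hom J J') (k : Hom J' J),
      (∀ s x, k.toFun s (h.toFun s x) = x) ∧ ∀ s x, h.toFun s (k.toFun s x) = x := by
  obtain ⟨h⟩ := hJ'.2 J hJ.isModel
  obtain ⟨k, hk⟩ := hJ.split J' hJ'.1.1 h
  refine ⟨h, k, hk, fun s x => ?_⟩
  have := hJ'.1.reflect hJ.isModel k
    (V := fun t => {i : Bool // s = t}) (PP.ofAtoms [.eq (s := s) ⟨true, rfl⟩ ⟨false, rfl⟩])
    (fun t i => i.2 ▸ cond i.1 (h.toFun s (k.toFun s x)) x)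
    (by simpa [PP.realize_ofAtoms, Atom.Realize] using hk s _)
  simpa [PP.realize_ofAtoms, Atom.Realize] using this

lemma IsCore.nonempty_iso {Θ : PUTheory 𝓛} {J J' : Str.{a, b, c} 𝓛} (hJ : IsCore Θ J)
    (hJ' : IsUniversalEC Θ J') : Nonempty (Iso J J') := by
  obtain ⟨h, k, hk, hh⟩ := hJ.exists_inverse hJ'
  refine ⟨⟨fun s => ⟨h.toFun s, k.toFun s, hk s, hh s⟩, fun R x => ⟨h.map_rel R x, fun hx => ?_⟩⟩⟩
  have := k.map_rel R _ hx
  simpa [hk] using this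

lemma IsCore.of_isUniversalEC {Θ : PUTheory 𝓛} {J J' : Str.{a, b, c} 𝓛} (hJ : IsCore Θ J)
    (hJ' : IsUniversalEC Θ J') : IsCore Θ J' := by
  obtain ⟨h, k, hk, hh⟩ := hJ.exists_inverse hJ'
  refine ⟨hJ'.1.1, hJ'.2, fun B hB f => ?_⟩
  obtain ⟨g, hg⟩ := hJ.split B hB (f.comp h)
  refine ⟨h.comp g, fun s x => ?_⟩
  have := hg s (k.toFun s x)
  simp only [Hom.comp, hh] at this ⊢
  rw [this, hh]

/-- `f` has a left inverse `g`, which itself has a left inverse; so `g` is a two-sided inverse of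
`f`. -/
lemma IsCore.exists_aut {Θ : PUTheory 𝓛} {J : Str.{a, b, c} 𝓛} (hJ : IsCore Θ J) (f : Hom J J) :
    ∃ g : Aut J, ∀ s x, g.app s x = f.toFun s x := by
  obtain ⟨g, hg⟩ := hJ.split J hJ.isModel f
  obtain ⟨h, hh⟩ := hJ.split J hJ.isModel g
  have hf : ∀ s x, f.toFun s (g.toFun s x) = x := by
    intro s x
    have h1 := hh s (f.toFun s (g.toFun s x))
    rw [hg, hh] at h1
    exact h1.symm
  refine ⟨⟨fun s => ⟨f.toFun s, g.toFun s, hg s, hf s⟩, fun R x => ⟨fun hx => ?_, f.map_rel R x⟩⟩,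
    fun s x => rfl⟩
  have := g.map_rel R _ hx
  simpa [hg] using this

lemma IsCore.exists_retraction {Θ : PUTheory 𝓛} {J S : Str.{a, b, c} 𝓛} (hJ : IsCore Θ J)
    (hS : S.IsModel Θ) (j : Hom J S) : ∃ r : Hom S J, ∀ s x, r.toFun s (j.toFun s x) = x :=
  hJ.split S hS j

end Cores

/-! ### Existence of the core inside a type space. -/

section Existence

variable {L : FirstOrder.Language.{u, v}} (M : Type w) [L.Structure M]

/-- The endomorphisms of a type space. -/
abbrev TypeSpaceEnd (L : FirstOrder.Language.{u, v}) (M : Type w) [L.Structure M] :=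
  Hom (typeSpace (L := L) M) (typeSpace M)

lemma Hom.ext {𝓛 : RelLang.{a, b}} {A B : Str.{a, b, c} 𝓛} {f g : Hom A B}
    (h : ∀ s x, f.toFun s x = g.toFun s x) : f = g := by
  cases f
  cases g
  congr 1
  funext s x
  exact h s x

instance : Semigroup (TypeSpaceEnd L M) where
  mul f g := f.comp g
  mul_assoc _ _ _ := rfl

/-- The values of an endomorphism of a type space. -/
def endValues (f : TypeSpaceEnd L M) (p : Σ s : PatSort L, GammaType M s) : GammaType M p.1 :=
  f.toFun p.1 p.2

/-- The topology of pointwise convergence on the endomorphisms of a type space. -/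
instance : TopologicalSpace (TypeSpaceEnd L M) :=
  TopologicalSpace.induced (endValues M) inferInstance

lemma endValues_injective : Function.Injective (endValues (L := L) M) := fun _ _ h =>
  Hom.ext fun s x => congrFun h ⟨s, x⟩

instance : T2Space (TypeSpaceEnd L M) :=
  T2Space.of_injective_continuous (endValues_injective M) continuous_induced_dom

/-- Preservation of atomic relations is a closed condition, so the endomorphisms form a closed
subset of a product of compact spaces. -/
instance [Nonempty M] : CompactSpace (TypeSpaceEnd L M) := by
  have h : Topology.IsClosedEmbedding (endValues (L := L) M) := by
    refine ⟨⟨⟨rfl⟩, endValues_injective M⟩, ?_⟩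
    have : Set.range (endValues (L := L) M) = ⋂ z : Σ R, {x // (typeSpace (L := L) M).rel R x},
        {y | Atom.Realize (typeSpace (L := L) M) (V := (typeSpace (L := L) M).carrier)
          (fun s p => y ⟨s, p⟩) (.rel z.1 z.2.1)} := by
      ext y
      simp only [Set.mem_range, Set.mem_iInter]
      refine ⟨?_, fun h => ⟨⟨fun s p => y ⟨s, p⟩, fun R x hx => h ⟨R, x, hx⟩⟩, rfl⟩⟩
      rintro ⟨f, rfl⟩ ⟨R, x, hx⟩
      exact f.map_rel R x hx
    rw [this]
    refine isClosed_iInter fun z => isClosed_atom _ _ fun s p => ?_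
    exact continuous_apply (A := fun p : Σ s : PatSort L, GammaType M s => GammaType M p.1)
      (⟨s, p⟩ : Σ s : PatSort L, GammaType M s)
  exact h.compactSpace

lemma exists_minimal_endomorphism [Nonempty M] : ∃ u : TypeSpaceEnd L M,
    u.comp u = u ∧ ∀ e : TypeSpaceEnd L M, ∃ e' : TypeSpaceEnd L M, e'.comp (e.comp u) = u := by
  have : Nonempty (TypeSpaceEnd L M) := ⟨Hom.id _⟩
  -- The value of `f ∘ r` at `p` is the value of `f` at `r p`, a coordinate of `f`; for left
  -- multiplication there is no such reason.
  have hc : ∀ r : TypeSpaceEnd L M, Continuous fun f : TypeSpaceEnd L M => f * r := by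
    intro r
    refine continuous_induced_rng.2 (continuous_pi fun p => ?_)
    have h : Continuous (endValues (L := L) M) := continuous_induced_dom
    exact (continuous_apply (A := fun p : Σ s : PatSort L, GammaType M s => GammaType M p.1)
      (⟨p.1, r.toFun p.1 p.2⟩ : Σ s : PatSort L, GammaType M s)).comp h
  exact exists_idempotent_minimal hc

/-- A core exists. -/
lemma exists_isCore [Nonempty M] : ∃ J : Str.{max u v, max u v, max u v w} (patLang L),
    IsCore (typeSpace (L := L) M).puTheory J := by
  obtain ⟨u, hu, hmin⟩ := exists_minimal_endomorphism (L := L) M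
  have huu : ∀ s p, u.toFun s (u.toFun s p) = u.toFun s p := fun s p =>
    congrArg (fun f : TypeSpaceEnd L M => f.toFun s p) hu
  -- The fixed points of the idempotent `u` are its image, with the relations of the type space.
  let J : Str.{max u v, max u v, max u v w} (patLang L) :=
    ⟨fun s => {p : (typeSpace M).carrier s // u.toFun s p = p},
      fun R x => (typeSpace M).rel R fun i => (x i).1⟩
  let i : Hom J (typeSpace M) := ⟨fun s p => p.1, fun R x h => h⟩
  let r : Hom (typeSpace M) J := ⟨fun s p => ⟨u.toFun s p, huu s p⟩, fun R x h => u.map_rel R x h⟩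
  refine ⟨J, (isModel_puTheory _).of_hom i, fun B hB => ?_, fun B hB f => ?_⟩
  · obtain ⟨k⟩ := nonempty_hom_of_isModel hB
    exact ⟨r.comp k⟩
  -- Closing the circle from `J` through `B` back to the type space gives the endomorphism `k ∘ f ∘
  -- r`. Minimality of `u` undoes it on the image of `u`, so `r ∘ e ∘ k` is a left inverse of `f`.
  · obtain ⟨k⟩ := nonempty_hom_of_isModel hB
    obtain ⟨e, he⟩ := hmin ((k.comp f).comp r)
    refine ⟨r.comp (e.comp k), fun s x => Subtype.ext ?_⟩
    have h1 := congrArg (fun f : TypeSpaceEnd L M => f.toFun s x.1) he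
    have h2 : r.toFun s (u.toFun s x.1) = x := Subtype.ext ((huu s x.1).trans x.2)
    simp only [Hom.comp, h2] at h1
    change u.toFun s (e.toFun s (k.toFun s (f.toFun s x))) = x.1
    rw [h1, huu, x.2]

end Existence

/-! ### Positive types of automorphisms and compactness of the automorphism group. -/

section CompactCores

variable {𝓛 : RelLang.{a, b}}

/-- The properties of the core on which the topology of its automorphism group depends. -/
structure IsCompactCore (J : Str.{a, b, c} 𝓛) : Prop where
  nonempty : ∀ s, Nonempty (J.carrier s)
  compact : ∀ (V : 𝓛.Sorts → Type c) (Γ : Set (PP 𝓛 fun s => V s ⊕ J.carrier s)),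
    (∀ l : List (PP 𝓛 fun s => V s ⊕ J.carrier s), (∀ φ ∈ l, φ ∈ Γ) →
      ∃ x : ∀ s, V s → J.carrier s, ∀ φ ∈ l, φ.Realize J fun s => Sum.elim (x s) id) →
    ∃ x : ∀ s, V s → J.carrier s, ∀ φ ∈ Γ, φ.Realize J fun s => Sum.elim (x s) id
  exists_aut : ∀ f : Hom J J, ∃ g : Aut J, ∀ s x, g.app s x = f.toFun s x
  exists_or : ∀ (V : 𝓛.Sorts → Type c) (φ ψ : PP 𝓛 V), ∃ χ : PP 𝓛 V,
    ∀ v, χ.Realize J v ↔ φ.Realize J v ∨ ψ.Realize J v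
  exists_false : ∃ φ : PPSentence 𝓛, ¬ J.Sat φ

variable {J : Str.{a, b, c} 𝓛} {I : Type}

/-- The atomic formulas, in variables for the images of the elements of `J` under a family of
maps, that are true for automorphisms. -/
def diagram (J : Str.{a, b, c} 𝓛) (I : Type) (U : 𝓛.Sorts → Type d) :
    Set (PP 𝓛 fun s => U s ⊕ I × J.carrier s) :=
  {φ | ∃ (i : I) (R : 𝓛.Rel) (x : ∀ k, J.carrier (𝓛.dom R k)), J.rel R x ∧
    φ = PP.ofAtoms [.rel R fun k => .inr (i, x k)]}

/-- The assignment given by a family of automorphisms. -/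
def autEval {U : 𝓛.Sorts → Type d} (u : ∀ s, U s → J.carrier s) (g : I → Aut J) (s : 𝓛.Sorts) :
    U s ⊕ I × J.carrier s → J.carrier s :=
  Sum.elim (u s) fun p => (g p.1).app s p.2

lemma realize_of_mem_diagram {U : 𝓛.Sorts → Type d} (u : ∀ s, U s → J.carrier s) (g : I → Aut J)
    {φ : PP 𝓛 fun s => U s ⊕ I × J.carrier s} (h : φ ∈ diagram J I U) :
    φ.Realize J (autEval u g) := by
  obtain ⟨i, R, x, hx, rfl⟩ := h
  rw [PP.realize_ofAtoms]
  simp only [List.mem_singleton, forall_eq]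
  exact (g i).toHom.map_rel R x hx

/-- Realization of a positive type by automorphisms. -/
lemma IsCompactCore.exists_auts (hJ : IsCompactCore J) {U : 𝓛.Sorts → Type d}
    (u : ∀ s, U s → J.carrier s) (Γ : Set (PP 𝓛 fun s => U s ⊕ I × J.carrier s))
    (h : ∀ l : List (PP 𝓛 fun s => U s ⊕ I × J.carrier s),
      (∀ φ ∈ l, φ ∈ Γ ∪ diagram J I U) → (PP.conj l).exs.Realize J u) :
    ∃ g : I → Aut J, ∀ φ ∈ Γ, φ.Realize J (autEval u g) := by
  let m (s) : U s ⊕ I × J.carrier s → I × J.carrier s ⊕ J.carrier s :=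
    Sum.elim (fun x => .inr (u s x)) .inl
  have hm : ∀ (x : ∀ s, I × J.carrier s → J.carrier s) (φ : PP 𝓛 fun s => U s ⊕ I × J.carrier s),
      (φ.map m).Realize J (fun s => Sum.elim (x s) id) ↔
        φ.Realize J fun s => Sum.elim (u s) (x s) := by
    intro x φ
    rw [PP.realize_map]
    have : (fun s y => Sum.elim (x s) id (m s y)) = fun s => Sum.elim (u s) (x s) := by
      funext s y
      cases y <;> rfl
    rw [this]
  -- The unknowns are all values of all the maps: the variable `(i, a)` stands for the image of `a`
  -- under the `i`-th map. The diagram formulas make each map an endomorphism, hence an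
  -- automorphism.
  obtain ⟨x, hx⟩ := hJ.compact (fun s => I × J.carrier s)
    (PP.map m '' (Γ ∪ diagram J I U)) fun l hl => by
    have : ∃ l' : List (PP 𝓛 fun s => U s ⊕ I × J.carrier s),
        (∀ φ ∈ l', φ ∈ Γ ∪ diagram J I U) ∧ l'.map (PP.map m) = l := by
      have : l ∈ Set.range (List.map fun φ : (Γ ∪ diagram J I U : Set _) => φ.1.map m) := by
        rw [Set.range_list_map]
        intro φ hφ
        obtain ⟨φ', h1, rfl⟩ := hl φ hφ
        exact ⟨⟨φ', h1⟩, rfl⟩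
      obtain ⟨l', rfl⟩ := this
      exact ⟨l'.map Subtype.val, by simp; tauto, by simp⟩
    obtain ⟨l', hl', rfl⟩ := this
    obtain ⟨x, hx⟩ := PP.exists_of_realize_exs hJ.nonempty (h l' hl')
    refine ⟨x, ?_⟩
    rw [List.forall_mem_map]
    intro φ hφ
    exact (hm x φ).2 ((PP.realize_conj J l' _).1 hx φ hφ)
  have hx' : ∀ φ ∈ Γ ∪ diagram J I U, φ.Realize J fun s => Sum.elim (u s) (x s) :=
    fun φ hφ => (hm x φ).1 (hx _ ⟨φ, hφ, rfl⟩)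
  choose g hg using fun i => hJ.exists_aut ⟨fun s y => x s (i, y), fun R y hy => by
    have := hx' _ (.inr ⟨i, R, y, hy, rfl⟩)
    rw [PP.realize_ofAtoms] at this
    exact this _ (List.mem_singleton_self _)⟩
  refine ⟨g, fun φ hφ => ?_⟩
  convert hx' φ (.inl hφ) using 1
  funext s y
  rcases y with y | ⟨i, y⟩
  · rfl
  · exact hg i s y

/-- The topology on families of automorphisms given by the primitive positive relations between
them. -/
abbrev autPowTopology (J : Str.{a, b, c} 𝓛) (I : Type) : TopologicalSpace (I → Aut J) :=
  TopologicalSpace.generateFrom {U | ∃ φ : PP 𝓛 fun s => J.carrier s ⊕ I × J.carrier s,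
    U = {g | ¬ φ.Realize J (autEval (fun _ => id) g)}}

/-- By Alexander's subbase theorem only pre-basic covers matter. If such a cover has no finite
subcover, the pp formulas of the complements are finitely consistent, hence hold of some family,
which is then not covered. -/
lemma IsCompactCore.compactSpace_autPow (hJ : IsCompactCore J) (I : Type) :
    @CompactSpace (I → Aut J) (autPowTopology J I) := by
  let := autPowTopology J I
  refine compactSpace_generateFrom (X := I → Aut J) rfl fun P hP hc => ?_
  by_contra hne
  obtain ⟨g, hg⟩ := hJ.exists_auts (I := I) (fun _ => id)
    {φ | {g | ¬ φ.Realize J (autEval (fun _ => id) g)} ∈ P} fun l hl => by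
    let Q : Set (Set (I → Aut J)) :=
      (fun φ : PP 𝓛 fun s => J.carrier s ⊕ I × J.carrier s =>
        {g : I → Aut J | ¬ φ.Realize J (autEval (fun _ => id) g)}) '' {φ | φ ∈ l} ∩ P
    have hQ : Q.Finite := (l.finite_toSet.image _).subset Set.inter_subset_left
    have : ⋃₀ Q ≠ Set.univ := fun h => hne ⟨Q, Set.inter_subset_right, hQ, h⟩
    obtain ⟨g, hg⟩ := (Set.ne_univ_iff_exists_notMem _).1 this
    refine PP.realize_exs_of (fun s p => (g p.1).app s p.2) ?_
    rw [PP.realize_conj]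
    intro φ hφ
    rcases hl φ hφ with h | h
    · by_contra h'
      exact hg ⟨_, ⟨⟨φ, hφ, rfl⟩, h⟩, h'⟩
    · exact realize_of_mem_diagram _ g h
  obtain ⟨U, hU, hgU⟩ := Set.mem_sUnion.1 (hc.symm ▸ Set.mem_univ g)
  obtain ⟨φ, rfl⟩ := hP hU
  exact hgU (hg φ hU)

/-- The topology is defined by formulas with finite contexts for both kinds of arguments; the
support is therefore taken twice, once on each side. -/
lemma isClosed_autRealize {U : 𝓛.Sorts → Type d} (u : ∀ s, U s → J.carrier s)
    (φ : PP 𝓛 fun s => U s ⊕ J.carrier s) :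
    IsClosed {g : Aut J | φ.Realize J fun s => Sum.elim (u s) (g.app s)} := by
  obtain ⟨n, σ, f, φ', -, rfl⟩ := φ.exists_support
  obtain ⟨m, τ, f', φ'', -, h⟩ :=
    (φ'.map (W := fun s => Ctx σ s ⊕ U s) fun s => Sum.swap).exists_support
  obtain ⟨x, hx⟩ := exists_tuple_eq (A := J.carrier) f
  obtain ⟨y, hy⟩ := exists_tuple_eq (A := J.carrier) fun s i => u s (f' s i)
  refine ⟨TopologicalSpace.isOpen_generateFrom_of_mem ⟨_, _, σ, τ, x, y, φ'', ?_⟩⟩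
  ext g
  refine not_congr ?_
  have e1 := PP.realize_map J (fun s => Sum.map id (f s)) φ' fun s => Sum.elim (u s) (g.app s)
  have e2 := PP.realize_map J (W := fun s => Ctx σ s ⊕ U s) (fun s => Sum.swap) φ'
    fun s => Sum.elim (fun i => g.app s (f s i)) (u s)
  rw [← h] at e2
  have e3 := PP.realize_map J (fun s => Sum.map id (f' s)) φ''
    fun s => Sum.elim (fun i => g.app s (f s i)) (u s)
  refine e1.trans (Iff.trans ?_ (e2.symm.trans (e3.trans ?_)))
  · refine iff_of_eq (congrArg _ ?_)
    funext s i
    cases i <;> rfl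
  · refine iff_of_eq (congrArg _ ?_)
    funext s i
    rcases i with i | i
    · exact ((tuple_app g x s i).trans (congrArg (g.app s) (congrFun (congrFun hx s) i))).symm
    · exact (congrFun (congrFun hy s) i).symm

lemma isClosed_realize_param {s : 𝓛.Sorts} {U : 𝓛.Sorts → Type d} (u : ∀ s, U s → J.carrier s)
    (φ : PP 𝓛 fun s' => Ctx (fun _ : Fin 1 => s) s' ⊕ U s') :
    IsClosed {x : J.carrier s | φ.Realize J fun s' => Sum.elim (tuple (fun _ => x) s') (u s')} := by
  obtain ⟨n, σ, f, φ', -, rfl⟩ := φ.exists_support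
  obtain ⟨y, hy⟩ := exists_tuple_eq (A := J.carrier) fun s i => u s (f s i)
  refine ⟨TopologicalSpace.isOpen_generateFrom_of_mem ⟨_, σ, y, φ', ?_⟩⟩
  ext x
  refine not_congr ((PP.realize_map J _ φ' _).trans (iff_of_eq (congrArg _ ?_)))
  funext s i
  rcases i with i | i
  · rfl
  · exact (congrFun (congrFun hy s) i).symm

/-- A closed set of automorphisms, in the form of a partial positive type. -/
lemma IsCompactCore.exists_eq_of_isClosed (hJ : IsCompactCore J) {C : Set (Aut J)}
    (hC : IsClosed C) : ∃ Γ : Set (PP 𝓛 fun s => J.carrier s ⊕ J.carrier s),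
      C = {g | ∀ φ ∈ Γ, φ.Realize J fun s => Sum.elim id (g.app s)} := by
  let Z (φ : PP 𝓛 fun s => J.carrier s ⊕ J.carrier s) : Set (Aut J) :=
    {g | ¬ φ.Realize J fun s => Sum.elim id (g.app s)}
  have ht : autTopology J = TopologicalSpace.generateFrom (Set.range Z) := by
    refine le_antisymm (le_generateFrom ?_) (le_generateFrom ?_)
    · rintro _ ⟨φ, rfl⟩
      exact (isClosed_autRealize (J := J) (fun _ => id) φ).isOpen_compl
    · rintro _ ⟨n, m, σ, τ, x, y, φ, rfl⟩
      refine TopologicalSpace.isOpen_generateFrom_of_mem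
        ⟨φ.map fun s => Sum.elim (fun i => .inr (tuple x s i)) fun i => .inl (tuple y s i), ?_⟩
      ext g
      refine not_congr ((PP.realize_map J _ φ _).trans (iff_of_eq (congrArg _ ?_)))
      funext s i
      rcases i with i | i
      · exact (tuple_app g x s i).symm
      · rfl
  -- Pre-basic open sets are complements of pp sets, so closure of pp relations under disjunction
  -- makes them stable under intersection: with the whole space they form a basis.
  have hb := TopologicalSpace.isTopologicalBasis_of_subbasis_of_inter ht (by
    rintro _ ⟨φ, rfl⟩ _ ⟨ψ, rfl⟩
    obtain ⟨χ, hχ⟩ := hJ.exists_or _ φ ψ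
    exact ⟨χ, by ext g; simp [Z, hχ]⟩)
  obtain ⟨χ, hχ⟩ := hJ.exists_false
  refine ⟨{φ | C ⊆ (Z φ)ᶜ}, subset_antisymm (fun g hg φ hφ => not_not.1 (hφ hg)) fun g hg => ?_⟩
  by_contra hgC
  obtain ⟨U, hU, hgU, hUC⟩ := hb.exists_subset_of_mem_open hgC hC.isOpen_compl
  rcases hU with rfl | ⟨φ, rfl⟩
  -- If the basic neighbourhood is everything, `C` is empty and the false sentence belongs to its
  -- type.
  · have h1 := hg (χ.map fun s => Empty.elim) fun k hk => (hUC (Set.mem_univ k) hk).elim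
    refine hχ (Eq.mp (congrArg (χ.Realize J) ?_) ((PP.realize_map J _ χ _).1 h1))
    funext s i
    exact i.elim
  · exact hgU (hg φ (Set.subset_compl_comm.1 hUC))

end CompactCores

/-! ### The quotient by the infinitesimal automorphisms. -/

section AutGroup

variable {𝓛 : RelLang.{a, b}} {J : Str.{a, b, c} 𝓛} {I : Type}

lemma Aut.mul_app (g h : Aut J) (s : 𝓛.Sorts) (x : J.carrier s) :
    (g * h).app s x = g.app s (h.app s x) := rfl

lemma Aut.inv_app_app (g : Aut J) (s : 𝓛.Sorts) (x : J.carrier s) :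
    g⁻¹.app s (g.app s x) = x := (g.app s).symm_apply_apply x

lemma Aut.app_inv_app (g : Aut J) (s : 𝓛.Sorts) (x : J.carrier s) :
    g.app s (g⁻¹.app s x) = x := (g.app s).apply_symm_apply x

lemma Aut.ext {g h : Aut J} (H : ∀ s x, g.app s x = h.app s x) : g = h :=
  Subtype.ext (funext fun s => Equiv.ext (H s))

lemma PP.realize_app_iff {V : 𝓛.Sorts → Type d} (g : Aut J) (φ : PP 𝓛 V)
    (v : ∀ s, V s → J.carrier s) :
    (φ.Realize J fun s x => g.app s (v s x)) ↔ φ.Realize J v := by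
  refine ⟨fun h => ?_, φ.realize_of_app g v⟩
  simpa only [Aut.inv_app_app] using φ.realize_of_app g⁻¹ _ h

lemma continuous_autPow_apply (i : I) :
    (let := autPowTopology J I; Continuous fun g : I → Aut J => g i) := by
  let := autPowTopology J I
  refine continuous_generateFrom_iff.2 ?_
  rintro _ ⟨n, m, σ, τ, x, y, φ, rfl⟩
  refine TopologicalSpace.isOpen_generateFrom_of_mem
    ⟨φ.map fun s => Sum.elim (fun k => .inr (i, tuple x s k)) fun k => .inl (tuple y s k), ?_⟩
  ext g
  refine not_congr (Iff.trans (iff_of_eq (congrArg _ ?_)) (PP.realize_map J _ φ _).symm)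
  funext s k
  rcases k with k | k
  · exact tuple_app (g i) x s k
  · rfl

/-- Applying $g_i$ turns $R(g_i^{-1}g_kx,y)$ into $R(g_kx,g_iy)$, a pp relation between two members
of the family. This is why the topology on families admits such mixed relations. -/
lemma continuous_autPow_inv_mul (i k : I) :
    (let := autPowTopology J I; Continuous fun g : I → Aut J => (g i)⁻¹ * g k) := by
  let := autPowTopology J I
  refine continuous_generateFrom_iff.2 ?_
  rintro _ ⟨n, m, σ, τ, x, y, φ, rfl⟩
  refine TopologicalSpace.isOpen_generateFrom_of_mem
    ⟨φ.map fun s => Sum.elim (fun l => .inr (k, tuple x s l)) fun l => .inr (i, tuple y s l), ?_⟩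
  ext g
  refine not_congr (((PP.realize_app_iff (g i) φ _).symm.trans
    (iff_of_eq (congrArg _ ?_))).trans (PP.realize_map J _ φ _).symm)
  funext s l
  rcases l with l | l
  · refine (congrArg _ (tuple_app _ x s l)).trans ?_
    exact Aut.app_inv_app (g i) s _
  · rfl

lemma IsCompactCore.compactSpace_aut (hJ : IsCompactCore J) : CompactSpace (Aut J) := by
  let := autPowTopology J Unit
  have := hJ.compactSpace_autPow Unit
  rw [← isCompact_univ_iff]
  have h : Set.range (fun g : Unit → Aut J => g ()) = Set.univ :=
    Set.range_eq_univ.2 fun g => ⟨fun _ => g, rfl⟩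
  rw [← h]
  exact isCompact_range (continuous_autPow_apply ())

/-- A Hausdorff quotient of the automorphism group is a topological group. -/
lemma IsCompactCore.isTopologicalGroup (hJ : IsCompactCore J) {H : Type*} [Group H]
    [TopologicalSpace H] [T2Space H] (π : Aut J →* H) (hc : Continuous π)
    (hs : Function.Surjective π) : IsTopologicalGroup H := by
  let := autPowTopology J Bool
  have := hJ.compactSpace_autPow Bool
  let q : (Bool → Aut J) → H × H := fun g => (π (g false), π (g true))
  have hq : Continuous q := (hc.comp (continuous_autPow_apply false)).prodMk
    (hc.comp (continuous_autPow_apply true))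
  have hqs : Function.Surjective q := by
    rintro ⟨x, y⟩
    obtain ⟨g, rfl⟩ := hs x
    obtain ⟨h, rfl⟩ := hs y
    exact ⟨fun i => cond i h g, rfl⟩
  -- A continuous surjection from a compact space to a Hausdorff space is a quotient map, so
  -- continuity of division on `H × H` can be tested on pairs of automorphisms.
  have hquot : Topology.IsQuotientMap q := hq.isClosedMap.isQuotientMap hq hqs
  have h1 : Continuous fun z : H × H => z.1⁻¹ * z.2 := by
    rw [hquot.continuous_iff]
    have : (fun z : H × H => z.1⁻¹ * z.2) ∘ q = π ∘ fun g => (g false)⁻¹ * g true := by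
      funext g
      simp [q]
    rw [this]
    exact hc.comp (continuous_autPow_inv_mul false true)
  have hinv : Continuous fun z : H => z⁻¹ := by
    have := h1.comp (continuous_id.prodMk (continuous_const (y := (1 : H))))
    simpa [Function.comp_def] using this
  have hmul : Continuous fun z : H × H => z.1 * z.2 := by
    have := h1.comp ((hinv.comp continuous_fst).prodMk continuous_snd)
    simpa [Function.comp_def] using this
  exact { continuous_mul := hmul, continuous_inv := hinv }

lemma continuous_app_left (s : 𝓛.Sorts) (x : J.carrier s) :
    Continuous fun g : Aut J => g.app s x := by
  refine continuous_generateFrom_iff.2 ?_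
  rintro _ ⟨k, σ, y, φ, rfl⟩
  refine TopologicalSpace.isOpen_generateFrom_of_mem ⟨1, k, fun _ => s, σ, fun _ => x, y, φ, rfl⟩

lemma continuous_aut_inv : Continuous fun g : Aut J => g⁻¹ := by
  refine continuous_generateFrom_iff.2 ?_
  rintro _ ⟨n, m, σ, τ, x, y, φ, rfl⟩
  refine TopologicalSpace.isOpen_generateFrom_of_mem
    ⟨m, n, τ, σ, y, x, φ.map fun _ => Sum.swap, ?_⟩
  ext g
  refine not_congr (((PP.realize_app_iff g φ _).symm.trans
    (iff_of_eq (congrArg _ ?_))).trans (PP.realize_map J _ φ _).symm)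
  funext s l
  rcases l with l | l
  · refine (congrArg _ (tuple_app _ x s l)).trans ?_
    exact Aut.app_inv_app g s _
  · exact (tuple_app g y s l).symm

/-- An automorphism as a homeomorphism of a sort. -/
def Aut.homeo (g : Aut J) (s : 𝓛.Sorts) : J.carrier s ≃ₜ J.carrier s where
  toEquiv := g.app s
  continuous_toFun := g.continuous_app s
  continuous_invFun := g⁻¹.continuous_app s

/-- Testing points of `U` suffices, as automorphisms are homeomorphisms. In this form the condition
concerns values of `g` and its inverse at single points, so it is visibly closed. -/
lemma mem_infinitesimal_iff (g : Aut J) : g ∈ infinitesimal J ↔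
    ∀ s, ∀ U : Set (J.carrier s), IsOpen U → ∀ x ∈ U,
      g.app s x ∈ closure U ∧ g⁻¹.app s x ∈ closure U := by
  constructor
  · intro h s U hU x hx
    refine ⟨h s U hU ▸ Set.mem_image_of_mem _ (subset_closure hx), ?_⟩
    exact (inv_mem h : g⁻¹ ∈ infinitesimal J) s U hU ▸ Set.mem_image_of_mem _ (subset_closure hx)
  · intro h s U hU
    have key : ∀ k : Aut J, (∀ x ∈ U, k.app s x ∈ closure U) → k.app s '' closure U ⊆ closure U :=
      fun k hk => (image_closure_subset_closure_image (k.continuous_app s)).trans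
        (closure_minimal (Set.image_subset_iff.2 hk) isClosed_closure)
    refine (key g fun x hx => (h s U hU x hx).1).antisymm fun x hx => ?_
    exact ⟨g⁻¹.app s x, key g⁻¹ (fun x hx => (h s U hU x hx).2) ⟨x, hx, rfl⟩, Aut.app_inv_app g s x⟩

lemma isClosed_infinitesimal : IsClosed (infinitesimal J : Set (Aut J)) := by
  have : (infinitesimal J : Set (Aut J)) = ⋂ (s) (U : Set (J.carrier s)) (_ : IsOpen U) (x ∈ U),
      ((fun g : Aut J => g.app s x) ⁻¹' closure U ∩
        (fun g : Aut J => g⁻¹.app s x) ⁻¹' closure U) := by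
    ext g
    simp only [SetLike.mem_coe, mem_infinitesimal_iff, Set.mem_iInter]
    rfl
  rw [this]
  refine isClosed_iInter fun s => isClosed_iInter fun U => isClosed_iInter fun _ =>
    isClosed_iInter fun x => isClosed_iInter fun _ => ?_
  exact (isClosed_closure.preimage (continuous_app_left s x)).inter
    (isClosed_closure.preimage ((continuous_app_left s x).comp continuous_aut_inv))

/-- With $W=hU$, both the interior of $\overline W$ and the complement of $\overline W$ are open and
$\mathfrak g$-invariant. The automorphisms sending $x$ into the first and into the second form
disjoint open unions of cosets, containing $h$ and $g$ respectively. -/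
lemma exists_separated_of_not_mem {g h : Aut J} {s : 𝓛.Sorts} {U : Set (J.carrier s)}
    (hU : IsOpen U) {x : J.carrier s} (hx : x ∈ U) (hxg : (h⁻¹ * g).app s x ∉ closure U) :
    ∃ A B : Set (Aut J ⧸ infinitesimal J), IsOpen A ∧ IsOpen B ∧
      (h : Aut J ⧸ infinitesimal J) ∈ A ∧ (g : Aut J ⧸ infinitesimal J) ∈ B ∧ Disjoint A B := by
  let W : Set (J.carrier s) := h.homeo s '' U
  have hW : IsOpen W := (h.homeo s).isOpenMap U hU
  have hgW : g.app s x ∉ closure W := by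
    intro hg
    rw [← (h.homeo s).image_closure] at hg
    obtain ⟨y, hy, hyg⟩ := hg
    refine hxg ?_
    rw [Aut.mul_app, ← hyg]
    exact (h.inv_app_app s y).symm ▸ hy
  have hk : ∀ k ∈ infinitesimal J, ∀ y, y ∈ closure W ↔ k.app s y ∈ closure W := by
    intro k hk y
    refine ⟨fun hy => hk s W hW ▸ Set.mem_image_of_mem _ hy, fun hy => ?_⟩
    rw [← hk s W hW] at hy
    obtain ⟨z, hz, hzy⟩ := hy
    exact (k.app s).injective hzy ▸ hz
  have hk' : ∀ k ∈ infinitesimal J, ∀ y, y ∈ interior (closure W) ↔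
      k.app s y ∈ interior (closure W) := by
    intro k hk y
    have h1 : k.homeo s ⁻¹' closure W = closure W := by
      ext y
      exact (‹∀ k ∈ infinitesimal J, ∀ y, y ∈ closure W ↔ k.app s y ∈ closure W› k hk y).symm
    have h2 := (k.homeo s).preimage_interior (closure W)
    rw [h1] at h2
    exact ((Set.ext_iff.1 h2) y).symm
  have hopen : ∀ O : Set (J.carrier s), IsOpen O →
      (∀ k ∈ infinitesimal J, ∀ y, y ∈ O ↔ k.app s y ∈ O) →
      ∃ A : Set (Aut J ⧸ infinitesimal J), IsOpen A ∧ ∀ l : Aut J,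
        (l : Aut J ⧸ infinitesimal J) ∈ A ↔ l.app s x ∈ O := by
    intro O hO hinv
    have h1 : ∀ l : Aut J, (l : Aut J ⧸ infinitesimal J) ∈
        QuotientGroup.mk '' {l : Aut J | l.app s x ∈ O} ↔ l.app s x ∈ O := by
      intro l
      refine ⟨?_, fun hl => ⟨l, hl, rfl⟩⟩
      rintro ⟨l', hl', he⟩
      -- The quotient consists of left cosets while invariance concerns multiplication on the left;
      -- normality reconciles the two.
      have h2 := (infinitesimal_normal J).mem_comm (QuotientGroup.eq.1 he)
      have h3 := (hinv _ h2 _).1 hl'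
      rwa [← Aut.mul_app, inv_mul_cancel_right] at h3
    refine ⟨_, ?_, h1⟩
    rw [← (QuotientGroup.isQuotientMap_mk (N := infinitesimal J)).isOpen_preimage]
    have : QuotientGroup.mk (s := infinitesimal J) ⁻¹'
        (QuotientGroup.mk '' {l : Aut J | l.app s x ∈ O}) = {l : Aut J | l.app s x ∈ O} :=
      Set.ext h1
    rw [this]
    exact hO.preimage (continuous_app_left s x)
  obtain ⟨A, hA, hA'⟩ := hopen _ isOpen_interior hk'
  obtain ⟨B, hB, hB'⟩ := hopen _ isClosed_closure.isOpen_compl fun k hk'' y =>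
    not_congr (hk k hk'' y)
  refine ⟨A, B, hA, hB, (hA' h).2 ?_, (hB' g).2 hgW, Set.disjoint_left.2 fun z => ?_⟩
  · exact interior_maximal subset_closure hW ⟨x, hx, rfl⟩
  · induction z using QuotientGroup.induction_on with
    | H l => exact fun h1 h2 => (hB' l).1 h2 (interior_subset ((hA' l).1 h1))

instance : T2Space (Aut J ⧸ infinitesimal J) where
  t2 a b hab := by
    induction a using QuotientGroup.induction_on with | H h => ?_
    induction b using QuotientGroup.induction_on with | H g => ?_
    have h1 : h⁻¹ * g ∉ infinitesimal J := fun h1 => hab (QuotientGroup.eq.2 h1)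
    rw [mem_infinitesimal_iff] at h1
    push Not at h1
    obtain ⟨s, U, hU, x, hx, h2⟩ := h1
    by_cases h3 : (h⁻¹ * g).app s x ∈ closure U
    · have h4 := h2 h3
      rw [mul_inv_rev, inv_inv] at h4
      obtain ⟨A, B, hA, hB, h5, h6, h7⟩ := exists_separated_of_not_mem hU hx h4
      exact ⟨B, A, hB, hA, h6, h5, h7.symm⟩
    · exact exists_separated_of_not_mem hU hx h3

lemma IsCompactCore.compactSpace_quotient (hJ : IsCompactCore J) :
    CompactSpace (Aut J ⧸ infinitesimal J) := by
  have := hJ.compactSpace_aut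
  infer_instance

lemma IsCompactCore.isTopologicalGroup_quotient (hJ : IsCompactCore J) :
    IsTopologicalGroup (Aut J ⧸ infinitesimal J) :=
  hJ.isTopologicalGroup (QuotientGroup.mk' (infinitesimal J)) QuotientGroup.continuous_mk
    (QuotientGroup.mk'_surjective _)

end AutGroup

/-! ### Restriction to the Hausdorff imaginary sorts. -/

section Restriction

variable {𝓛 : RelLang.{a, b}} {J : Str.{a, b, c} 𝓛} {I : Type}

lemma Aut.realize_tuple_iff {n : ℕ} {σ : Fin n → 𝓛.Sorts} (g : Aut J) (φ : PP 𝓛 (Ctx σ))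
    (x : ∀ i, J.carrier (σ i)) :
    φ.Realize J (tuple fun i => g.app _ (x i)) ↔ φ.Realize J (tuple x) := by
  rw [← PP.realize_app_iff g φ (tuple x)]
  refine iff_of_eq (congrArg _ ?_)
  funext s i
  exact tuple_app g x s i

lemma Aut.app_pair {s : 𝓛.Sorts} (g : Aut J) (x y : J.carrier s) :
    (fun i => g.app s ((![x, y] : Fin 2 → J.carrier s) i)) = ![g.app s x, g.app s y] := by
  funext i
  fin_cases i <;> rfl

namespace HausdorffImaginary

variable (h : HausdorffImaginary J)

lemma app_mem_iff (g : Aut J) (x : J.carrier h.sort) : g.app h.sort x ∈ h.P ↔ x ∈ h.P := by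
  obtain ⟨Φ, hΦ⟩ := h.P_pp
  rw [hΦ, hΦ]
  exact forall₂_congr fun φ _ => g.realize_tuple_iff φ fun _ => x

lemma app_E_iff (g : Aut J) {x y : J.carrier h.sort} (hx : x ∈ h.P) (hy : y ∈ h.P) :
    h.E (g.app h.sort x) (g.app h.sort y) ↔ h.E x y := by
  obtain ⟨Φ, hΦ⟩ := h.E_pp
  rw [hΦ _ ((h.app_mem_iff g x).2 hx) _ ((h.app_mem_iff g y).2 hy), hΦ x hx y hy]
  refine forall₂_congr fun φ _ => Iff.trans ?_ (g.realize_tuple_iff φ ![x, y])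
  exact iff_of_eq (congrArg (fun z => φ.Realize J (tuple z)) (g.app_pair x y).symm)

/-- The action of an automorphism on an imaginary sort. -/
def perm (g : Aut J) : Equiv.Perm h.Elem :=
  Quotient.congr ((g.app h.sort).subtypeEquiv fun x => (h.app_mem_iff g x).symm)
    fun x y => (h.app_E_iff g x.2 y.2).symm

instance : T2Space h.Elem := h.hausdorff

end HausdorffImaginary

lemma inducedRel_perm {k : ℕ} (h : Fin k → HausdorffImaginary J)
    (φ : PP 𝓛 (Ctx fun i => (h i).sort)) (x : ∀ i, (h i).Elem) (g : Aut J)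
    (hx : HausdorffImaginary.inducedRel h φ x) :
    HausdorffImaginary.inducedRel h φ fun i => (h i).perm g (x i) := by
  obtain ⟨y, hy, hφ⟩ := hx
  exact ⟨fun i => ⟨g.app _ (y i), ((h i).app_mem_iff g _).2 (y i).2⟩,
    fun i => congrArg ((h i).perm g) (hy i), (g.realize_tuple_iff φ _).2 hφ⟩

/-- Restriction of automorphisms to the Hausdorff imaginary sorts. -/
def restrictH (J : Str.{a, b, c} 𝓛) : Aut J →* AutH J :=
  MonoidHom.mk' (fun g => ⟨fun h => h.perm g, fun k h φ x =>
    ⟨fun hx => by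
      have := inducedRel_perm h φ _ g⁻¹ hx
      convert this using 1
      funext i
      obtain ⟨y, hy⟩ := Quotient.exists_rep (x i)
      rw [← hy]
      exact congrArg (Quotient.mk _) (Subtype.ext (g.inv_app_app _ _).symm),
      inducedRel_perm h φ x g⟩⟩) fun g g' => by
    refine Subtype.ext (funext fun h => Equiv.ext fun x => ?_)
    obtain ⟨y, rfl⟩ := Quotient.exists_rep x
    rfl

lemma restrictH_mk (g : Aut J) (h : HausdorffImaginary J) (x : h.P) :
    (restrictH J g).app h (Quotient.mk h.setoid x) =
      Quotient.mk h.setoid ⟨g.app h.sort x, (h.app_mem_iff g x).2 x.2⟩ := rfl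

lemma continuous_restrictH : Continuous (restrictH J) := by
  refine continuous_induced_rng.2 (continuous_pi fun h => continuous_pi fun x => ?_)
  obtain ⟨y, rfl⟩ := Quotient.exists_rep x
  have h1 : Continuous fun g : Aut J =>
      (⟨g.app h.sort y, (h.app_mem_iff g y).2 y.2⟩ : h.P) :=
    (continuous_app_left h.sort y.1).subtype_mk _
  exact (continuous_quotient_mk' (s := h.setoid)).comp h1

instance : T2Space (AutH J) := by
  refine T2Space.of_injective_continuous
    (f := fun (f : AutH J) (h : HausdorffImaginary J) (x : h.Elem) => (f.app h x : h.Elem))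
    (fun f g hfg => ?_) continuous_induced_dom
  exact Subtype.ext (funext fun h => Equiv.ext fun x => congrFun (congrFun hfg h) x)

lemma List.exists_witnesses {α β : Type*} (l : List α) (D : α → Prop) (R : α → β → Prop)
    (h : ∀ x ∈ l, D x ∨ ∃ y, R x y) :
    ∃ l' : List β, ∀ x ∈ l, D x ∨ ∃ y ∈ l', R x y := by
  induction l with
  | nil => exact ⟨[], by simp⟩
  | cons x l ih =>
    obtain ⟨l', hl'⟩ := ih fun x hx => h x (List.mem_cons_of_mem _ hx)
    have hmono : ∀ y, ∀ x ∈ l, D x ∨ ∃ z ∈ y :: l', R x z := fun y x hx =>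
      (hl' x hx).imp_right fun ⟨z, hz, hR⟩ => ⟨z, List.mem_cons_of_mem _ hz, hR⟩
    rcases h x List.mem_cons_self with hx | ⟨y, hy⟩
    · exact ⟨l', List.forall_mem_cons.2 ⟨.inl hx, hl'⟩⟩
    · exact ⟨y :: l', List.forall_mem_cons.2 ⟨.inr ⟨y, List.mem_cons_self, hy⟩, hmono y⟩⟩

/-- With a representative `b` of `f[x]` chosen for each class, a preimage of `f` is an automorphism
`g` with `E (g x) b` for all `x`, i.e. a realization of a pp type. Its finite parts are consistent
because `f` preserves induced relations. -/
lemma IsCompactCore.restrictH_surjective (hJ : IsCompactCore J) :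
    Function.Surjective (restrictH J) := by
  classical
  intro f
  choose Φ hΦ using fun h : HausdorffImaginary J => h.E_pp
  choose b hb using fun (h : HausdorffImaginary J) (x : h.P) =>
    Quotient.exists_rep (f.app h (Quotient.mk h.setoid x))
  let m (h : HausdorffImaginary J) (x : h.P) :=
    tuple (A := fun s => J.carrier s ⊕ Unit × J.carrier s) (σ := fun _ : Fin 2 => h.sort)
      ![.inr ((), x.1), .inl (b h x).1]
  have hm : ∀ (W : ∀ s, J.carrier s ⊕ Unit × J.carrier s → J.carrier s) (h : HausdorffImaginary J)
      (x : h.P) (ψ : PP 𝓛 (Ctx fun _ : Fin 2 => h.sort)), (ψ.map (m h x)).Realize J W ↔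
        ψ.Realize J (tuple ![W _ (.inr ((), x.1)), W _ (.inl (b h x).1)]) := by
    intro W h x ψ
    refine (PP.realize_map J _ ψ _).trans (iff_of_eq (congrArg _ ?_))
    funext s i
    refine (comp_tuple W _ s i).symm.trans (congrArg (fun z => tuple z s i) ?_)
    funext i
    fin_cases i <;> rfl
  obtain ⟨g, hg⟩ := hJ.exists_auts (I := Unit) (fun _ => id)
    {χ | ∃ z : Σ h : HausdorffImaginary J, h.P, ∃ ψ ∈ Φ z.1, χ = ψ.map (m z.1 z.2)} fun l hl => by
    obtain ⟨zs, hzs⟩ := List.exists_witnesses l (· ∈ diagram J Unit J.carrier)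
      (fun χ (z : Σ h : HausdorffImaginary J, h.P) => ∃ ψ ∈ Φ z.1, χ = ψ.map (m z.1 z.2))
      fun χ hχ => (hl χ hχ).symm
    let h : Fin zs.length → HausdorffImaginary J := fun i => (zs.get i).1
    let x : ∀ i, (h i).P := fun i => (zs.get i).2
    -- The formula says that a map satisfying the given finite part of the diagram sends each `x i`
    -- to the value of the free variable `i`. It holds of the `x i` themselves through the identity;
    -- transport by `f` yields representatives `y i` of the images.
    let φ : PP 𝓛 fun s => Ctx (fun i => (h i).sort) s ⊕ (J.carrier s ⊕ Unit × J.carrier s) :=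
      (PP.conj ((l.filter (· ∈ diagram J Unit J.carrier)).map (PP.map fun _ => Sum.inr))).and
        (PP.ofAtoms ((List.finRange zs.length).map fun i =>
          .eq (s := (h i).sort) (.inl ⟨i, rfl⟩) (.inr (.inr ((), (x i).1)))))
    have hφ : ∀ (y : ∀ i, J.carrier (h i).sort)
        (W : ∀ s, J.carrier s ⊕ Unit × J.carrier s → J.carrier s),
        (φ.Realize J fun s => Sum.elim (tuple y s) (W s)) ↔
          (∀ χ ∈ l, χ ∈ diagram J Unit J.carrier → χ.Realize J W) ∧
            ∀ i, y i = W _ (.inr ((), (x i).1)) := by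
      intro y W
      refine (PP.realize_and J _ _ _).trans (and_congr ?_ ?_)
      · refine (PP.realize_conj J _ _).trans ?_
        simp only [List.forall_mem_map, List.mem_filter, decide_eq_true_eq, and_imp]
        exact forall₃_congr fun χ _ _ => PP.realize_map J _ χ _
      · refine (PP.realize_ofAtoms J _ _).trans ?_
        simp only [List.forall_mem_map, List.mem_finRange, forall_true_left]
        rfl
    have h1 : HausdorffImaginary.inducedRel h φ.exs fun i => Quotient.mk _ (x i) := by
      refine ⟨x, fun _ => rfl, PP.realize_exs_of (autEval (fun _ => id) fun _ => 1) ?_⟩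
      exact (hφ _ _).2 ⟨fun χ _ hχ => realize_of_mem_diagram _ _ hχ, fun i => rfl⟩
    obtain ⟨y, hy, h2⟩ := (f.2 _ h φ.exs _).2 h1
    obtain ⟨W, hW⟩ := PP.exists_of_realize_exs hJ.nonempty h2
    obtain ⟨hW1, hW2⟩ := (hφ _ _).1 hW
    refine PP.realize_exs_of (fun s p => W s (.inr p)) ((PP.realize_conj J _ _).2 fun χ hχ => ?_)
    rcases hzs χ hχ with hD | ⟨z, hz, ψ, hψ, rfl⟩
    · have := hW1 χ hχ hD
      obtain ⟨i, R, x, hx, rfl⟩ := hD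
      rw [PP.realize_ofAtoms] at this ⊢
      simp only [List.mem_singleton, forall_eq] at this ⊢
      exact this
    · obtain ⟨i, rfl⟩ := List.mem_iff_get.1 hz
      rw [hm]
      have h3 : (Quotient.mk (h i).setoid (y i)) = Quotient.mk _ (b (h i) (x i)) :=
        (hy i).trans (hb (h i) (x i)).symm
      have h4 := (hΦ (h i) _ (y i).2 _ (b (h i) (x i)).2).1 (Quotient.exact h3) ψ hψ
      have h5 : (y i).1 = W _ (.inr ((), (x i).1)) := hW2 i
      rw [h5] at h4
      exact h4
  refine ⟨g (), Subtype.ext (funext fun h => Equiv.ext fun x => ?_)⟩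
  obtain ⟨x, rfl⟩ := Quotient.exists_rep x
  refine Eq.trans ?_ (hb h x)
  refine (restrictH_mk (g ()) h x).trans (Quotient.sound ?_)
  exact (hΦ h _ ((h.app_mem_iff _ _).2 x.2) _ (b h x).2).2 fun ψ hψ =>
    (hm _ h x ψ).1 (hg _ ⟨⟨h, x⟩, ψ, hψ, rfl⟩)

/-- After existential quantification over the automorphisms' values, a finite part of the type is a
pp formula true on `K`, hence true of `u`; compactness does the rest. The lemma serves to show that
sets defined through automorphisms are given by pp types. -/
lemma IsCompactCore.exists_auts_of_forall (hJ : IsCompactCore J) {U : 𝓛.Sorts → Type d}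
    (K : Set (∀ s, U s → J.carrier s)) (Γ : Set (PP 𝓛 fun s => U s ⊕ I × J.carrier s))
    (hK : ∀ u ∈ K, ∃ g : I → Aut J, ∀ φ ∈ Γ, φ.Realize J (autEval u g))
    (u : ∀ s, U s → J.carrier s)
    (hu : ∀ φ : PP 𝓛 U, (∀ u ∈ K, φ.Realize J u) → φ.Realize J u) :
    ∃ g : I → Aut J, ∀ φ ∈ Γ, φ.Realize J (autEval u g) := by
  refine hJ.exists_auts u Γ fun l hl => hu _ fun u hu => ?_
  obtain ⟨g, hg⟩ := hK u hu
  refine PP.realize_exs_of (fun s p => (g p.1).app s p.2) ((PP.realize_conj J _ _).2 fun φ hφ => ?_)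
  rcases hl φ hφ with h | h
  · exact hg φ h
  · exact realize_of_mem_diagram u g h

/-- A closed set of automorphisms is a pp type with parameters. By compactness its image is cut out
by the pp formulas stating that finite parts of this type, together with `y = g x`, are consistent.
Sorts of `J` need not be Hausdorff, so compactness of the group alone would not suffice. -/
lemma IsCompactCore.isClosedMap_app_left (hJ : IsCompactCore J) {s : 𝓛.Sorts} (x : J.carrier s) :
    IsClosedMap fun g : Aut J => g.app s x := by
  intro F hF
  obtain ⟨Γ, rfl⟩ := hJ.exists_eq_of_isClosed hF
  let U (s' : 𝓛.Sorts) : Type c := Ctx (fun _ : Fin 1 => s) s' ⊕ J.carrier s'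
  let u (y : J.carrier s) (s' : 𝓛.Sorts) : U s' → J.carrier s' :=
    Sum.elim (tuple (fun _ => y) s') id
  let m (s' : 𝓛.Sorts) : J.carrier s' ⊕ J.carrier s' → U s' ⊕ Unit × J.carrier s' :=
    Sum.elim (fun x => .inl (.inr x)) fun x => .inr ((), x)
  let Γ' : Set (PP 𝓛 fun s => U s ⊕ Unit × J.carrier s) :=
    insert (PP.ofAtoms [.eq (s := s) (.inl (.inl ⟨0, rfl⟩)) (.inr ((), x))]) (PP.map m '' Γ)
  have hΓ' : ∀ (y : J.carrier s) (g : Unit → Aut J), (∀ φ ∈ Γ', φ.Realize J (autEval (u y) g)) ↔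
      y = (g ()).app s x ∧ ∀ φ ∈ Γ, φ.Realize J fun s => Sum.elim id ((g ()).app s) := by
    intro y g
    refine Set.forall_mem_insert.trans (and_congr ?_ ?_)
    · rw [PP.realize_ofAtoms]
      simp only [List.mem_singleton, forall_eq]
      rfl
    · refine Set.forall_mem_image.trans (forall₂_congr fun φ _ => ?_)
      refine (PP.realize_map J m φ _).trans (iff_of_eq (congrArg _ ?_))
      funext s i
      cases i <;> rfl
  have : (fun g : Aut J => g.app s x) ''
      {g | ∀ φ ∈ Γ, φ.Realize J fun s => Sum.elim id (g.app s)} =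
      ⋂ l : {l : List (PP 𝓛 fun s => U s ⊕ Unit × J.carrier s) //
        ∀ φ ∈ l, φ ∈ Γ' ∪ diagram J Unit U}, {y | (PP.conj l.1).exs.Realize J (u y)} := by
    ext y
    simp only [Set.mem_iInter, Subtype.forall]
    constructor
    · rintro ⟨g, hg, rfl⟩ l hl
      refine PP.realize_exs_of (fun s p => g.app s p.2)
        ((PP.realize_conj J _ _).2 fun φ hφ => ?_)
      rcases hl φ hφ with h | h
      · exact (hΓ' _ fun _ => g).2 ⟨rfl, hg⟩ φ h
      · exact realize_of_mem_diagram (u _) (fun _ => g) h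
    · intro h
      obtain ⟨g, hg⟩ := hJ.exists_auts (I := Unit) (u y) Γ' h
      obtain ⟨h1, h2⟩ := (hΓ' y g).1 hg
      exact ⟨g (), h2, h1.symm⟩
  rw [this]
  exact isClosed_iInter fun l => isClosed_realize_param (J := J) (fun _ => id) (PP.conj l.1).exs

end Restriction

/-! ### Orbits modulo infinitesimals as imaginary sorts; the kernel of restriction. -/

section Kernel

variable {𝓛 : RelLang.{a, b}} {J : Str.{a, b, c} 𝓛}

/-- The orbit of an element under the automorphism group. -/
def orbit {s : 𝓛.Sorts} (x : J.carrier s) : Set (J.carrier s) := {y | ∃ g : Aut J, g.app s x = y}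

/-- The orbit relation of the group of infinitesimal automorphisms. -/
def InfEquiv {s : 𝓛.Sorts} (x y : J.carrier s) : Prop := ∃ g ∈ infinitesimal J, g.app s x = y

lemma infEquiv_equivalence (s : 𝓛.Sorts) : Equivalence (InfEquiv (J := J) (s := s)) where
  refl x := ⟨1, one_mem _, rfl⟩
  symm := by
    rintro x _ ⟨g, hg, rfl⟩
    exact ⟨g⁻¹, inv_mem hg, g.inv_app_app s x⟩
  trans := by
    rintro x _ _ ⟨g, hg, rfl⟩ ⟨h, hh, rfl⟩
    exact ⟨h * g, mul_mem hh hg, rfl⟩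

/-- An element satisfying all pp formulas true of `x` is the image of `x` under an automorphism: the
orbit is the pp type of `x`. -/
lemma IsCompactCore.exists_pp_orbit (hJ : IsCompactCore J) {s : 𝓛.Sorts} (x : J.carrier s) :
    ∃ Φ : Set (PP 𝓛 (Ctx fun _ : Fin 1 => s)),
      ∀ y, y ∈ orbit x ↔ ∀ φ ∈ Φ, φ.Realize J (tuple fun _ => y) := by
  refine ⟨{φ | φ.Realize J (tuple fun _ => x)}, fun y => ⟨?_, fun h => ?_⟩⟩
  · rintro ⟨g, rfl⟩ φ hφ
    exact (g.realize_tuple_iff φ fun _ => x).2 hφ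
  · let Γ : Set (PP 𝓛 fun s' => Ctx (fun _ : Fin 1 => s) s' ⊕ Unit × J.carrier s') :=
      {PP.ofAtoms [.eq (s := s) (.inr ((), x)) (.inl ⟨0, rfl⟩)]}
    have hΓ : ∀ (z : J.carrier s) (g : Unit → Aut J),
        (∀ φ ∈ Γ, φ.Realize J (autEval (tuple fun _ => z) g)) ↔ (g ()).app s x = z := by
      intro z g
      simp only [Γ, Set.mem_singleton_iff, forall_eq, PP.realize_ofAtoms, List.mem_singleton]
      rfl
    obtain ⟨g, hg⟩ := hJ.exists_auts_of_forall {tuple fun _ => x} Γ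
      (by rintro _ rfl; exact ⟨fun _ => 1, (hΓ x _).2 rfl⟩) (tuple fun _ => y)
      fun φ hφ => h φ (hφ _ rfl)
    exact ⟨g (), (hΓ y g).1 hg⟩

/-- The type consists of the pp formulas true of all pairs $(x,kx)$ with $k\in\mathfrak g$. As
$\mathfrak g$ is closed and normal, a pair in the orbit satisfying it has the form $(g_0x,g_1x)$
with $g_0^{-1}g_1\in\mathfrak g$. -/
lemma IsCompactCore.exists_pp_infEquiv (hJ : IsCompactCore J) {s : 𝓛.Sorts} (x : J.carrier s) :
    ∃ Φ : Set (PP 𝓛 (Ctx fun _ : Fin 2 => s)), ∀ y ∈ orbit x, ∀ z ∈ orbit x,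
      InfEquiv y z ↔ ∀ φ ∈ Φ, φ.Realize J (tuple ![y, z]) := by
  let K : Set (∀ s', Ctx (fun _ : Fin 2 => s) s' → J.carrier s') :=
    {v | ∃ k ∈ infinitesimal J, v = tuple ![x, k.app s x]}
  refine ⟨{φ | ∀ v ∈ K, φ.Realize J v}, ?_⟩
  rintro _ ⟨g, rfl⟩ z -
  constructor
  · rintro ⟨k, hk, rfl⟩ φ hφ
    have h1 := hφ _ ⟨g⁻¹ * k * g, by
      simpa using (infinitesimal_normal J).conj_mem k hk g⁻¹, rfl⟩
    rw [← g.realize_tuple_iff] at h1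
    refine (iff_of_eq (congrArg (fun z => φ.Realize J (tuple z)) ((g.app_pair _ _).trans ?_))).1 h1
    simp only [Aut.mul_app, Aut.app_inv_app]
  · intro h
    obtain ⟨Γ, hΓ⟩ := hJ.exists_eq_of_isClosed (isClosed_infinitesimal (J := J))
    have hΓ' : ∀ k : Aut J, k ∈ infinitesimal J ↔
        ∀ φ ∈ Γ, φ.Realize J fun s => Sum.elim id (k.app s) := Set.ext_iff.1 hΓ
    let U (s' : 𝓛.Sorts) : Type := Ctx (fun _ : Fin 2 => s) s'
    let m (s' : 𝓛.Sorts) : J.carrier s' ⊕ J.carrier s' → U s' ⊕ Bool × J.carrier s' :=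
      Sum.elim (fun x => .inr (false, x)) fun x => .inr (true, x)
    let Γ' : Set (PP 𝓛 fun s => U s ⊕ Bool × J.carrier s) :=
      insert (PP.ofAtoms [.eq (s := s) (.inr (false, x)) (.inl ⟨0, rfl⟩)])
        (insert (PP.ofAtoms [.eq (s := s) (.inr (true, x)) (.inl ⟨1, rfl⟩)]) (PP.map m '' Γ))
    have hm : ∀ (v : Fin 2 → J.carrier s) (g : Bool → Aut J),
        (∀ φ ∈ Γ', φ.Realize J (autEval (tuple v) g)) ↔
          (g false).app s x = v 0 ∧ (g true).app s x = v 1 ∧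
            (g false)⁻¹ * g true ∈ infinitesimal J := by
      intro v g
      refine Set.forall_mem_insert.trans (and_congr ?_
        (Set.forall_mem_insert.trans (and_congr ?_ ?_)))
      · rw [PP.realize_ofAtoms]
        simp only [List.mem_singleton, forall_eq]
        rfl
      · rw [PP.realize_ofAtoms]
        simp only [List.mem_singleton, forall_eq]
        rfl
      · refine Set.forall_mem_image.trans ((forall₂_congr fun φ _ => ?_).trans (hΓ' _).symm)
        refine (PP.realize_map J m φ _).trans
          (Iff.trans ?_ (PP.realize_app_iff (g false) φ _))
        refine iff_of_eq (congrArg _ ?_)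
        funext s' i
        rcases i with i | i
        · rfl
        · exact (Aut.app_inv_app (g false) s' _).symm
    obtain ⟨k, hk⟩ := hJ.exists_auts_of_forall K Γ' (by
      rintro _ ⟨k, hk, rfl⟩
      refine ⟨fun i => cond i k 1, (hm _ _).2 ⟨rfl, rfl, ?_⟩⟩
      simpa using hk) (tuple ![g.app s x, z]) h
    obtain ⟨h1, h2, h3⟩ := (hm _ k).1 hk
    refine ⟨k true * (k false)⁻¹, (infinitesimal_normal J).mem_comm h3, ?_⟩
    change (k true).app s ((k false)⁻¹.app s (g.app s x)) = z
    have h1' : (k false).app s x = g.app s x := h1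
    rw [← h1', Aut.inv_app_app]
    exact h2

/-- The quotient of an orbit by the group of infinitesimal automorphisms. -/
def orbitSetoid {s : 𝓛.Sorts} (x : J.carrier s) : Setoid (orbit x) :=
  ⟨fun y z => InfEquiv y.1 z.1, ((infEquiv_equivalence s).comap Subtype.val)⟩

/-- The quotient injects continuously into $\mathcal G/K$, where $K$ is the image of the stabilizer
of $x$. The stabilizer is closed, hence compact, so $K$ is closed and $\mathcal G/K$ is Hausdorff.
Continuity comes from evaluation at $x$ being a closed map. -/
lemma IsCompactCore.t2Space_orbit (hJ : IsCompactCore J) {s : 𝓛.Sorts} (x : J.carrier s) :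
    T2Space (Quotient (orbitSetoid x)) := by
  have := hJ.compactSpace_aut
  have := hJ.isTopologicalGroup_quotient
  let S : Subgroup (Aut J) :=
    { carrier := {g | g.app s x = x}
      mul_mem' := fun {g h} hg hh => by
        change g.app s (h.app s x) = x
        rw [show h.app s x = x from hh]
        exact hg
      one_mem' := rfl
      inv_mem' := fun {g} hg => by
        have h1 := g.inv_app_app s x
        rwa [show g.app s x = x from hg] at h1 }
  have hS : IsClosed (S : Set (Aut J)) := by
    have := isClosed_autRealize (J := J) (fun _ => id)
      (PP.ofAtoms [.eq (s := s) (.inr x) (.inl x)])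
    simp only [PP.realize_ofAtoms, List.mem_singleton, forall_eq] at this
    exact this
  let π := QuotientGroup.mk' (infinitesimal J)
  let K : Subgroup (Aut J ⧸ infinitesimal J) := S.map π
  have hK : IsClosed (K : Set (Aut J ⧸ infinitesimal J)) :=
    (hS.isCompact.image QuotientGroup.continuous_mk).isClosed
  have hmk : ∀ g h : Aut J, ((π g : (Aut J ⧸ infinitesimal J) ⧸ K) = π h) ↔
      InfEquiv (g.app s x) (h.app s x) := by
    intro g h
    rw [QuotientGroup.eq]
    constructor
    · rintro ⟨t, ht, hgh⟩
      have h1 : t⁻¹ * (g⁻¹ * h) ∈ infinitesimal J := QuotientGroup.eq.1 (by simpa [π] using hgh)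
      have h2 := (infinitesimal_normal J).conj_mem _ h1 (g * t)
      have h3 : t.app s x = x := ht
      have h4 : t⁻¹.app s x = x := S.inv_mem ht
      refine ⟨_, h2, ?_⟩
      simp only [mul_inv_rev, Aut.mul_app, Aut.inv_app_app, h4, Aut.app_inv_app]
    · rintro ⟨k, hk, hgh⟩
      refine ⟨(k * g)⁻¹ * h, ?_, ?_⟩
      · change ((k * g)⁻¹).app s (h.app s x) = x
        rw [← hgh]
        exact (k * g).inv_app_app s x
      · have : π k = 1 := (QuotientGroup.eq_one_iff k).2 hk
        simp [this]
  choose f hf using fun y : orbit x => y.2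
  let F : Quotient (orbitSetoid x) → (Aut J ⧸ infinitesimal J) ⧸ K :=
    Quotient.lift (fun y => (π (f y) : (Aut J ⧸ infinitesimal J) ⧸ K)) fun y z hyz =>
      (hmk _ _).2 (by rw [hf, hf]; exact hyz)
  refine T2Space.of_injective_continuous (f := F) ?_ ?_
  · intro y z
    induction y using Quotient.inductionOn
    induction z using Quotient.inductionOn
    intro hyz
    have := (hmk _ _).1 hyz
    rw [hf, hf] at this
    exact Quotient.sound this
  · refine Continuous.quotient_lift (continuous_iff_isClosed.2 fun C hC => ?_) _
    have h1 : IsClosed {g : Aut J | (π g : (Aut J ⧸ infinitesimal J) ⧸ K) ∈ C} :=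
      hC.preimage (QuotientGroup.continuous_mk.comp QuotientGroup.continuous_mk)
    have h2 : (fun y => (π (f y) : (Aut J ⧸ infinitesimal J) ⧸ K)) ⁻¹' C = Subtype.val ⁻¹'
        ((fun g : Aut J => g.app s x) ''
          {g : Aut J | (π g : (Aut J ⧸ infinitesimal J) ⧸ K) ∈ C}) := by
      ext y
      refine ⟨fun hy => ⟨f y, hy, hf y⟩, ?_⟩
      rintro ⟨g, hg, hgy⟩
      have : (π (f y) : (Aut J ⧸ infinitesimal J) ⧸ K) = π g :=
        (hmk _ _).2 (by rw [hf]; exact hgy ▸ (infEquiv_equivalence s).refl _)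
      rw [Set.mem_preimage, this]
      exact hg
    rw [h2]
    exact (hJ.isClosedMap_app_left x _ h1).preimage continuous_subtype_val

/-- The orbit of an element modulo infinitesimal automorphisms, as an imaginary sort. -/
def IsCompactCore.orbitImaginary (hJ : IsCompactCore J) {s : 𝓛.Sorts} (x : J.carrier s) :
    HausdorffImaginary J where
  sort := s
  P := orbit x
  E := InfEquiv
  P_pp := hJ.exists_pp_orbit x
  E_pp := hJ.exists_pp_infEquiv x
  equivalence := (infEquiv_equivalence s).comap Subtype.val
  hausdorff := hJ.t2Space_orbit x

/-- An automorphism trivial on the orbit sorts moves each element within its $\mathfrak g$-orbit,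
and being infinitesimal is tested element by element. -/
lemma IsCompactCore.ker_restrictH_le (hJ : IsCompactCore J) :
    (restrictH J).ker ≤ infinitesimal J := by
  intro g hg
  have key : ∀ s (x : J.carrier s), InfEquiv x (g.app s x) := by
    intro s x
    have h1 := restrictH_mk g (hJ.orbitImaginary x) ⟨x, 1, rfl⟩
    rw [MonoidHom.mem_ker.1 hg] at h1
    exact Quotient.exact h1
  rw [mem_infinitesimal_iff]
  intro s U hU x hx
  have h2 : ∀ y, InfEquiv x y → y ∈ closure U := by
    rintro y ⟨k, hk, rfl⟩
    exact ((mem_infinitesimal_iff k).1 hk s U hU x hx).1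
  refine ⟨h2 _ (key s x), h2 _ ((infEquiv_equivalence s).symm ?_)⟩
  have h3 := key s (g⁻¹.app s x)
  rwa [Aut.app_inv_app] at h3

lemma IsCompactCore.compactSpace_autH (hJ : IsCompactCore J) : CompactSpace (AutH J) := by
  have := hJ.compactSpace_aut
  rw [← isCompact_univ_iff, ← Set.range_eq_univ.2 hJ.restrictH_surjective]
  exact isCompact_range continuous_restrictH

lemma IsCompactCore.isTopologicalGroup_autH (hJ : IsCompactCore J) : IsTopologicalGroup (AutH J) :=
  hJ.isTopologicalGroup (restrictH J) continuous_restrictH hJ.restrictH_surjective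

end Kernel

/-! ### Disjunctions of pp formulas, and the transfer of compactness to retracts. -/

section Disjunction

variable {L : FirstOrder.Language.{u, v}} {M : Type w} [L.Structure M] {V : PatSort L → Type d}

/-- The atomic formula `R_t` with its arguments. -/
def patAtom {k : ℕ} (x : Fin k → Σ f : PatFormula L, V f.sort) (α : L.Formula ℕ) :
    Atom (patLang L) V :=
  .rel (⟨k, fun i => (x i).1, α⟩ : PatRel L) fun i => (x i).2

lemma realize_patAtom {k : ℕ} (x : Fin k → Σ f : PatFormula L, V f.sort) (α : L.Formula ℕ)
    (v : ∀ s, V s → GammaType M s) : (patAtom x α).Realize (typeSpace M) v ↔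
      ¬ ∃ b : ℕ → M, α.Realize b ∧ ∀ i, GammaType.Mem (x i).1 b (v _ (x i).2) := Iff.rfl

/-- Renaming of the parameter variables. -/
def PatFormula.shift (f : PatFormula L) (g : ℕ → ℕ) : PatFormula L := ⟨f.sort, f.φ, f.pos, g ∘ f.ρ⟩

lemma Fin.forall_append {α : Type*} {m n : ℕ} (x : Fin m → α) (y : Fin n → α) (P : α → Prop) :
    (∀ i, P (Fin.append x y i)) ↔ (∀ i, P (x i)) ∧ ∀ i, P (y i) := by
  constructor
  · intro h
    exact ⟨fun i => by simpa using h (Fin.castAdd n i), fun i => by simpa using h (Fin.natAdd m i)⟩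
  · rintro ⟨h, h'⟩ i
    refine Fin.addCases (fun i => ?_) (fun i => ?_) i
    · simpa using h i
    · simpa using h' i

/-- The negated disjunction asks for witnesses of both patterns. Moving their parameters to even and
odd indices merges them into a single pattern. -/
lemma exists_patAtom_or {k k' : ℕ} (x : Fin k → Σ f : PatFormula L, V f.sort) (α : L.Formula ℕ)
    (x' : Fin k' → Σ f : PatFormula L, V f.sort) (α' : L.Formula ℕ) :
    ∃ β : Atom (patLang L) V, ∀ v : ∀ s, V s → GammaType M s, β.Realize (typeSpace M) v ↔
      (patAtom x α).Realize (typeSpace M) v ∨ (patAtom x' α').Realize (typeSpace M) v := by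
  refine ⟨patAtom (Fin.append (fun i => ⟨(x i).1.shift (2 * ·), (x i).2⟩)
    fun i => ⟨(x' i).1.shift (2 * · + 1), (x' i).2⟩)
    (α.relabel (2 * ·) ⊓ α'.relabel (2 * · + 1)), fun v => ?_⟩
  rw [realize_patAtom, realize_patAtom, realize_patAtom, ← not_and_or, not_iff_not]
  have key : ∀ b : ℕ → M, ((α.relabel (2 * ·) ⊓ α'.relabel (2 * · + 1) : L.Formula ℕ).Realize b ∧
      ∀ i, GammaType.Mem (Fin.append (fun i => (⟨(x i).1.shift (2 * ·), (x i).2⟩ :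
        Σ f : PatFormula L, V f.sort)) (fun i => ⟨(x' i).1.shift (2 * · + 1), (x' i).2⟩) i).1 b
        (v _ (Fin.append (fun i => (⟨(x i).1.shift (2 * ·), (x i).2⟩ :
        Σ f : PatFormula L, V f.sort)) (fun i => ⟨(x' i).1.shift (2 * · + 1), (x' i).2⟩) i).2)) ↔
      (α.Realize (b ∘ (2 * ·)) ∧ ∀ i, GammaType.Mem (x i).1 (b ∘ (2 * ·)) (v _ (x i).2)) ∧
      (α'.Realize (b ∘ (2 * · + 1)) ∧
        ∀ i, GammaType.Mem (x' i).1 (b ∘ (2 * · + 1)) (v _ (x' i).2)) := by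
    intro b
    rw [Fin.forall_append (P := fun z : Σ f : PatFormula L, V f.sort =>
      GammaType.Mem z.1 b (v _ z.2)), Formula.realize_inf, Formula.realize_relabel,
      Formula.realize_relabel]
    exact and_and_and_comm
  simp only [key]
  constructor
  · rintro ⟨b, h1, h2⟩
    exact ⟨⟨_, h1⟩, ⟨_, h2⟩⟩
  · rintro ⟨⟨b, h1⟩, ⟨b', h2⟩⟩
    refine ⟨fun i => if i % 2 = 0 then b (i / 2) else b' (i / 2), ?_, ?_⟩
    · convert h1 <;> · funext i; simp
    · have : ((fun i => if i % 2 = 0 then b (i / 2) else b' (i / 2)) ∘ (2 * · + 1)) = b' := by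
        funext i
        have h3 : (2 * i + 1) % 2 = 1 := by omega
        have h4 : (2 * i + 1) / 2 = i := by omega
        simp [h3, h4]
      rw [this]
      exact h2

/-- Equality of types is a conjunction of relations $\mathcal R_t$: no instance of a formula of the
finite set `γ` lies in exactly one of the two types. -/
lemma exists_patAtoms (β : Atom (patLang L) V) :
    ∃ l : List (Σ k, (Fin k → Σ f : PatFormula L, V f.sort) × L.Formula ℕ),
      ∀ v : ∀ s, V s → GammaType M s, β.Realize (typeSpace M) v ↔
        ∀ z ∈ l, (patAtom z.2.1 z.2.2).Realize (typeSpace M) v := by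
  classical
  cases β with
  | rel R x => exact ⟨[⟨R.k, fun i => ⟨R.φ i, x i⟩, R.α⟩], fun v => by
      rw [List.forall_mem_singleton]; rfl⟩
  | @eq s x y =>
    let s' : PatSort L := s
    let F : s'.γ × Bool → Σ k, (Fin k → Σ f : PatFormula L, V f.sort) × L.Formula ℕ := fun z =>
      ⟨2, ![⟨⟨s', z.1, z.2, id⟩, x⟩, ⟨⟨s', z.1, !z.2, id⟩, y⟩], ⊤⟩
    refine ⟨(Finset.univ : Finset (s'.γ × Bool)).toList.map F, fun v => ?_⟩
    simp only [List.forall_mem_map, Finset.mem_toList, Finset.mem_univ, forall_true_left, F,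
      realize_patAtom, Formula.realize_top, true_and, Fin.forall_fin_two]
    have hmem : ∀ (z : s'.γ × Bool) (b : ℕ → M),
        (GammaType.Mem ⟨s', z.1, z.2, id⟩ b (v s' x) ∧
          GammaType.Mem ⟨s', z.1, !z.2, id⟩ b (v s' y)) ↔
        ((b ∈ (v s' x).1 z.1 ↔ z.2 = true) ∧ (b ∈ (v s' y).1 z.1 ↔ (!z.2) = true)) :=
      fun z b => Iff.rfl
    refine Iff.trans (b := ∀ (z : s'.γ × Bool), ¬ ∃ b : ℕ → M,
      ((b ∈ (v s' x).1 z.1 ↔ z.2 = true) ∧ (b ∈ (v s' y).1 z.1 ↔ (!z.2) = true))) ?_ Iff.rfl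
    constructor
    · intro h z
      rintro ⟨b, h1, h2⟩
      have h' : v s' x = v s' y := h
      rw [h'] at h1
      have := h1.symm.trans h2
      cases hz : z.2 <;> simp [hz] at this
    · intro h
      change v s' x = v s' y
      refine GammaType.ext fun φ b => ?_
      by_contra hne
      rcases not_iff.1 hne with h3
      by_cases h4 : b ∈ (v s' x).1 φ
      · exact h (φ, true) ⟨b, by simp [h4], by simpa [h4] using h3⟩
      · exact h (φ, false) ⟨b, by simp [h4], by simpa [h4] using h3⟩

lemma exists_atoms_or (β β' : Atom (patLang L) V) :
    ∃ l : List (Atom (patLang L) V), ∀ v : ∀ s, V s → GammaType M s,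
      (∀ γ ∈ l, γ.Realize (typeSpace M) v) ↔
        β.Realize (typeSpace M) v ∨ β'.Realize (typeSpace M) v := by
  obtain ⟨l, hl⟩ := exists_patAtoms (M := M) β
  obtain ⟨l', hl'⟩ := exists_patAtoms (M := M) β'
  choose f hf using fun (z z' : Σ k, (Fin k → Σ f : PatFormula L, V f.sort) × L.Formula ℕ) =>
    exists_patAtom_or (M := M) z.2.1 z.2.2 z'.2.1 z'.2.2
  refine ⟨(l ×ˢ l').map fun z => f z.1 z.2, fun v => ?_⟩
  rw [hl, hl']
  simp only [List.forall_mem_map, List.mem_product, Prod.forall, and_imp, hf]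
  constructor
  · intro h
    by_contra hne
    push Not at hne
    obtain ⟨⟨z, hz, h1⟩, ⟨z', hz', h2⟩⟩ := hne
    exact (h z z' hz hz').elim h1 h2
  · rintro (h | h) z z' hz hz'
    · exact .inl (h z hz)
    · exact .inr (h z' hz')

end Disjunction

section Retracts

variable {𝓛 : RelLang.{a, b}} {J S : Str.{a, b, c} 𝓛}

lemma Atom.realize_retract {V : 𝓛.Sorts → Type e} {j : Hom J S} {r : Hom S J}
    (hr : ∀ s x, r.toFun s (j.toFun s x) = x) (α : Atom 𝓛 V) (v : ∀ s, V s → J.carrier s) :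
    α.Realize J v ↔ α.Realize S fun s x => j.toFun s (v s x) := by
  refine ⟨α.realize_hom j v, fun h => ?_⟩
  have := α.realize_hom r _ h
  simpa only [hr] using this

lemma compact_of_retract {j : Hom J S} {r : Hom S J} (hr : ∀ s x, r.toFun s (j.toFun s x) = x)
    {V : 𝓛.Sorts → Type d} (Γ : Set (PP 𝓛 fun s => V s ⊕ J.carrier s))
    (hS : ∀ (Γ : Set (PP 𝓛 fun s => V s ⊕ S.carrier s)),
      (∀ l : List (PP 𝓛 fun s => V s ⊕ S.carrier s), (∀ φ ∈ l, φ ∈ Γ) →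
        ∃ x : ∀ s, V s → S.carrier s, ∀ φ ∈ l, φ.Realize S fun s => Sum.elim (x s) id) →
      ∃ x : ∀ s, V s → S.carrier s, ∀ φ ∈ Γ, φ.Realize S fun s => Sum.elim (x s) id)
    (h : ∀ l : List (PP 𝓛 fun s => V s ⊕ J.carrier s), (∀ φ ∈ l, φ ∈ Γ) →
      ∃ x : ∀ s, V s → J.carrier s, ∀ φ ∈ l, φ.Realize J fun s => Sum.elim (x s) id) :
    ∃ x : ∀ s, V s → J.carrier s, ∀ φ ∈ Γ, φ.Realize J fun s => Sum.elim (x s) id := by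
  let m (s) : V s ⊕ J.carrier s → V s ⊕ S.carrier s := Sum.map id (j.toFun s)
  obtain ⟨x, hx⟩ := hS (PP.map m '' Γ) fun l hl => by
    have : ∃ l' : List Γ, l'.map (fun φ => φ.1.map m) = l := by
      have : l ∈ Set.range (List.map fun φ : Γ => φ.1.map m) := by
        rw [Set.range_list_map]
        intro φ hφ
        obtain ⟨φ', h1, rfl⟩ := hl φ hφ
        exact ⟨⟨φ', h1⟩, rfl⟩
      exact this
    obtain ⟨l', rfl⟩ := this
    obtain ⟨x, hx⟩ := h (l'.map Subtype.val) (by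
      rw [List.forall_mem_map]
      exact fun φ _ => φ.2)
    refine ⟨fun s i => j.toFun s (x s i), ?_⟩
    rw [List.forall_mem_map] at hx ⊢
    intro φ hφ
    have h1 := PP.realize_hom j _ _ (hx φ hφ)
    refine (PP.realize_map _ _ _ _).2 (Eq.mp (congrArg _ ?_) h1)
    funext s i
    cases i <;> rfl
  refine ⟨fun s i => r.toFun s (x s i), fun φ hφ => ?_⟩
  have h1 := PP.realize_hom r _ _ ((PP.realize_map _ _ _ _).1 (hx _ ⟨φ, hφ, rfl⟩))
  refine Eq.mp (congrArg _ ?_) h1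
  funext s i
  rcases i with i | i
  · rfl
  · exact hr s i

/-- The quantified variables are made disjoint and disjunction is distributed over the atoms.
Nonempty sorts supply values for the variables of the disjunct that is not needed. -/
lemma exists_pp_or (hJ : ∀ s, Nonempty (J.carrier s)) {V : 𝓛.Sorts → Type d} (φ ψ : PP 𝓛 V)
    (h : ∀ α β : Atom 𝓛 fun s => V s ⊕ (Ctx φ.σ s ⊕ Ctx ψ.σ s), ∃ l : List (Atom 𝓛 _), ∀ v,
      (∀ γ ∈ l, γ.Realize J v) ↔ α.Realize J v ∨ β.Realize J v) :
    ∃ χ : PP 𝓛 V, ∀ v, χ.Realize J v ↔ φ.Realize J v ∨ ψ.Realize J v := by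
  let W (s : 𝓛.Sorts) : Type := Ctx φ.σ s ⊕ Ctx ψ.σ s
  let A : List (Atom 𝓛 fun s => V s ⊕ W s) :=
    φ.atoms.map (Atom.map fun _ => Sum.map id Sum.inl)
  let B : List (Atom 𝓛 fun s => V s ⊕ W s) :=
    ψ.atoms.map (Atom.map fun _ => Sum.map id Sum.inr)
  choose f hf using h
  let χ : PP 𝓛 fun s => V s ⊕ W s := PP.ofAtoms ((A ×ˢ B).flatMap fun z => f z.1 z.2)
  have hχ : ∀ v : ∀ s, V s ⊕ W s → J.carrier s, χ.Realize J v ↔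
      (∀ α ∈ A, α.Realize J v) ∨ ∀ α ∈ B, α.Realize J v := by
    intro v
    refine (PP.realize_ofAtoms J _ v).trans ?_
    simp only [List.mem_flatMap, List.mem_product, forall_exists_index, and_imp, Prod.exists]
    constructor
    · intro h
      by_contra hne
      push Not at hne
      obtain ⟨⟨α, hα, h1⟩, ⟨β, hβ, h2⟩⟩ := hne
      exact ((hf α β v).1 fun γ hγ => h γ α β hα hβ hγ).elim h1 h2
    · rintro (h | h) γ α β hα hβ hγ
      · exact (hf α β v).2 (.inl (h α hα)) γ hγ
      · exact (hf α β v).2 (.inr (h β hβ)) γ hγ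
  have hA : ∀ (v : ∀ s, V s → J.carrier s) (w : ∀ s, W s → J.carrier s),
      (∀ α ∈ A, α.Realize J fun s => Sum.elim (v s) (w s)) ↔
        ∀ α ∈ φ.atoms, α.Realize J fun s => Sum.elim (v s) fun i => w s (.inl i) := by
    intro v w
    refine (Atom.forall_realize_map J _ _ _).trans (iff_of_eq ?_)
    refine congrArg (fun v => ∀ α ∈ φ.atoms, α.Realize J v) ?_
    funext s x
    cases x <;> rfl
  have hB : ∀ (v : ∀ s, V s → J.carrier s) (w : ∀ s, W s → J.carrier s),
      (∀ α ∈ B, α.Realize J fun s => Sum.elim (v s) (w s)) ↔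
        ∀ α ∈ ψ.atoms, α.Realize J fun s => Sum.elim (v s) fun i => w s (.inr i) := by
    intro v w
    refine (Atom.forall_realize_map J _ _ _).trans (iff_of_eq ?_)
    refine congrArg (fun v => ∀ α ∈ ψ.atoms, α.Realize J v) ?_
    funext s x
    cases x <;> rfl
  refine ⟨χ.exs, fun v => ⟨fun h => ?_, fun h => ?_⟩⟩
  · obtain ⟨w, hw⟩ := PP.exists_of_realize_exs hJ h
    rw [hχ, hA, hB] at hw
    rcases hw with hw | hw
    · obtain ⟨y, hy⟩ := exists_tuple_eq (A := J.carrier) fun s i => w s (.inl i)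
      exact .inl ⟨y, by rw [hy]; exact hw⟩
    · obtain ⟨y, hy⟩ := exists_tuple_eq (A := J.carrier) fun s i => w s (.inr i)
      exact .inr ⟨y, by rw [hy]; exact hw⟩
  · rcases h with ⟨y, hy⟩ | ⟨y, hy⟩
    · refine PP.realize_exs_of (fun s => Sum.elim (tuple y s) fun _ => (hJ s).some) ?_
      exact (hχ _).2 (.inl ((hA v _).2 hy))
    · refine PP.realize_exs_of (fun s => Sum.elim (fun _ => (hJ s).some) (tuple y s)) ?_
      exact (hχ _).2 (.inr ((hB v _).2 hy))

end Retracts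

section CompactCores

variable {L : FirstOrder.Language.{u, v}} {M : Type w} [L.Structure M] [Nonempty M]
  {J : Str.{max u v, max u v, max u v w} (patLang L)}

lemma isCompactCore_of_retract {j : Hom J (typeSpace M)} {r : Hom (typeSpace M) J}
    (hr : ∀ s x, r.toFun s (j.toFun s x) = x)
    (haut : ∀ f : Hom J J, ∃ g : Aut J, ∀ s x, g.app s x = f.toFun s x) : IsCompactCore J := by
  have hne : ∀ s, Nonempty (J.carrier s) := fun s => (nonempty_typeSpace M s).map (r.toFun s)
  refine ⟨hne, fun V Γ h => compact_of_retract hr Γ exists_realize_of_finite h, haut,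
    fun V φ ψ => exists_pp_or hne φ ψ fun α β => ?_, ?_⟩
  · obtain ⟨l, hl⟩ := exists_atoms_or (M := M) α β
    refine ⟨l, fun v => ?_⟩
    rw [Atom.realize_retract hr α, Atom.realize_retract hr β]
    refine Iff.trans ?_ (hl _)
    exact forall₂_congr fun γ _ => Atom.realize_retract hr γ v
  -- The relation symbol without arguments and with $\alpha=\top$ denies that there is any parameter
  -- tuple.
  · refine ⟨PP.ofAtoms [patAtom (k := 0) finZeroElim ⊤], fun h => ?_⟩
    have h1 : (typeSpace M).Sat _ := h.hom j
    have h2 := (PP.realize_ofAtoms _ _ _).1 h1 _ (List.mem_singleton_self _)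
    exact h2 ⟨fun _ => Classical.arbitrary M, by simp, fun i => i.elim0⟩

end CompactCores

/-! ### Cardinality bounds. -/

section Cardinality

open Cardinal

variable {L : FirstOrder.Language.{u, v}}

lemma mk_patSort_le : #(PatSort L) ≤ max ℵ₀ L.card := by
  let f : PatSort L → Σ n, List (L.Formula (Fin n ⊕ ℕ)) := fun s => ⟨s.n, s.γ.toList⟩
  have hf : Function.Injective f := by
    rintro ⟨n, γ⟩ ⟨n', γ'⟩ h
    obtain ⟨rfl, h⟩ := Sigma.mk.inj h
    have : γ = γ' := by
      classical
      rw [← Finset.toList_toFinset γ, ← Finset.toList_toFinset γ', eq_of_heq h]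
    rw [this]
  have hF : ∀ n, #(L.Formula (Fin n ⊕ ℕ)) ≤ max ℵ₀ L.card := by
    intro n
    have h1 : #(L.Formula (Fin n ⊕ ℕ)) ≤ #(Σ n', L.BoundedFormula (Fin n ⊕ ℕ) n') :=
      mk_le_of_injective (f := fun φ => ⟨0, φ⟩) fun φ ψ h => eq_of_heq (Sigma.mk.inj h).2
    refine h1.trans (BoundedFormula.card_le.trans ?_)
    simp only [mk_sum, mk_fin, mk_nat, lift_natCast, lift_aleph0, lift_add]
    refine max_le (le_max_left _ _) (add_le_of_le (le_max_left _ _) ?_ ?_)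
    · exact (add_le_aleph0.2 ⟨(natCast_lt_aleph0).le, le_rfl⟩).trans (le_max_left _ _)
    · simp
  refine (mk_le_of_injective hf).trans ?_
  rw [mk_sigma]
  refine (sum_le_sum _ (fun _ => max ℵ₀ L.card) fun n => ?_).trans ?_
  · refine (mk_list_le_max _).trans (max_le (le_max_left _ _) (hF n))
  · rw [sum_const]
    simp only [mk_nat, lift_aleph0, lift_id']
    refine mul_le_of_le (le_max_left _ _) (le_max_left _ _) (by simp)

/-- Each formula involves finitely many parameter variables, so a type is determined by its
behaviour on finite lists of parameters, padded by a fixed element. -/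
lemma mk_gammaType_le (M : Type w) [L.Structure M] [Nonempty M] (s : PatSort L) :
    #(GammaType M s) ≤ 2 ^ max ℵ₀ (lift.{max u v} #M) := by
  let f : GammaType M s → Set (s.γ × List M) := fun p =>
    {z | (fun k => z.2.getD k (Classical.arbitrary M)) ∈ p.1 z.1}
  have hf : Function.Injective f := by
    intro p q h
    refine GammaType.ext fun φ b => ?_
    obtain ⟨F, hF⟩ := GammaType.mem_congr φ
    let l : List M := (List.range (F.sup id + 1)).map b
    have hl : ∀ k ∈ F, b k = l.getD k (Classical.arbitrary M) := by
      intro k hk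
      have : k < F.sup id + 1 := Nat.lt_succ_of_le (Finset.le_sup (f := id) hk)
      simp [l, List.getD, this]
    rw [hF M p b _ hl, hF M q b _ hl]
    exact Set.ext_iff.1 h (φ, l)
  have h1 := mk_le_of_injective hf
  have h2 : lift.{w} #s.γ ≤ ℵ₀ := by
    rw [lift_le_aleph0]
    exact (lt_aleph0_of_finite _).le
  have h3 : #(List M) ≤ max ℵ₀ #M := mk_list_le_max M
  rw [mk_set, mk_prod] at h1
  have h4 : lift.{w} #s.γ * lift.{max u v} #(List M) ≤ max ℵ₀ (lift.{max u v} #M) := by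
    refine mul_le_of_le (le_max_left _ _) (h2.trans (le_max_left _ _)) ?_
    refine (lift_le.2 h3).trans ?_
    simp
  exact h1.trans (power_le_power_left two_ne_zero h4)

lemma exists_small_model {T : L.Theory} (hT : T.IsSatisfiable) :
    ∃ (M : Type (max u v w)) (_ : L.Structure M) (_ : Nonempty M), M ⊨ T ∧
      #M ≤ lift.{w} (max ℵ₀ L.card : Cardinal.{max u v}) := by
  obtain ⟨M⟩ := hT
  have : ∃ (N : Type (max u v)) (_ : L.Structure N) (_ : Nonempty N), N ⊨ T ∧
      #N ≤ max ℵ₀ L.card := by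
    by_cases h : #M ≤ max ℵ₀ L.card
    · exact ⟨M, inferInstance, inferInstance, M.is_model, h⟩
    · obtain ⟨S, hS⟩ := exists_elementarySubstructure_card_eq L (M := M) ∅ (max ℵ₀ L.card)
        (le_max_left _ _) (by simp) (by simp) (by simpa using (not_le.1 h).le)
      have hS' : #S = max ℵ₀ L.card := by simpa using hS
      refine ⟨S, inferInstance, ?_, ?_, hS'.le⟩
      · rw [← mk_ne_zero_iff, hS']
        exact (aleph0_pos.trans_le (le_max_left _ _)).ne'
      · exact S.theory_model_iff T |>.2 M.is_model
  obtain ⟨N, _, _, hN, hc⟩ := this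
  let g : ULift.{w} N ≃ N := Equiv.ulift
  let : L.Structure (ULift.{w} N) := g.symm.inducedStructure
  let k : N ≃[L] ULift.{w} N := g.symm.inducedStructureEquiv
  refine ⟨ULift.{w} N, inferInstance, inferInstance, ?_, ?_⟩
  · exact k.toElementaryEmbedding.elementarilyEquivalent.theory_model_iff.1 hN
  · rw [mk_uLift]
    exact lift_le.2 hc

lemma mk_core_le {J : Str.{max u v, max u v, max u v w} (patLang L)} (M : Type (max u v w))
    [L.Structure M] [Nonempty M] (hM : #M ≤ lift.{w} (max ℵ₀ L.card : Cardinal.{max u v}))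
    (hJ : ∀ s : PatSort L, #(J.carrier s) ≤ #(GammaType.{u, v, max u v w} M s)) :
    #(Σ s, J.carrier s) ≤ lift.{w} (2 ^ max ℵ₀ L.card : Cardinal.{max u v}) := by
  have h1 : lift.{w} (max ℵ₀ L.card : Cardinal.{max u v}) ≤
      lift.{w} (2 ^ max ℵ₀ L.card : Cardinal.{max u v}) := lift_le.2 (cantor _).le
  have h2 : ∀ s : PatSort L, #(J.carrier s) ≤
      lift.{w} (2 ^ max ℵ₀ L.card : Cardinal.{max u v}) := by
    intro s
    refine (hJ s).trans ((mk_gammaType_le M s).trans ?_)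
    rw [lift_power, lift_two]
    refine power_le_power_left two_ne_zero (max_le ?_ ?_)
    · simp
    · exact (lift_id'.{max u v, max u v w} #M).le.trans hM
  rw [mk_sigma]
  refine (sum_le_sum _ (fun _ => lift.{w} (2 ^ max ℵ₀ L.card : Cardinal.{max u v})) h2).trans ?_
  rw [sum_const]
  refine mul_le_of_le ?_ ?_ ?_
  · exact (by simp : ℵ₀ ≤ lift.{w} (max ℵ₀ L.card : Cardinal.{max u v})).trans h1
  · refine le_trans ?_ h1
    rw [← lift_umax.{max u v, w}]
    exact lift_le.2 (mk_patSort_le (L := L))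
  · exact (lift_id'.{max u v, max u v w} _).le

end Cardinality

/-! ### The approximate Lascar neighbour relations in type spaces. -/

section Products

/-- This realizes two limit types by one ultrafilter of pairs, without constraint between the two
tuples. -/
lemma exists_ultrafilter_prod {X Y : Type*} (U : Ultrafilter X) (U' : Ultrafilter Y) :
    ∃ W : Ultrafilter (X × Y), W.map Prod.fst = U ∧ W.map Prod.snd = U' := by
  have : Filter.NeBot ((U : Filter X) ×ˢ (U' : Filter Y)) := inferInstance
  have hle := Ultrafilter.of_le ((U : Filter X) ×ˢ (U' : Filter Y))
  refine ⟨Ultrafilter.of (U ×ˢ U'), ?_, ?_⟩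
  · exact Ultrafilter.coe_le_coe.1 ((Filter.map_mono hle).trans Filter.tendsto_fst)
  · exact Ultrafilter.coe_le_coe.1 ((Filter.map_mono hle).trans Filter.tendsto_snd)

end Products

section Neighbours

variable {L : FirstOrder.Language.{u, v}}

section General

variable {A B : Str.{max u v, max u v, c} (patLang L)} {s s' : PatSort L}

lemma pair_comp {F : PatSort L → Type c} {G : PatSort L → Type d} (f : ∀ s, F s → G s)
    {φ ψ : PatFormula L} (q : F φ.sort) (p : F ψ.sort) :
    (fun i => f _ ((Fin.cons q (Fin.cons p finZeroElim) : (i : Fin 2) → F (![φ, ψ] i).sort) i)) =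
      (Fin.cons (f _ q) (Fin.cons (f _ p) finZeroElim) : (i : Fin 2) → G (![φ, ψ] i).sort) := by
  funext i
  match i with
  | 0 => rfl
  | 1 => rfl

lemma OmitsPair.hom (f : Hom A B) {φ ψ : PatFormula L} {q : A.carrier φ.sort}
    {p : A.carrier ψ.sort} (h : OmitsPair A φ ψ q p) :
    OmitsPair B φ ψ (f.toFun φ.sort q) (f.toFun ψ.sort p) :=
  Eq.mp (congrArg (B.rel (⟨2, ![φ, ψ], ⊤⟩ : PatRel L)) (pair_comp f.toFun q p))
    (f.map_rel (⟨2, ![φ, ψ], ⊤⟩ : PatRel L) _ h)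

lemma SameDef.hom (f : Hom A B) {φ : s.γ} {ψ : s'.γ} {q : A.carrier s} {p : A.carrier s'}
    (h : SameDef A φ ψ q p) : SameDef B φ ψ (f.toFun s q) (f.toFun s' p) :=
  fun ε => (h ε).hom f

lemma Contains.hom (f : Hom A B) {θ : s.γ} {q : A.carrier s} (h : Contains A θ q) :
    Contains B θ (f.toFun s q) :=
  f.map_rel (⟨1, fun _ => ⟨s, θ, false, id⟩, ⊤⟩ : PatRel L) _ h

variable (A) in
/-- The approximation of the Lascar neighbour relation given by a formula and a finite set of
formulas. -/
def LNat {k : ℕ} (D : L.Formula (Fin k)) (Δ : Finset (L.Formula (Fin s.n ⊕ Fin k)))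
    (p p' : A.carrier s) : Prop :=
  ∃ q : A.carrier (pairSort s (sameTypeFormula D Δ)),
    Contains A ⟨_, mem_pairSort s (sameTypeFormula D Δ)⟩ q ∧
    ∀ φ : s.γ,
      SameDef A ⟨_, left_mem_pairSort s (sameTypeFormula D Δ) φ⟩ φ q p ∧
      SameDef A ⟨_, right_mem_pairSort s (sameTypeFormula D Δ) φ⟩ φ q p'

variable {k : ℕ} {D : L.Formula (Fin k)} {Δ : Finset (L.Formula (Fin s.n ⊕ Fin k))}

lemma LNat.hom (f : Hom A B) {p p' : A.carrier s} (h : LNat A D Δ p p') :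
    LNat B D Δ (f.toFun s p) (f.toFun s p') := by
  obtain ⟨q, hq, h⟩ := h
  exact ⟨f.toFun _ q, hq.hom f, fun φ => ⟨(h φ).1.hom f, (h φ).2.hom f⟩⟩

lemma isPP_omitsPair {V : PatSort L → Type d} (φ ψ : PatFormula L) (x : V φ.sort) (y : V ψ.sort) :
    IsPP (V := V) A fun v => OmitsPair A φ ψ (v φ.sort x) (v ψ.sort y) := by
  obtain ⟨χ, hχ⟩ := IsPP.of_atom (A := A) (V := V)
    (.rel (⟨2, ![φ, ψ], ⊤⟩ : PatRel L) (Fin.cons x (Fin.cons y finZeroElim)))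
  refine ⟨χ, fun v => Iff.trans ?_ (hχ v)⟩
  exact iff_of_eq (congrArg (A.rel (⟨2, ![φ, ψ], ⊤⟩ : PatRel L)) (pair_comp v x y).symm)

lemma isPP_sameDef {V : PatSort L → Type d} (φ : s.γ) (ψ : s'.γ) (x : V s) (y : V s') :
    IsPP (V := V) A fun v => SameDef A φ ψ (v s x) (v s' y) :=
  IsPP.forall_finite fun ε => isPP_omitsPair ⟨s, φ, ε, id⟩ ⟨s', ψ, !ε, id⟩ x y

lemma isPP_lNat {V : PatSort L → Type d} (x y : V s) :
    IsPP (V := V) A fun v => LNat A D Δ (v s x) (v s y) := by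
  refine IsPP.exists_elem (𝓛 := patLang L) (A := A) (V := V)
    (s := pairSort s (sameTypeFormula D Δ)) (X := fun (v : ∀ s : PatSort L, V s → A.carrier s) q =>
    Contains A ⟨_, mem_pairSort s (sameTypeFormula D Δ)⟩ q ∧
    ∀ φ : s.γ, SameDef A ⟨_, left_mem_pairSort s (sameTypeFormula D Δ) φ⟩ φ q (v s x) ∧
      SameDef A ⟨_, right_mem_pairSort s (sameTypeFormula D Δ) φ⟩ φ q (v s y)) ?_
  refine IsPP.and ?_ (IsPP.forall_finite fun φ => IsPP.and ?_ ?_)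
  · exact IsPP.of_atom (𝓛 := patLang L) (A := A)
      (V := fun t => V t ⊕ Ctx (𝓛 := patLang L) (fun _ : Fin 1 => pairSort s (sameTypeFormula D Δ)) t)
      (Atom.rel (𝓛 := patLang L) (⟨1, fun _ => ⟨_, ⟨_, mem_pairSort s (sameTypeFormula D Δ)⟩, false,
        id⟩, ⊤⟩ : PatRel L) fun _ => Sum.inr ⟨0, rfl⟩)
  · exact isPP_sameDef (s := pairSort s (sameTypeFormula D Δ))
      (V := fun t => V t ⊕ Ctx (𝓛 := patLang L) (fun _ : Fin 1 => _) t) _ φ (.inr ⟨0, rfl⟩) (.inl x)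
  · exact isPP_sameDef (s := pairSort s (sameTypeFormula D Δ))
      (V := fun t => V t ⊕ Ctx (𝓛 := patLang L) (fun _ : Fin 1 => _) t) _ φ (.inr ⟨0, rfl⟩) (.inl y)

end General

section TypeSpaces

variable {M : Type w} [L.Structure M] {s s' : PatSort L}

lemma sameDef_typeSpace (φ : s.γ) (ψ : s'.γ) (q : GammaType M s) (p : GammaType M s') :
    SameDef (typeSpace M) φ ψ q p ↔ ∀ b, b ∈ q.1 φ ↔ b ∈ p.1 ψ := by
  have key : ∀ ε : Bool, OmitsPair (typeSpace M) ⟨s, φ, ε, id⟩ ⟨s', ψ, !ε, id⟩ q p ↔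
      ¬ ∃ b : ℕ → M, (b ∈ q.1 φ ↔ ε = true) ∧ (b ∈ p.1 ψ ↔ (!ε) = true) := by
    intro ε
    refine not_congr (exists_congr fun b => ⟨fun h => ⟨h.2 0, h.2 1⟩, fun h => ⟨?_, fun i => ?_⟩⟩)
    · exact Formula.realize_top.2 trivial
    · match i with
      | 0 => exact h.1
      | 1 => exact h.2
  refine (forall_congr' key).trans ⟨fun h b => ?_, fun h ε => ?_⟩
  · by_contra hne
    have h3 := not_iff.1 hne
    by_cases h4 : b ∈ q.1 φ
    · exact h true ⟨b, by simp [h4], by simpa [h4] using h3⟩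
    · exact h false ⟨b, by simp [h4], by simpa [h4] using h3⟩
  · rintro ⟨b, h1, h2⟩
    rw [h b] at h1
    have := h1.symm.trans h2
    cases ε <;> simp at this

lemma contains_typeSpace (θ : s.γ) (q : GammaType M s) :
    Contains (typeSpace M) θ q ↔ ∀ b, b ∈ q.1 θ := by
  have key : Contains (typeSpace M) θ q ↔
      ¬ ∃ b : ℕ → M, (⊤ : L.Formula ℕ).Realize b ∧ ∀ _ : Fin 1, (b ∈ q.1 θ ↔ false = true) := Iff.rfl
  rw [key]
  simp

/-- The tuples `e` and `e'` have the same `Δ`-type over some realization of `D`. -/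
def SameType {n k : ℕ} (D : L.Formula (Fin k)) (Δ : Finset (L.Formula (Fin n ⊕ Fin k)))
    (e e' : Fin n → M) : Prop :=
  ∃ z : Fin k → M, D.Realize z ∧
    ∀ φ ∈ Δ, φ.Realize (Sum.elim e z) ↔ φ.Realize (Sum.elim e' z)

lemma SameType.symm {n k : ℕ} {D : L.Formula (Fin k)} {Δ : Finset (L.Formula (Fin n ⊕ Fin k))}
    {e e' : Fin n → M} (h : SameType D Δ e e') : SameType D Δ e' e := by
  obtain ⟨z, hz, h⟩ := h
  exact ⟨z, hz, fun φ hφ => (h φ hφ).symm⟩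

lemma realize_sameTypeFormula {n k : ℕ} (D : L.Formula (Fin k))
    (Δ : Finset (L.Formula (Fin n ⊕ Fin k))) (e : Fin (n + n) → M) (b : ℕ → M) :
    (sameTypeFormula D Δ).Realize (Sum.elim e b) ↔
      SameType D Δ (e ∘ Fin.castAdd n) (e ∘ Fin.natAdd n) := by
  rw [sameTypeFormula, Formula.realize_iExs]
  refine exists_congr fun z => ?_
  rw [Formula.realize_inf, Formula.realize_iInf]
  refine and_congr ?_ ?_
  · rw [Formula.realize_relabel, Sum.elim_comp_inr]
  · rw [Subtype.forall]
    refine forall₂_congr fun φ _ => ?_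
    rw [Formula.realize_iff, Formula.realize_relabel, Formula.realize_relabel]
    refine iff_congr (iff_of_eq (congrArg _ ?_)) (iff_of_eq (congrArg _ ?_)) <;>
    · funext i
      cases i <;> rfl

lemma realize_leftFormula {n : ℕ} (φ : L.Formula (Fin n ⊕ ℕ)) (e : Fin (n + n) → M) (b : ℕ → M) :
    (leftFormula φ).Realize (Sum.elim e b) ↔ φ.Realize (Sum.elim (e ∘ Fin.castAdd n) b) := by
  rw [leftFormula, Formula.realize_relabel]
  refine iff_of_eq (congrArg _ ?_)
  funext i
  cases i <;> rfl

lemma realize_rightFormula {n : ℕ} (φ : L.Formula (Fin n ⊕ ℕ)) (e : Fin (n + n) → M) (b : ℕ → M) :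
    (rightFormula φ).Realize (Sum.elim e b) ↔ φ.Realize (Sum.elim (e ∘ Fin.natAdd n) b) := by
  rw [rightFormula, Formula.realize_relabel]
  refine iff_of_eq (congrArg _ ?_)
  funext i
  cases i <;> rfl

/-- The type of a tuple under an ultrafilter. -/
def IsLimitType {I : Type*} (p : GammaType M s) (W : Ultrafilter I) (e : I → Fin s.n → M) : Prop :=
  ∀ φ b, b ∈ p.1 φ ↔ ∀ᶠ i in (W : Filter I), φ.1.Realize (Sum.elim (e i) b)

variable [Nonempty M]

lemma exists_isLimitType (p : GammaType M s) :
    ∃ W : Ultrafilter (Fin s.n → M), IsLimitType p W id := by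
  obtain ⟨W, rfl⟩ := p.exists_eq_ofUltrafilter
  exact ⟨W, fun φ b => GammaType.mem_ofUltrafilter W φ b⟩

lemma exists_gammaType (s : PatSort L) {I : Type*} (W : Ultrafilter I) (e : I → Fin s.n → M) :
    ∃ p : GammaType M s, IsLimitType p W e :=
  ⟨GammaType.ofUltrafilter s (W.map e), fun φ b => GammaType.mem_ofUltrafilter _ φ b⟩

variable {k : ℕ} {D : L.Formula (Fin k)} {Δ : Finset (L.Formula (Fin s.n ⊕ Fin k))}

lemma lNat_of_isLimitType {I : Type*} {W : Ultrafilter I} {e e' : I → Fin s.n → M}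
    {p p' : GammaType M s} (hp : IsLimitType p W e) (hp' : IsLimitType p' W e')
    (h : ∀ᶠ i in (W : Filter I), SameType D Δ (e i) (e' i)) : LNat (typeSpace M) D Δ p p' := by
  obtain ⟨q, hq⟩ := exists_gammaType (pairSort s (sameTypeFormula D Δ)) W
    fun i => Fin.append (e i) (e' i)
  have hl : ∀ i, Fin.append (e i) (e' i) ∘ Fin.castAdd s.n = e i := fun i =>
    funext fun l => Fin.append_left _ _ l
  have hr : ∀ i, Fin.append (e i) (e' i) ∘ Fin.natAdd s.n = e' i := fun i =>
    funext fun l => Fin.append_right _ _ l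
  refine ⟨q, (contains_typeSpace _ q).2 fun b => (hq _ b).2 ?_, fun φ =>
    ⟨(sameDef_typeSpace _ φ q p).2 fun b => ?_, (sameDef_typeSpace _ φ q p').2 fun b => ?_⟩⟩
  · filter_upwards [h] with i hi
    refine (realize_sameTypeFormula D Δ _ b).2 ?_
    rwa [hl, hr]
  · rw [hq, hp]
    refine Filter.eventually_congr (Filter.Eventually.of_forall fun i => ?_)
    refine (realize_leftFormula φ.1 _ b).trans ?_
    rw [hl]
  · rw [hq, hp']
    refine Filter.eventually_congr (Filter.Eventually.of_forall fun i => ?_)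
    refine (realize_rightFormula φ.1 _ b).trans ?_
    rw [hr]

/-- Together with `lNat_of_isLimitType` this replaces the auxiliary type `q` by an ultrafilter of
pairs of tuples, in which form the relation is manifestly symmetric. -/
lemma LNat.exists_ultrafilter {p p' : GammaType M s} (h : LNat (typeSpace M) D Δ p p') :
    ∃ W : Ultrafilter (Fin (s.n + s.n) → M),
      IsLimitType p W (fun e => e ∘ Fin.castAdd s.n) ∧
      IsLimitType p' W (fun e => e ∘ Fin.natAdd s.n) ∧
      ∀ᶠ e in (W : Filter (Fin (s.n + s.n) → M)),
        SameType D Δ (e ∘ Fin.castAdd s.n) (e ∘ Fin.natAdd s.n) := by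
  obtain ⟨q, hq, h⟩ := h
  obtain ⟨W, hW⟩ := exists_isLimitType (s := pairSort s (sameTypeFormula D Δ)) q
  refine ⟨W, fun φ b => ?_, fun φ b => ?_, ?_⟩
  · rw [← (sameDef_typeSpace _ φ q p).1 (h φ).1 b, hW]
    exact Filter.eventually_congr (Filter.Eventually.of_forall fun e => realize_leftFormula φ.1 e b)
  · rw [← (sameDef_typeSpace _ φ q p').1 (h φ).2 b, hW]
    exact Filter.eventually_congr (Filter.Eventually.of_forall fun e => realize_rightFormula φ.1 e b)
  · have h1 := (hW _ _).1 ((contains_typeSpace _ q).1 hq fun _ => Classical.arbitrary M)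
    exact h1.mono fun e he => (realize_sameTypeFormula D Δ e _).1 he

lemma LNat.symm_typeSpace {p p' : GammaType M s} (h : LNat (typeSpace M) D Δ p p') :
    LNat (typeSpace M) D Δ p' p := by
  obtain ⟨W, h1, h2, h3⟩ := h.exists_ultrafilter
  exact lNat_of_isLimitType h2 h1 (h3.mono fun e he => he.symm)

/-- A structure in which types in a sort extend to types in a larger sort. -/
def HasExtensions (A : Str.{max u v, max u v, c} (patLang L)) : Prop :=
  ∀ (s : PatSort L) (p : A.carrier s) (γ : Finset (L.Formula (Fin s.n ⊕ ℕ))) (h : s.γ ⊆ γ),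
    ∃ q : A.carrier ⟨s.n, γ⟩, ∀ φ : s.γ,
      SameDef (s := ⟨s.n, γ⟩) A ⟨φ.1, h φ.2⟩ φ q p

variable (M) in
lemma hasExtensions_typeSpace : HasExtensions (typeSpace (L := L) M) := by
  intro s p γ h
  obtain ⟨W, hW⟩ := exists_isLimitType (s := s) p
  obtain ⟨q, hq⟩ := exists_gammaType ⟨s.n, γ⟩ W id
  exact ⟨q, fun φ => (sameDef_typeSpace _ φ q p).2 fun b => (hq _ b).trans (hW φ b).symm⟩

lemma HasExtensions.of_retract {A B : Str.{max u v, max u v, c} (patLang L)}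
    (hB : HasExtensions B) {j : Hom A B} {r : Hom B A}
    (hr : ∀ s x, r.toFun s (j.toFun s x) = x) : HasExtensions A := by
  intro s p γ h
  obtain ⟨q, hq⟩ := hB s (j.toFun s p) γ h
  refine ⟨r.toFun _ q, fun φ => ?_⟩
  exact Eq.mp (congrArg _ (hr s p)) ((hq φ).hom r)

/-- Suppose not. Some common extension of the two types then contains the negation of
`sameTypeFormula D Δ`. Containing it and extending the two types are positive conditions, so they
survive `v`. But after `v` both types coincide, so `x` and `x'` have the same `Δ`-type over every
tuple of `M'`, in particular over a realization of `D`. -/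
lemma lNat_of_comp_eq {M' : Type w} [L.Structure M'] [Nonempty M']
    {A : Str.{max u v, max u v, max u v w} (patLang L)} (hA : HasExtensions A)
    (f f' : Hom A (typeSpace M)) (v : Hom (typeSpace (L := L) M) (typeSpace M'))
    (hv : ∀ s x, v.toFun s (f.toFun s x) = v.toFun s (f'.toFun s x))
    (hD : ∃ z : Fin k → M', D.Realize z) (p : A.carrier s) :
    LNat (typeSpace M) D Δ (f.toFun s p) (f'.toFun s p) := by
  classical
  -- The sort need not contain the formulas of `Δ`; they are added and `p` is extended already in
  -- `A`, so that the images of the extension under `f` and `f'` still agree after `v`.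
  let ι : Fin s.n ⊕ Fin k → Fin s.n ⊕ ℕ := Sum.map id Fin.val
  let s' : PatSort L := ⟨s.n, s.γ ∪ Δ.image (Formula.relabel ι)⟩
  obtain ⟨p', hp'⟩ := hA s p s'.γ Finset.subset_union_left
  obtain ⟨U, hU⟩ := exists_isLimitType (s := s') (f.toFun s' p')
  obtain ⟨U', hU'⟩ := exists_isLimitType (s := s') (f'.toFun s' p')
  obtain ⟨W, hW1, hW2⟩ := exists_ultrafilter_prod U U'
  have h1 : IsLimitType (s := s') (f.toFun s' p') W Prod.fst := by
    intro φ b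
    rw [hU φ b, ← hW1]
    rfl
  have h2 : IsLimitType (s := s') (f'.toFun s' p') W Prod.snd := by
    intro φ b
    rw [hU' φ b, ← hW2]
    rfl
  have h1' : IsLimitType (s := s) (f.toFun s p) W Prod.fst := fun φ b =>
    ((sameDef_typeSpace _ φ _ _).1 ((hp' φ).hom f) b).symm.trans (h1 _ b)
  have h2' : IsLimitType (s := s) (f'.toFun s p) W Prod.snd := fun φ b =>
    ((sameDef_typeSpace _ φ _ _).1 ((hp' φ).hom f') b).symm.trans (h2 _ b)
  refine lNat_of_isLimitType h1' h2' ?_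
  by_contra hne
  have hne' := Ultrafilter.eventually_not.2 hne
  let θ : L.Formula (Fin (s.n + s.n) ⊕ ℕ) := (sameTypeFormula D Δ).not
  let t : PatSort L := pairSort s' θ
  obtain ⟨q, hq⟩ := exists_gammaType (M := M) t W fun i => Fin.append i.1 i.2
  have hl : ∀ i : (Fin s.n → M) × (Fin s.n → M),
      Fin.append i.1 i.2 ∘ Fin.castAdd s.n = i.1 := fun i =>
    funext fun l => Fin.append_left _ _ l
  have hr : ∀ i : (Fin s.n → M) × (Fin s.n → M),
      Fin.append i.1 i.2 ∘ Fin.natAdd s.n = i.2 := fun i =>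
    funext fun l => Fin.append_right _ _ l
  have hc : Contains (typeSpace M) ⟨_, mem_pairSort s' θ⟩ q := by
    refine (contains_typeSpace _ q).2 fun b => (hq _ b).2 (hne'.mono fun i hi => ?_)
    refine Formula.realize_not.2 fun hi' => hi ?_
    have := (realize_sameTypeFormula D Δ _ b).1 hi'
    rwa [hl, hr] at this
  have hL : ∀ φ : s'.γ, SameDef (typeSpace M) ⟨_, left_mem_pairSort s' θ φ⟩ φ q
      (f.toFun s' p') := fun φ => (sameDef_typeSpace _ φ q _).2 fun b => by
    rw [hq, h1]
    refine Filter.eventually_congr (Filter.Eventually.of_forall fun i => ?_)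
    refine (realize_leftFormula φ.1 _ b).trans ?_
    exact iff_of_eq (congrArg (fun z => φ.1.Realize (Sum.elim z b)) (hl i))
  have hR : ∀ φ : s'.γ, SameDef (typeSpace M) ⟨_, right_mem_pairSort s' θ φ⟩ φ q
      (f'.toFun s' p') := fun φ => (sameDef_typeSpace _ φ q _).2 fun b => by
    rw [hq, h2]
    refine Filter.eventually_congr (Filter.Eventually.of_forall fun i => ?_)
    refine (realize_rightFormula φ.1 _ b).trans ?_
    exact iff_of_eq (congrArg (fun z => φ.1.Realize (Sum.elim z b)) (hr i))
  obtain ⟨W', hW'⟩ : ∃ W' : Ultrafilter (Fin (s.n + s.n) → M'),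
      IsLimitType (s := t) (v.toFun t q) W' id := exists_isLimitType (v.toFun t q)
  obtain ⟨z, hz⟩ := hD
  let b : ℕ → M' := fun i => if h : i < k then z ⟨i, h⟩ else Classical.arbitrary M'
  have hb : b ∘ Fin.val = z := by
    funext i
    simp [b]
  have hcv := (hW' _ b).1 ((contains_typeSpace _ _).1 (hc.hom v) b)
  have hΔ : ∀ᶠ e in (W' : Filter (Fin (s.n + s.n) → M')), ∀ φ : Δ,
      (φ.1.Realize (Sum.elim (e ∘ Fin.castAdd s.n) z) ↔
        φ.1.Realize (Sum.elim (e ∘ Fin.natAdd s.n) z)) := by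
    refine Filter.eventually_all.2 fun φ => ?_
    let φ' : s'.γ := ⟨φ.1.relabel ι, Finset.mem_union_right _ (Finset.mem_image_of_mem _ φ.2)⟩
    have hφ' : ∀ e : Fin s.n → M', φ'.1.Realize (Sum.elim e b) ↔ φ.1.Realize (Sum.elim e z) := by
      intro e
      refine (Formula.realize_relabel).trans (iff_of_eq (congrArg _ ?_))
      funext i
      rcases i with i | i
      · rfl
      · exact congrFun hb i
    have h3 := (sameDef_typeSpace _ φ' _ _).1 ((hL φ').hom v) b
    have h4 := (sameDef_typeSpace _ φ' _ _).1 ((hR φ').hom v) b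
    -- Here the equality after `v` identifies the left and the right type.
    replace h4 := h4.trans ((iff_of_eq (congrArg (fun P : GammaType M' s' => b ∈ P.1 φ')
      (hv s' p').symm)).trans h3.symm)
    rw [hW', hW'] at h4
    have h5 : ∀ e : Fin (s.n + s.n) → M', (leftFormula φ'.1).Realize (Sum.elim e b) ↔
        φ.1.Realize (Sum.elim (e ∘ Fin.castAdd s.n) z) :=
      fun e => (realize_leftFormula φ'.1 e b).trans (hφ' _)
    have h6 : ∀ e : Fin (s.n + s.n) → M', (rightFormula φ'.1).Realize (Sum.elim e b) ↔
        φ.1.Realize (Sum.elim (e ∘ Fin.natAdd s.n) z) :=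
      fun e => (realize_rightFormula φ'.1 e b).trans (hφ' _)
    have h7 : (∀ᶠ e in (W' : Filter (Fin (s.n + s.n) → M')),
        φ.1.Realize (Sum.elim (e ∘ Fin.natAdd s.n) z)) ↔
        ∀ᶠ e in (W' : Filter (Fin (s.n + s.n) → M')),
        φ.1.Realize (Sum.elim (e ∘ Fin.castAdd s.n) z) :=
      ((Filter.eventually_congr (Filter.Eventually.of_forall h6)).symm.trans h4).trans
        (Filter.eventually_congr (Filter.Eventually.of_forall h5))
    by_cases h8 : ∀ᶠ e in (W' : Filter (Fin (s.n + s.n) → M')),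
        φ.1.Realize (Sum.elim (e ∘ Fin.castAdd s.n) z)
    · filter_upwards [h8, h7.2 h8] with e he he' using iff_of_true he he'
    · filter_upwards [Ultrafilter.eventually_not.2 h8,
        Ultrafilter.eventually_not.2 (mt h7.1 h8)] with e he he' using iff_of_false he he'
  obtain ⟨e, he, he'⟩ := (hcv.and hΔ).exists
  refine Formula.realize_not.1 he ((realize_sameTypeFormula D Δ e b).2 ⟨z, hz, fun φ hφ => ?_⟩)
  exact he' ⟨φ, hφ⟩

end TypeSpaces

end Neighbours

/-! ### Closedness of the Lascar set, and the displacement by infinitesimal automorphisms. -/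

section ClosedCovers

/-- A nonempty open set covered by finitely many closed sets meets the interior of one of them.
Apply this to the complement of the union of the closures of the interiors. -/
lemma exists_mem_closure_interior {X ι : Type*} [TopologicalSpace X] [Finite ι] {B : ι → Set X}
    (hB : ∀ i, IsClosed (B i)) (h : ∀ x, ∃ i, x ∈ B i) (x : X) :
    ∃ i, x ∈ closure (interior (B i)) := by
  classical
  have key : ∀ (t : Finset ι) (O : Set X), IsOpen O → O.Nonempty → (∀ x ∈ O, ∃ i ∈ t, x ∈ B i) →
      ∃ i, (O ∩ interior (B i)).Nonempty := by
    intro t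
    induction t using Finset.induction_on with
    | empty =>
      rintro O - ⟨x, hx⟩ h
      obtain ⟨i, hi, -⟩ := h x hx
      exact absurd hi (Finset.notMem_empty i)
    | insert i t _ ih =>
      intro O hO hne h
      by_cases hOB : O ⊆ B i
      · exact ⟨i, by rwa [Set.inter_eq_left.2 (interior_maximal hOB hO)]⟩
      · obtain ⟨y, hy, hyB⟩ := Set.not_subset.1 hOB
        obtain ⟨i', z, hz, hz'⟩ := ih (O ∩ (B i)ᶜ) (hO.inter (hB i).isOpen_compl) ⟨y, hy, hyB⟩
          fun z hz => by
            obtain ⟨i', hi', hzi⟩ := h z hz.1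
            rcases Finset.mem_insert.1 hi' with rfl | hi'
            · exact absurd hzi hz.2
            · exact ⟨i', hi', hzi⟩
        exact ⟨i', z, hz.1, hz'⟩
  have := Fintype.ofFinite ι
  by_contra hne
  push Not at hne
  obtain ⟨i, y, hy, hy'⟩ := key Finset.univ (⋂ i, (closure (interior (B i)))ᶜ)
    (isOpen_iInter_of_finite fun i => isClosed_closure.isOpen_compl)
    ⟨x, Set.mem_iInter.2 hne⟩ fun y _ => by
      obtain ⟨i, hi⟩ := h y
      exact ⟨i, Finset.mem_univ i, hi⟩
  exact Set.mem_iInter.1 hy i (subset_closure hy')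

end ClosedCovers

section LascarSets

variable {L : FirstOrder.Language.{u, v}}

lemma exists_realize_of_models {T : L.Theory} {M : Type w} [L.Structure M] [Nonempty M]
    (hM : M ⊨ T) {k : ℕ} {D : L.Formula (Fin k)}
    (h : T ⊨ᵇ (Formula.iExs (Fin k) (D.relabel (Sum.inr : Fin k → Empty ⊕ Fin k)) : L.Sentence)) :
    ∃ z : Fin k → M, D.Realize z := by
  have h1 := Theory.ModelsBoundedFormula.realize_sentence h M
  obtain ⟨z, hz⟩ := Formula.realize_iExs.1 h1
  rw [Formula.realize_relabel, Sum.elim_comp_inr] at hz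
  exact ⟨z, hz⟩

lemma models_of_exists_realize {T : L.Theory} (hT : T.IsComplete) {M : Type w} [L.Structure M]
    [Nonempty M] (hM : M ⊨ T) {k : ℕ} {D : L.Formula (Fin k)} (h : ∃ z : Fin k → M, D.Realize z) :
    T ⊨ᵇ (Formula.iExs (Fin k) (D.relabel (Sum.inr : Fin k → Empty ⊕ Fin k)) : L.Sentence) := by
  refine (hT.realize_sentence_iff _ M).1 (Formula.realize_iExs.2 ?_)
  obtain ⟨z, hz⟩ := h
  exact ⟨z, by rwa [Formula.realize_relabel, Sum.elim_comp_inr]⟩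

lemma isClosed_lascarSet (J : Str.{max u v, max u v, c} (patLang L)) (T : L.Theory) :
    IsClosed (lascarSet J T) := by
  have : lascarSet J T = ⋂ (s : PatSort L) (p : J.carrier s) (k : ℕ) (D : L.Formula (Fin k))
      (Δ : Finset (L.Formula (Fin s.n ⊕ Fin k)))
      (_ : T ⊨ᵇ (Formula.iExs (Fin k) (D.relabel (Sum.inr : Fin k → Empty ⊕ Fin k)) : L.Sentence)),
      {g | LNat J D Δ p (g.app s p)} := by
    ext g
    simp only [Set.mem_iInter]
    rfl
  rw [this]
  refine isClosed_iInter fun s => isClosed_iInter fun p => isClosed_iInter fun k =>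
    isClosed_iInter fun D => isClosed_iInter fun Δ => isClosed_iInter fun _ => ?_
  obtain ⟨φ, hφ⟩ := isPP_lNat (A := J) (D := D) (Δ := Δ)
    (V := fun t => J.carrier t ⊕ J.carrier t) (s := s) (.inl p) (.inr p)
  have h1 := isClosed_autRealize (J := J) (fun _ => id) φ
  have h2 : {g : Aut J | LNat J D Δ p (g.app s p)} =
      {g | φ.Realize J fun s => Sum.elim id (g.app s)} := by
    ext g
    exact hφ fun s => Sum.elim id (g.app s)
  rw [h2]
  exact h1

variable {M : Type w} [L.Structure M]
  {J : Str.{max u v, max u v, max u v w} (patLang L)} {j : Hom J (typeSpace M)}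
  {r : Hom (typeSpace M) J} {s : PatSort L} {k : ℕ} {D : L.Formula (Fin k)}
  {Δ : Finset (L.Formula (Fin s.n ⊕ Fin k))}

lemma lNat_retract_iff (hr : ∀ s x, r.toFun s (j.toFun s x) = x) {p p' : J.carrier s} :
    LNat J D Δ p p' ↔ LNat (typeSpace M) D Δ (j.toFun s p) (j.toFun s p') := by
  refine ⟨fun h => h.hom j, fun h => ?_⟩
  have h1 := h.hom r
  rwa [show r.toFun s (j.toFun s p) = p from hr s p,
    show r.toFun s (j.toFun s p') = p' from hr s p'] at h1

variable [Nonempty M]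

/-- For one realization `z` of `D` there are finitely many `Δ`-types over `z`, and elements of `J`
inducing the same one are neighbours. One representative for each suffices. -/
lemma exists_finite_cover (hr : ∀ s x, r.toFun s (j.toFun s x) = x)
    (hD : ∃ z : Fin k → M, D.Realize z) :
    ∃ (ι : Type (max u v)) (_ : Finite ι) (x : ι → J.carrier s),
      ∀ y, ∃ i, LNat J D Δ (x i) y := by
  obtain ⟨z, hz⟩ := hD
  choose W hW using fun x : J.carrier s => exists_isLimitType (s := s) (j.toFun s x)
  let c : J.carrier s → Δ → Prop := fun x φ =>
    ∀ᶠ e in (W x : Filter (Fin s.n → M)), φ.1.Realize (Sum.elim e z)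
  choose x' hx' using fun i : Set.range c => i.2
  refine ⟨Set.range c, inferInstance, x', fun y => ⟨⟨c y, y, rfl⟩, ?_⟩⟩
  have hx : c (x' ⟨c y, y, rfl⟩) = c y := hx' _
  generalize x' ⟨c y, y, rfl⟩ = x at hx
  rw [lNat_retract_iff hr]
  obtain ⟨U, hU1, hU2⟩ := exists_ultrafilter_prod (W x) (W y)
  refine lNat_of_isLimitType (W := U) (e := Prod.fst) (e' := Prod.snd) (fun φ b => ?_)
    (fun φ b => ?_) ?_
  · refine (hW x φ b).trans ?_
    rw [← hU1]
    rfl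
  · refine (hW y φ b).trans ?_
    rw [← hU2]
    rfl
  · have : ∀ᶠ i in (U : Filter ((Fin s.n → M) × (Fin s.n → M))), ∀ φ : Δ,
        (φ.1.Realize (Sum.elim i.1 z) ↔ φ.1.Realize (Sum.elim i.2 z)) := by
      refine Filter.eventually_all.2 fun φ => ?_
      have h1 : c x φ ↔ ∀ᶠ i in (U : Filter ((Fin s.n → M) × (Fin s.n → M))),
          φ.1.Realize (Sum.elim i.1 z) := by
        simp only [c]
        rw [← hU1]
        rfl
      have h2 : c y φ ↔ ∀ᶠ i in (U : Filter ((Fin s.n → M) × (Fin s.n → M))),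
          φ.1.Realize (Sum.elim i.2 z) := by
        simp only [c]
        rw [← hU2]
        rfl
      rw [hx] at h1
      by_cases h : c y φ
      · filter_upwards [h1.1 h, h2.1 h] with e he he' using iff_of_true he he'
      · filter_upwards [Ultrafilter.eventually_not.2 (mt h1.2 h),
          Ultrafilter.eventually_not.2 (mt h2.2 h)] with e he he' using iff_of_false he he'
    exact this.mono fun i hi => ⟨z, hz, fun φ hφ => hi ⟨φ, hφ⟩⟩

/-- Infinitesimal automorphisms move elements to neighbours of neighbours. -/
lemma exists_lNat_of_mem_infinitesimal (hr : ∀ s x, r.toFun s (j.toFun s x) = x)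
    (hD : ∃ z : Fin k → M, D.Realize z) {g : Aut J} (hg : g ∈ infinitesimal J)
    (y : J.carrier s) : ∃ x, LNat J D Δ x y ∧ LNat J D Δ x (g.app s y) := by
  let _ : TopologicalSpace (J.carrier s) := ppTopology J s
  obtain ⟨ι, _, x, hx⟩ := exists_finite_cover (Δ := Δ) hr hD
  have hB : ∀ i, IsClosed {y : (J.carrier s) | LNat J D Δ (x i) y} := by
    intro i
    obtain ⟨φ, hφ⟩ := isPP_lNat (A := J) (D := D) (Δ := Δ)
      (V := fun t => Ctx (𝓛 := patLang L) (fun _ : Fin 1 => s) t ⊕ J.carrier t) (s := s)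
      (.inr (x i)) (.inl ⟨0, rfl⟩)
    have h1 := isClosed_realize_param (J := J) (fun _ => id) φ
    have h2 : {y : J.carrier s | LNat J D Δ (x i) y} =
        {y | φ.Realize J fun s' => Sum.elim (tuple (fun _ => y) s') id} := by
      ext y
      exact hφ fun s' => Sum.elim (tuple (fun _ => y) s') id
    rw [h2]
    exact h1
  -- An infinitesimal automorphism preserves the closure of the interior of the `i`-th set, so `y`
  -- and its image have the common neighbour `x i`.
  obtain ⟨i, hi⟩ := exists_mem_closure_interior hB hx y
  refine ⟨x i, (hB i).closure_interior_subset hi, (hB i).closure_interior_subset ?_⟩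
  rw [← hg s _ isOpen_interior]
  exact Set.mem_image_of_mem _ hi

end LascarSets

/-! ### Realizing limits of tuples in saturated models. -/

section Saturation

variable (L : FirstOrder.Language.{u, v}) (M : Type w) [L.Structure M]

/-- `κ`-saturation. -/
def IsSaturated (κ : Cardinal.{w}) : Prop :=
  ∀ A : Set M, Cardinal.mk A < κ → ∀ Γ : Set (L.Formula (A ⊕ Unit)),
    (∀ Γ₀ : Finset (L.Formula (A ⊕ Unit)), ↑Γ₀ ⊆ Γ →
      ∃ m : M, ∀ φ ∈ Γ₀, φ.Realize (Sum.elim (↑) fun _ => m)) →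
    ∃ m : M, ∀ φ ∈ Γ, φ.Realize (Sum.elim (↑) fun _ => m)

/-- Strong `κ`-homogeneity. -/
def IsHomogeneous (κ : Cardinal.{w}) : Prop :=
  ∀ A : Set M, Cardinal.mk A < κ → ∀ f : A → M,
    (∀ φ : L.Formula A, φ.Realize ((↑) : A → M) ↔ φ.Realize f) →
    ∃ σ : modelAut L M, ∀ x : A, σ.1 x = f x

variable {L M} {κ : Cardinal.{w}}

lemma IsHomogeneous.exists_aut (hM : IsHomogeneous L M κ) {I : Type w} (hI : Cardinal.mk I < κ)
    (f f' : I → M) (h : ∀ φ : L.Formula I, φ.Realize f ↔ φ.Realize f') :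
    ∃ σ : modelAut L M, ∀ i, σ.1 (f i) = f' i := by
  choose c hc using fun x : Set.range f => x.2
  have hf' : ∀ i i', f i = f i' → f' i = f' i' := by
    intro i i' hi
    have := h ((Term.var i).equal (Term.var i'))
    simp only [Formula.realize_equal, Term.realize_var] at this
    exact this.1 hi
  obtain ⟨σ, hσ⟩ := hM (Set.range f) (Cardinal.mk_range_le.trans_lt hI) (fun x => f' (c x)) (by
    intro φ
    have := h (φ.relabel c)
    rw [Formula.realize_relabel, Formula.realize_relabel] at this
    rwa [show f ∘ c = ((↑) : Set.range f → M) from funext hc] at this)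
  exact ⟨σ, fun i => (hσ ⟨f i, i, rfl⟩).trans (hf' _ _ (hc ⟨f i, i, rfl⟩))⟩

variable {P V : Type w}

/-- The values `x v` for `v ∈ S` realize the limit, over the parameters `a`, of the types of
the functions `V → M`. -/
def IsPartialLimit (a : P → M) (U : Ultrafilter (V → M)) (S : Set V) (x : V → M) : Prop :=
  ∀ χ : L.Formula (P ⊕ V), DependsOn (fun y : V → M => χ.Realize (Sum.elim a y)) S →
    (∀ᶠ y in (U : Filter (V → M)), χ.Realize (Sum.elim a y)) → χ.Realize (Sum.elim a x)

variable {a : P → M} {U : Ultrafilter (V → M)}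

lemma IsPartialLimit.congr {S : Set V} {x x' : V → M} (h : IsPartialLimit (L := L) a U S x)
    (hx : ∀ v ∈ S, x v = x' v) : IsPartialLimit (L := L) a U S x' := fun χ hχ hU =>
  (iff_of_eq (hχ hx)).1 (h χ hχ hU)

lemma isPartialLimit_empty (x : V → M) : IsPartialLimit (L := L) a U ∅ x := by
  intro χ hχ hU
  obtain ⟨y, hy⟩ := hU.exists
  exact (iff_of_eq (hχ fun _ h => h.elim)).1 hy

lemma isPartialLimit_of_finset {S : Set V} {x : V → M}
    (h : ∀ F : Finset V, ↑F ⊆ S → IsPartialLimit (L := L) a U F x) :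
    IsPartialLimit (L := L) a U S x := by
  classical
  intro χ hχ hU
  obtain ⟨F, hF⟩ := realize_congr χ
  let F' : Finset V := (F.preimage Sum.inr Sum.inr_injective.injOn).filter (· ∈ S)
  refine h F' (fun v hv => (Finset.mem_filter.1 hv).2) χ (fun y y' hy => ?_) hU
  let z : V → M := fun v => if v ∈ S then y v else y' v
  have h1 : χ.Realize (Sum.elim a y) = χ.Realize (Sum.elim a z) :=
    hχ fun v hv => (if_pos hv).symm
  have h2 : χ.Realize (Sum.elim a z) ↔ χ.Realize (Sum.elim a y') := by
    refine hF M _ _ ?_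
    rintro (i | i) hi
    · rfl
    · by_cases his : i ∈ S
      · refine (if_pos his).trans (hy i ?_)
        exact Finset.mem_coe.2 (Finset.mem_filter.2 ⟨Finset.mem_preimage.2 hi, his⟩)
      · exact if_neg his
  exact h1.trans (propext h2)

/-- Quantifying the new variable in a finite part of the limit type leaves a formula about the old
variables that holds in the limit, hence holds of `x`. Saturation for one variable then supplies the
new value. -/
lemma IsPartialLimit.exists_insert [Nonempty M] (hM : IsSaturated L M κ) (hκ : Cardinal.aleph0 ≤ κ)
    (hP : Cardinal.mk P < κ) (hV : Cardinal.mk V < κ) {S : Set V} {x : V → M}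
    (h : IsPartialLimit (L := L) a U S x) {v : V} (hv : v ∉ S) :
    ∃ x' : V → M, (∀ u ∈ S, x u = x' u) ∧ IsPartialLimit (L := L) a U (insert v S) x' := by
  classical
  let A : Set M := Set.range a ∪ x '' S
  have hA : Cardinal.mk A < κ :=
    (Cardinal.mk_union_le _ _).trans_lt (Cardinal.add_lt_of_lt hκ
      (Cardinal.mk_range_le.trans_lt hP)
      ((Cardinal.mk_image_le.trans (Cardinal.mk_set_le S)).trans_lt hV))
  let ι : P ⊕ V → A ⊕ Unit := Sum.elim (fun p => .inl ⟨a p, .inl ⟨p, rfl⟩⟩)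
    fun u => if hu : u ∈ S then .inl ⟨x u, .inr ⟨u, hu, rfl⟩⟩ else .inr ()
  let Γ : Set (L.Formula (P ⊕ V)) := {χ |
    DependsOn (fun y : V → M => χ.Realize (Sum.elim a y)) (insert v S) ∧
      ∀ᶠ y in (U : Filter (V → M)), χ.Realize (Sum.elim a y)}
  have hι : ∀ χ ∈ Γ, ∀ m : M, (χ.relabel ι).Realize (Sum.elim (↑) fun _ => m) ↔
      χ.Realize (Sum.elim a (Function.update x v m)) := by
    intro χ hχ m
    rw [Formula.realize_relabel]
    have h1 : (Sum.elim (↑) fun _ => m) ∘ ι =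
        Sum.elim a fun u => if u ∈ S then x u else m := by
      funext i
      rcases i with i | i
      · rfl
      · by_cases hi : i ∈ S <;> simp [ι, hi]
    rw [h1]
    refine iff_of_eq (hχ.1 fun u hu => ?_)
    rcases hu with rfl | hu
    · simp [hv]
    · have : u ≠ v := fun e => hv (e ▸ hu)
      simp [hu, this]
  obtain ⟨m, hm⟩ := hM A hA (Formula.relabel ι '' Γ) (by
    intro Γ₀ hΓ₀
    obtain ⟨t, ht, rfl⟩ := Finset.subset_set_image_iff.1 hΓ₀
    let χ : L.Formula ((P ⊕ V) ⊕ Unit) := (fconj t).relabel (Sum.elim (.inl ∘ .inl)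
      fun u => if u = v then .inr () else .inl (.inr u))
    have hχ : ∀ y : V → M, (fexs χ).Realize (Sum.elim a y) ↔
        ∃ m, ∀ φ ∈ t, φ.Realize (Sum.elim a (Function.update y v m)) := by
      intro y
      rw [realize_fexs]
      have h2 : ∀ z : Unit → M, χ.Realize (Sum.elim (Sum.elim a y) z) ↔
          ∀ φ ∈ t, φ.Realize (Sum.elim a (Function.update y v (z ()))) := by
        intro z
        rw [Formula.realize_relabel, realize_fconj]
        have : Sum.elim (Sum.elim a y) z ∘ Sum.elim (.inl ∘ .inl)
            (fun u => if u = v then .inr () else .inl (.inr u)) =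
            Sum.elim a (Function.update y v (z ())) := by
          funext i
          rcases i with i | i
          · rfl
          · by_cases hi : i = v <;> simp [hi]
        rw [this]
      refine ⟨fun ⟨z, hz⟩ => ⟨z (), (h2 z).1 hz⟩, fun ⟨m, hm⟩ => ⟨fun _ => m, (h2 _).2 hm⟩⟩
    have hx : (fexs χ).Realize (Sum.elim a x) := by
      refine h _ (fun y y' hy => propext ?_) ?_
      · refine (hχ y).trans (Iff.trans ?_ (hχ y').symm)
        refine exists_congr fun m => forall₂_congr fun φ hφ => iff_of_eq ((ht hφ).1 fun u hu => ?_)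
        rcases hu with rfl | hu
        · simp
        · have : u ≠ v := fun e => hv (e ▸ hu)
          simp [this, hy u hu]
      · have : ∀ᶠ y in (U : Filter (V → M)), ∀ φ : t, φ.1.Realize (Sum.elim a y) :=
          Filter.eventually_all.2 fun φ => (ht φ.2).2
        refine this.mono fun y hy => (hχ y).2 ⟨y v, fun φ hφ => ?_⟩
        rw [Function.update_eq_self]
        exact hy ⟨φ, hφ⟩
    obtain ⟨m, hm⟩ := (hχ x).1 hx
    refine ⟨m, fun φ hφ => ?_⟩
    obtain ⟨φ, hφ', rfl⟩ := Finset.mem_image.1 hφ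
    exact (hι φ (ht hφ') m).2 (hm φ hφ'))
  refine ⟨Function.update x v m, fun u hu => ?_, fun χ hχ hU =>
    (hι χ ⟨hχ, hU⟩ m).1 (hm _ ⟨χ, ⟨hχ, hU⟩, rfl⟩)⟩
  have : u ≠ v := fun e => hv (e ▸ hu)
  simp [this]

/-- Zorn's lemma on partial limits extends saturation from one variable to fewer than `κ` variables;
unions of chains are harmless because a formula has finitely many variables. -/
lemma IsSaturated.exists_isPartialLimit [Nonempty M] (hM : IsSaturated L M κ)
    (hκ : Cardinal.aleph0 ≤ κ) (hP : Cardinal.mk P < κ) (hV : Cardinal.mk V < κ) (a : P → M)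
    (U : Ultrafilter (V → M)) : ∃ x : V → M, ∀ χ : L.Formula (P ⊕ V),
      (∀ᶠ y in (U : Filter (V → M)), χ.Realize (Sum.elim a y)) → χ.Realize (Sum.elim a x) := by
  classical
  let Q := {q : Set V × (V → M) // IsPartialLimit (L := L) a U q.1 q.2}
  let R : Q → Q → Prop := fun q q' => q.1.1 ⊆ q'.1.1 ∧ ∀ v ∈ q.1.1, q.1.2 v = q'.1.2 v
  have htrans : ∀ {q q' q'' : Q}, R q q' → R q' q'' → R q q'' := fun h h' =>
    ⟨h.1.trans h'.1, fun v hv => (h.2 v hv).trans (h'.2 v (h.1 hv))⟩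
  have hrefl : ∀ q : Q, R q q := fun q => ⟨subset_rfl, fun _ _ => rfl⟩
  have hub : ∀ c : Set Q, IsChain R c → ∃ ub, ∀ q ∈ c, R q ub := by
    intro c hc
    let x : V → M := fun v => if h : ∃ q ∈ c, v ∈ q.1.1 then h.choose.1.2 v
      else Classical.arbitrary M
    have htot : ∀ q ∈ c, ∀ q' ∈ c, R q q' ∨ R q' q := by
      intro q hq q' hq'
      by_cases e : q = q'
      · exact .inl (e ▸ hrefl q)
      · exact hc hq hq' e
    have hx : ∀ q ∈ c, ∀ v ∈ q.1.1, q.1.2 v = x v := by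
      intro q hq v hv
      have h : ∃ q ∈ c, v ∈ q.1.1 := ⟨q, hq, hv⟩
      simp only [x, dif_pos h]
      rcases htot q hq _ h.choose_spec.1 with h' | h'
      · exact h'.2 v hv
      · exact (h'.2 v h.choose_spec.2).symm
    refine ⟨⟨⟨⋃ q ∈ c, q.1.1, x⟩, isPartialLimit_of_finset fun F hF => ?_⟩, fun q hq =>
      ⟨Set.subset_biUnion_of_mem (u := fun q : Q => q.1.1) hq, hx q hq⟩⟩
    rcases c.eq_empty_or_nonempty with rfl | hne
    · have : (F : Set V) = ∅ := Set.subset_empty_iff.1 (by simpa using hF)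
      simpa only [this] using isPartialLimit_empty x
    · have hdir : DirectedOn (fun q q' : Q => q.1.1 ⊆ q'.1.1) c := by
        intro q hq q' hq'
        rcases htot q hq q' hq' with h | h
        · exact ⟨q', hq', h.1, subset_rfl⟩
        · exact ⟨q, hq, subset_rfl, h.1⟩
      obtain ⟨q, hq, hFq⟩ := DirectedOn.exists_mem_subset_of_finset_subset_biUnion hne hdir hF
      intro χ hχ hU
      exact (q.2.congr (hx q hq)) χ (fun y y' hy => hχ fun v hv => hy v (hFq hv)) hU
  obtain ⟨q, hq⟩ := exists_maximal_of_chains_bounded hub htrans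
  have huniv : ∀ v, v ∈ q.1.1 := by
    intro v
    by_contra hv
    obtain ⟨x', hx', h⟩ := q.2.exists_insert hM hκ hP hV hv
    exact hv ((hq ⟨⟨_, x'⟩, h⟩ ⟨Set.subset_insert _ _, hx'⟩).1 (Set.mem_insert _ _))
  exact ⟨q.1.2, fun χ hU => q.2 χ (fun y y' hy => by
    rw [show y = y' from funext fun v => hy v (huniv v)]) hU⟩

lemma exists_small_elementarySubstructure
    (hκ : Cardinal.lift.{w} (2 ^ max Cardinal.aleph0 L.card) < Cardinal.lift.{max u v} κ) :
    ∃ N : L.ElementarySubstructure M, Cardinal.mk N < κ := by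
  have h1 : Cardinal.lift.{w} (max Cardinal.aleph0 L.card) < Cardinal.lift.{max u v} κ :=
    (Cardinal.lift_le.2 (Cardinal.cantor _).le).trans_lt hκ
  by_cases h : Cardinal.lift.{w} (max Cardinal.aleph0 L.card) ≤
      Cardinal.lift.{max u v} (Cardinal.mk M)
  · obtain ⟨N, -, hN⟩ := exists_elementarySubstructure_card_eq L (∅ : Set M)
      (max Cardinal.aleph0 L.card) (le_max_left _ _) (by simp)
      (Cardinal.lift_le.2 (le_max_right _ _)) h
    refine ⟨N, Cardinal.lift_lt.{_, max u v}.1 ?_⟩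
    rw [hN]
    exact h1
  · refine ⟨⊤, Cardinal.lift_lt.{_, max u v}.1 (lt_of_le_of_lt ?_ ((not_le.1 h).trans h1))⟩
    exact Cardinal.lift_le.2 (Cardinal.mk_set_le _)

lemma aleph0_le_of_lt
    (hκ : Cardinal.lift.{w} (2 ^ max Cardinal.aleph0 L.card) < Cardinal.lift.{max u v} κ) :
    Cardinal.aleph0 ≤ κ := by
  refine Cardinal.lift_le.{max u v}.1 (le_trans ?_ hκ.le)
  rw [Cardinal.lift_aleph0, ← Cardinal.lift_aleph0.{w, max u v}]
  exact Cardinal.lift_le.2 ((le_max_left _ _).trans (Cardinal.cantor _).le)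

end Saturation

/-! ### The action on types, and chains of neighbours. -/

section Action

variable {L : FirstOrder.Language.{u, v}} {M : Type w} [L.Structure M]

lemma realize_aut (σ : modelAut L M) {α : Type*} (φ : L.Formula α) (x : α → M) :
    φ.Realize (σ.1 ∘ x) ↔ φ.Realize x := by
  obtain ⟨e, he⟩ := σ.2
  rw [show σ.1 ∘ x = e ∘ x from funext fun i => (he (x i)).symm]
  exact StrongHomClass.realize_formula e φ

lemma realize_aut_symm (σ : modelAut L M) {α : Type*} (φ : L.Formula α) (x : α → M) :
    φ.Realize (σ.1.symm ∘ x) ↔ φ.Realize x :=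
  realize_aut σ⁻¹ φ x

/-- The action of an automorphism on the type spaces. -/
def actHom (σ : modelAut L M) : Hom (typeSpace (L := L) M) (typeSpace M) where
  toFun _ p := GammaType.act σ p
  map_rel t p hp := by
    rintro ⟨b, hb, hb'⟩
    exact hp ⟨σ.1.symm ∘ b, (realize_aut_symm σ t.α b).2 hb, hb'⟩

lemma actHom_mul (σ τ : modelAut L M) (s : PatSort L) (p : GammaType M s) :
    (actHom (σ * τ)).toFun s p = (actHom σ).toFun s ((actHom τ).toFun s p) := rfl

lemma actHom_one (s : PatSort L) (p : GammaType M s) : (actHom 1).toFun s p = p := rfl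

lemma actHom_inv_actHom (σ : modelAut L M) (s : PatSort L) (p : GammaType M s) :
    (actHom σ⁻¹).toFun s ((actHom σ).toFun s p) = p := by
  rw [← actHom_mul, inv_mul_cancel, actHom_one]

end Action

section Chains

variable {L : FirstOrder.Language.{u, v}}

/-- Elements connected by a chain of (approximate) Lascar neighbours of length `i`. -/
def LNChain (A : Str.{max u v, max u v, c} (patLang L)) {s : PatSort L} {k : ℕ}
    (D : L.Formula (Fin k)) (Δ : Finset (L.Formula (Fin s.n ⊕ Fin k))) :
    ℕ → A.carrier s → A.carrier s → Prop
  | 0, p, p' => p = p'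
  | i + 1, p, p' => ∃ p'', LNat A D Δ p p'' ∧ LNChain A D Δ i p'' p'

variable {A B : Str.{max u v, max u v, c} (patLang L)} {s : PatSort L} {k : ℕ}
  {D : L.Formula (Fin k)} {Δ : Finset (L.Formula (Fin s.n ⊕ Fin k))} {i i' : ℕ}
  {p p' p'' : A.carrier s}

lemma LNat.chain (h : LNat A D Δ p p') : LNChain A D Δ 1 p p' := ⟨p', h, rfl⟩

lemma LNChain.trans (h : LNChain A D Δ i p p') (h' : LNChain A D Δ i' p' p'') :
    LNChain A D Δ (i' + i) p p'' := by
  induction i generalizing p with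
  | zero =>
    obtain rfl : p = p' := h
    exact h'
  | succ i ih =>
    obtain ⟨q, hq, h⟩ := h
    exact ⟨q, hq, ih h⟩

lemma LNChain.hom (f : Hom A B) (h : LNChain A D Δ i p p') :
    LNChain B D Δ i (f.toFun s p) (f.toFun s p') := by
  induction i generalizing p with
  | zero => exact congrArg (f.toFun s) h
  | succ i ih =>
    obtain ⟨q, hq, h⟩ := h
    exact ⟨_, hq.hom f, ih h⟩

lemma LNChain.symm_typeSpace {M : Type w} [L.Structure M] [Nonempty M] {p p' : GammaType M s}
    (h : LNChain (typeSpace M) D Δ i p p') : LNChain (typeSpace M) D Δ i p' p := by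
  induction i generalizing p with
  | zero => exact Eq.symm h
  | succ i ih =>
    obtain ⟨q, hq, h⟩ := h
    have h1 := (ih h).trans hq.symm_typeSpace.chain
    rwa [add_comm] at h1

end Chains

/-! ### From automorphisms of the core to automorphisms of the model. -/

section Realization

variable {L : FirstOrder.Language.{u, v}} {M : Type w} [L.Structure M] [Nonempty M]
  {J : Str.{max u v, max u v, max u v w} (patLang L)} {j : Hom J (typeSpace M)}
  {r : Hom (typeSpace M) J}

/-- Parameter tuples are indexed by `ℕ`; this codes a finite part of a large family by natural
numbers. -/
lemma exists_code {X Y : Type*} [Nonempty Y] (F : Finset X) (f : X → Y) :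
    ∃ (c : X → ℕ) (b : ℕ → Y), ∀ x ∈ F, b (c x) = f x := by
  classical
  refine ⟨fun x => if h : x ∈ F then F.equivFin ⟨x, h⟩ else 0,
    fun l => if h : l < F.card then f (F.equivFin.symm ⟨l, h⟩) else Classical.arbitrary Y,
    fun x hx => ?_⟩
  simp [hx]

/-- A finite set of conditions is a pattern present in the types $j(gx)$, with witness `f`. If it
were absent from the types $jx$, the corresponding $\mathcal R_t$ would pass through $r$, $g$ and
$j$ to $j(gx)$, a contradiction. -/
lemma exists_ultrafilter_of_aut (hr : ∀ s x, r.toFun s (j.toFun s x) = x) (g : Aut J)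
    {N : Type w} (f : N → M) :
    ∃ U : Ultrafilter (N → M),
      (∀ ψ : L.Formula N, ψ.Realize f → ∀ᶠ τ in (U : Filter (N → M)), ψ.Realize τ) ∧
      ∀ (s : PatSort L) (x : J.carrier s) (φ : s.γ) (b : ℕ → N),
        f ∘ b ∈ (j.toFun s (g.app s x) : GammaType M s).1 φ ↔
          ∀ᶠ τ in (U : Filter (N → M)), τ ∘ b ∈ (j.toFun s x : GammaType M s).1 φ := by
  classical
  let I₁ := {ψ : L.Formula N // ψ.Realize f}
  let I₂ := Σ s : PatSort L, J.carrier s × s.γ × (ℕ → N)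
  let G : I₂ → Prop := fun i =>
    f ∘ i.2.2.2 ∈ (j.toFun i.1 (g.app i.1 i.2.1) : GammaType M i.1).1 i.2.2.1
  let H : I₂ → (N → M) → Prop := fun i τ =>
    τ ∘ i.2.2.2 ∈ (j.toFun i.1 i.2.1 : GammaType M i.1).1 i.2.2.1
  let S : I₁ ⊕ I₂ → Set (N → M) := Sum.elim (fun ψ => {τ | ψ.1.Realize τ})
    fun i => {τ | H i τ ↔ G i}
  obtain ⟨U, hU⟩ := exists_ultrafilter_mem S (by
    intro t
    choose F₁ hF₁ using fun ψ : I₁ => realize_congr ψ.1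
    choose F₂ hF₂ using fun i : I₂ => GammaType.mem_congr i.2.2.1
    let F : Finset N := t.toLeft.biUnion F₁ ∪ t.toRight.biUnion fun i => (F₂ i).image i.2.2.2
    obtain ⟨c, b, hb⟩ := exists_code F f
    let e := t.toRight.equivFin
    let x : Fin t.toRight.card → I₂ := fun l => (e.symm l).1
    let R : PatRel L := ⟨t.toRight.card,
      fun l => ⟨(x l).1, (x l).2.2.1, decide (G (x l)), c ∘ (x l).2.2.2⟩,
      (fconj (t.toLeft.image Subtype.val)).relabel c⟩
    have h1 : (typeSpace M).rel R (fun l => j.toFun (x l).1 (x l).2.1) →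
        (typeSpace M).rel R (fun l => j.toFun (x l).1 (g.app (x l).1 (x l).2.1)) := by
      intro h
      have h2 : J.rel R (fun l => (x l).2.1) := by
        have := r.map_rel R _ h
        exact Eq.mp (congrArg (J.rel R) (funext fun l => hr _ _)) this
      exact j.map_rel R _ ((g.2 R _).2 h2)
    have h3 : ¬ (typeSpace M).rel R (fun l => j.toFun (x l).1 (g.app (x l).1 (x l).2.1)) := by
      refine not_not_intro ⟨b, ?_, fun l => ?_⟩
      · refine Formula.realize_relabel.2 ((realize_fconj _ _).2 fun ψ hψ => ?_)
        obtain ⟨ψ, hψ', rfl⟩ := Finset.mem_image.1 hψ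
        refine (hF₁ ψ M _ _ fun n hn => hb n ?_).2 ψ.2
        exact Finset.mem_union_left _ (Finset.mem_biUnion.2 ⟨ψ, hψ', hn⟩)
      · have h4 : b ∘ (c ∘ (x l).2.2.2) ∈
            (j.toFun (x l).1 (g.app (x l).1 (x l).2.1) : GammaType M (x l).1).1 (x l).2.2.1 ↔
            G (x l) := by
          refine hF₂ (x l) M _ _ _ fun n hn => hb _ ?_
          exact Finset.mem_union_right _ (Finset.mem_biUnion.2
            ⟨x l, (e.symm l).2, Finset.mem_image_of_mem _ hn⟩)
        exact h4.trans decide_eq_true_iff.symm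
    obtain ⟨b', hb', hb''⟩ := not_not.1 (mt h1 h3)
    refine ⟨b' ∘ c, fun i hi => ?_⟩
    rcases i with ψ | i
    · exact (realize_fconj _ _).1 (Formula.realize_relabel.1 hb') _
        (Finset.mem_image_of_mem _ (Finset.mem_toLeft.2 hi))
    · have h5 := hb'' (e ⟨i, Finset.mem_toRight.2 hi⟩)
      have h6 : ∀ l, GammaType.Mem (R.φ l) b' (j.toFun (x l).1 (x l).2.1) →
          (H (x l) (b' ∘ c) ↔ G (x l)) := fun l h => Iff.trans h decide_eq_true_iff
      have h7 : x (e ⟨i, Finset.mem_toRight.2 hi⟩) = i :=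
        congrArg Subtype.val (e.symm_apply_apply _)
      have h8 := h6 _ h5
      rw [h7] at h8
      exact h8)
  refine ⟨U, fun ψ hψ => hU (.inl ⟨ψ, hψ⟩), fun s x φ b => ?_⟩
  have h : ∀ᶠ τ in (U : Filter (N → M)),
      (H ⟨s, x, φ, b⟩ τ ↔ G ⟨s, x, φ, b⟩) := hU (.inr ⟨s, x, φ, b⟩)
  refine ⟨fun h1 => h.mono fun τ hτ => hτ.2 h1, fun h1 => ?_⟩
  obtain ⟨τ, h2, h3⟩ := (h.and h1).exists
  exact h2.1 h3

/-- If `τ'` realizes the limit type of `τ` over `f`, each finite part of the diagram of `M` over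
`(f, τ')` is solvable over `(f, τ)` for almost all `τ`. The resulting maps of `M` are elementary in
the limit, fix `f` and send `τ'` to `τ`. -/
lemma exists_ultrafilter_over {N : Type w} {f τ' : N → M} {U : Ultrafilter (N → M)}
    (h : ∀ χ : L.Formula (N ⊕ N), (∀ᶠ τ in (U : Filter (N → M)), χ.Realize (Sum.elim f τ)) →
      χ.Realize (Sum.elim f τ')) :
    ∃ W : Ultrafilter ((M → M) × (N → M)), W.map Prod.snd = U ∧
      ∀ χ : L.Formula ((N ⊕ N) ⊕ M), χ.Realize (Sum.elim (Sum.elim f τ') id) →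
        ∀ᶠ i in (W : Filter ((M → M) × (N → M))), χ.Realize (Sum.elim (Sum.elim f i.2) i.1) := by
  classical
  let I₁ := {χ : L.Formula ((N ⊕ N) ⊕ M) // χ.Realize (Sum.elim (Sum.elim f τ') id)}
  obtain ⟨W, hW⟩ := exists_ultrafilter_mem
    (fun i : I₁ × {X : Set (N → M) // X ∈ U} => {w : (M → M) × (N → M) |
      i.1.1.Realize (Sum.elim (Sum.elim f w.2) w.1) ∧ w.2 ∈ i.2.1}) (by
    intro t
    let χ : L.Formula ((N ⊕ N) ⊕ M) := fconj (t.image fun i => i.1.1)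
    have h1 : (fexs χ).Realize (Sum.elim f τ') := by
      refine (realize_fexs χ _).2 ⟨id, (realize_fconj _ _).2 fun ψ hψ => ?_⟩
      obtain ⟨i, -, rfl⟩ := Finset.mem_image.1 hψ
      exact i.1.2
    have h2 : ∀ᶠ τ in (U : Filter (N → M)), (fexs χ).Realize (Sum.elim f τ) := by
      by_contra h3
      exact h _ ((Ultrafilter.eventually_not.2 h3).mono fun τ hτ => Formula.realize_not.2 hτ) h1
    have h4 : ∀ᶠ τ in (U : Filter (N → M)), ∀ i : t, τ ∈ i.1.2.1 :=
      Filter.eventually_all.2 fun i => i.1.2.2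
    obtain ⟨τ, h5, h6⟩ := (h2.and h4).exists
    obtain ⟨w, hw⟩ := (realize_fexs χ _).1 h5
    exact ⟨(w, τ), fun i hi => ⟨(realize_fconj _ _).1 hw _ (Finset.mem_image_of_mem _ hi),
      h6 ⟨i, hi⟩⟩⟩)
  refine ⟨W, ?_, fun χ hχ => Filter.mem_of_superset (hW (⟨χ, hχ⟩, ⟨Set.univ, Filter.univ_mem⟩))
    fun w hw => hw.1⟩
  refine Ultrafilter.coe_le_coe.1 fun X hX => ?_
  have h1 := hW (⟨⊤, Formula.realize_top.2 trivial⟩, ⟨X, hX⟩)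
  exact Filter.mem_map.2 (Filter.mem_of_superset h1 fun w hw => hw.2)

variable {κ : Cardinal.{w}}

/-- Each automorphism of the core agrees, on the types over a small elementary submodel and up to an
endomorphism of the type spaces over the submodel, with an automorphism of the model. -/
lemma exists_aut_of_aut (hM : IsSaturated L M κ) (hM' : IsHomogeneous L M κ)
    (hκ : Cardinal.aleph0 ≤ κ) (hr : ∀ s x, r.toFun s (j.toFun s x) = x) (g : Aut J)
    (N : L.ElementarySubstructure M) (hN : Cardinal.mk N < κ) :
    ∃ (σ : modelAut L M) (v : Hom (typeSpace (L := L) M) (typeSpace M)),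
      (∀ (s : PatSort L) (p : GammaType M s), (restrictHom N.subtype).toFun s (v.toFun s p) =
        (restrictHom N.subtype).toFun s p) ∧
      ∀ (s : PatSort L) (x : J.carrier s), (restrictHom N.subtype).toFun s (j.toFun s (g.app s x)) =
        (restrictHom N.subtype).toFun s ((actHom σ).toFun s (v.toFun s (j.toFun s x))) := by
  obtain ⟨U, hU, hU'⟩ := exists_ultrafilter_of_aut hr g (N.subtype : N → M)
  obtain ⟨τ', hτ'⟩ := hM.exists_isPartialLimit hκ hN hN (N.subtype : N → M) U
  obtain ⟨W, hWU, hW⟩ := exists_ultrafilter_over hτ'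
  have hW₁ : ∀ n : N, ∀ᶠ i in (W : Filter ((M → M) × (N → M))),
      i.1 (N.subtype n) = N.subtype n := by
    intro n
    have := hW ((Term.var (.inr (N.subtype n))).equal (Term.var (.inl (.inl n)))) (by simp)
    simpa using this
  have hW₂ : ∀ n : N, ∀ᶠ i in (W : Filter ((M → M) × (N → M))), i.1 (τ' n) = i.2 n := by
    intro n
    have := hW ((Term.var (.inr (τ' n))).equal (Term.var (.inl (.inr n)))) (by simp)
    simpa using this
  have happ : IsApprox L W (Prod.fst : (M → M) × (N → M) → M → M) := by
    intro ψ hψ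
    have := hW (ψ.relabel .inr) (by simpa [Formula.realize_relabel] using hψ)
    simpa [Formula.realize_relabel] using this
  have hτ : ∀ ψ : L.Formula N, ψ.Realize N.subtype ↔ ψ.Realize τ' := by
    have h1 : ∀ ψ : L.Formula N, ψ.Realize N.subtype → ψ.Realize τ' := by
      intro ψ hψ
      have := hτ' (ψ.relabel .inr) (by simpa [Formula.realize_relabel] using hU ψ hψ)
      simpa [Formula.realize_relabel] using this
    refine fun ψ => ⟨h1 ψ, fun h2 => ?_⟩
    by_contra h3
    exact Formula.realize_not.1 (h1 ψ.not (Formula.realize_not.2 h3)) h2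
  -- This automorphism maps `N` to its copy `τ'`. Since types are moved by the inverse on
  -- parameters, the automorphism that answers the claim is its inverse.
  obtain ⟨σ, hσ⟩ := hM'.exists_aut hN _ _ hτ
  refine ⟨σ⁻¹, happ.hom, fun s p => ?_, fun s x => ?_⟩
  · refine GammaType.ext fun φ b => ?_
    obtain ⟨F, hF⟩ := GammaType.mem_congr φ
    have h1 : ∀ᶠ i in (W : Filter ((M → M) × (N → M))), ∀ l : F,
        i.1 (N.subtype (b l)) = N.subtype (b l) := Filter.eventually_all.2 fun l => hW₁ _
    have h2 : ∀ᶠ i in (W : Filter ((M → M) × (N → M))), (i.1 ∘ N.subtype ∘ b ∈ p.1 φ ↔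
        N.subtype ∘ b ∈ p.1 φ) := h1.mono fun i hi => hF M _ _ _ fun l hl => hi ⟨l, hl⟩
    exact (Filter.eventually_congr h2).trans Filter.eventually_const
  · refine GammaType.ext fun φ b => ?_
    refine (hU' s x φ b).trans (Iff.trans ?_
      (happ.mem_hom (j.toFun s x) φ (σ.1 ∘ N.subtype ∘ b)).symm)
    rw [← hWU]
    change (∀ᶠ i in (W : Filter ((M → M) × (N → M))),
      i.2 ∘ b ∈ (j.toFun s x : GammaType M s).1 φ) ↔ _
    refine Filter.eventually_congr ?_
    obtain ⟨F, hF⟩ := GammaType.mem_congr φ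
    have h1 : ∀ᶠ i in (W : Filter ((M → M) × (N → M))), ∀ l : F,
        i.1 (τ' (b l)) = i.2 (b l) := Filter.eventually_all.2 fun l => hW₂ _
    refine h1.mono fun i hi => hF M _ _ _ fun l hl => ?_
    have h2 := hi ⟨l, hl⟩
    rw [← hσ] at h2
    exact h2.symm

end Realization

/-! ### From chains of small families of elements to strong automorphisms. -/

section FunctionChains

variable {L : FirstOrder.Language.{u, v}} {M : Type w} [L.Structure M] {N : Type w}

/-- Families of elements of a model connected by a chain of length `i`, in which consecutive
families have the same `t`-type over a realization of `d`, up to equality at the arguments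
in `F`. -/
def FunChain (d : Finset (L.Formula N)) (t : Finset (L.Formula (N ⊕ N))) (F : Finset N) :
    ℕ → (N → M) → (N → M) → Prop
  | 0, x, y => ∀ n ∈ F, x n = y n
  | i + 1, x, y => ∃ x' z : N → M, (∀ ψ ∈ d, ψ.Realize z) ∧
      (∀ χ ∈ t, χ.Realize (Sum.elim x z) ↔ χ.Realize (Sum.elim x' z)) ∧ FunChain d t F i x' y

lemma FunChain.mono {d d' : Finset (L.Formula N)} {t t' : Finset (L.Formula (N ⊕ N))}
    {F F' : Finset N} (hd : d ⊆ d') (ht : t ⊆ t') (hF : F ⊆ F') {i : ℕ} {x y : N → M}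
    (h : FunChain d' t' F' i x y) : FunChain d t F i x y := by
  induction i generalizing x with
  | zero => exact fun n hn => h n (hF hn)
  | succ i ih =>
    obtain ⟨x', z, h1, h2, h3⟩ := h
    exact ⟨x', z, fun ψ hψ => h1 ψ (hd hψ), fun χ hχ => h2 χ (ht hχ), ih h3⟩

variable (M) in
lemma exists_formula_step (d : Finset (L.Formula N)) (t : Finset (L.Formula (N ⊕ N)))
    (χ : L.Formula (N ⊕ N)) : ∃ Θ : L.Formula ((N ⊕ N) ⊕ (N ⊕ N)), ∀ x y x' z : N → M,
      Θ.Realize (Sum.elim (Sum.elim x y) (Sum.elim x' z)) ↔ (∀ ψ ∈ d, ψ.Realize z) ∧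
        (∀ χ ∈ t, χ.Realize (Sum.elim x z) ↔ χ.Realize (Sum.elim x' z)) ∧
        χ.Realize (Sum.elim x' y) := by
  refine ⟨(fconj d).relabel (.inr ∘ .inr) ⊓ ((Formula.iInf fun φ : t =>
    (φ.1.relabel (Sum.elim (.inl ∘ .inl) (.inr ∘ .inr))).iff
      (φ.1.relabel (Sum.elim (.inr ∘ .inl) (.inr ∘ .inr)))) ⊓
    χ.relabel (Sum.elim (.inr ∘ .inl) (.inl ∘ .inr))), fun x y x' z => ?_⟩
  have h1 : Sum.elim (Sum.elim x y) (Sum.elim x' z) ∘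
      (Sum.elim (.inl ∘ .inl) (.inr ∘ .inr) : N ⊕ N → _) = Sum.elim x z := by
    funext i
    cases i <;> rfl
  have h2 : Sum.elim (Sum.elim x y) (Sum.elim x' z) ∘
      (Sum.elim (.inr ∘ .inl) (.inr ∘ .inr) : N ⊕ N → _) = Sum.elim x' z := by
    funext i
    cases i <;> rfl
  have h3 : Sum.elim (Sum.elim x y) (Sum.elim x' z) ∘
      (Sum.elim (.inr ∘ .inl) (.inl ∘ .inr) : N ⊕ N → _) = Sum.elim x' y := by
    funext i
    cases i <;> rfl
  rw [Formula.realize_inf, Formula.realize_inf, Formula.realize_relabel, realize_fconj,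
    Formula.realize_iInf, Formula.realize_relabel, h3]
  refine and_congr Iff.rfl (and_congr ?_ Iff.rfl)
  rw [Subtype.forall]
  refine forall₂_congr fun φ _ => ?_
  rw [Formula.realize_iff, Formula.realize_relabel, Formula.realize_relabel, h1, h2]

variable [Nonempty M]

variable (M) in
lemma exists_formula_funChain (d : Finset (L.Formula N)) (t : Finset (L.Formula (N ⊕ N)))
    (F : Finset N) (i : ℕ) : ∃ χ : L.Formula (N ⊕ N), ∀ x y : N → M,
      χ.Realize (Sum.elim x y) ↔ FunChain d t F i x y := by
  induction i with
  | zero =>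
    refine ⟨Formula.iInf fun n : F => (Term.var (.inl n.1)).equal (Term.var (.inr n.1)),
      fun x y => ?_⟩
    rw [Formula.realize_iInf, Subtype.forall]
    exact forall₂_congr fun n _ => by simp
  | succ i ih =>
    obtain ⟨χ, hχ⟩ := ih
    obtain ⟨Θ, hΘ⟩ := exists_formula_step M d t χ
    refine ⟨fexs Θ, fun x y => (realize_fexs Θ _).trans ⟨?_, ?_⟩⟩
    · rintro ⟨w, hw⟩
      rw [← Sum.elim_comp_inl_inr w, hΘ, hχ] at hw
      exact ⟨_, _, hw⟩
    · rintro ⟨x', z, h1, h2, h3⟩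
      exact ⟨Sum.elim x' z, (hΘ x y x' z).2 ⟨h1, h2, (hχ _ _).2 h3⟩⟩

variable {κ : Cardinal.{w}} {f x y : N → M} {i : ℕ}

/-- All approximations to the first step, each with the formula saying that the rest of the chain
exists, are realized simultaneously by saturation. Finite sets of conditions combine because chains
are monotone in them. -/
lemma exists_step_of_funChain (hM : IsSaturated L M κ) (hκ : Cardinal.aleph0 ≤ κ)
    (hN : Cardinal.mk (N ⊕ N) < κ)
    (h : ∀ (d : Finset (L.Formula N)) (t : Finset (L.Formula (N ⊕ N))) (F : Finset N),
      (∀ ψ ∈ d, ψ.Realize f) → FunChain d t F (i + 1) x y) :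
    ∃ x' z : N → M, (∀ ψ : L.Formula N, ψ.Realize f ↔ ψ.Realize z) ∧
      (∀ χ : L.Formula (N ⊕ N), χ.Realize (Sum.elim x z) ↔ χ.Realize (Sum.elim x' z)) ∧
      ∀ (d : Finset (L.Formula N)) (t : Finset (L.Formula (N ⊕ N))) (F : Finset N),
        (∀ ψ ∈ d, ψ.Realize f) → FunChain d t F i x' y := by
  classical
  let I := {d : Finset (L.Formula N) // ∀ ψ ∈ d, ψ.Realize f} × Finset (L.Formula (N ⊕ N)) ×
    Finset N
  choose χ hχ using fun e : I => exists_formula_funChain M e.1.1 e.2.1 e.2.2 i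
  choose Θ hΘ using fun e : I => exists_formula_step M e.1.1 e.2.1 (χ e)
  obtain ⟨U, hU⟩ := exists_ultrafilter_mem
    (fun e : I => {w : N ⊕ N → M | (Θ e).Realize (Sum.elim (Sum.elim x y) w)}) (by
    intro s
    obtain ⟨x', z, h1, h2, h3⟩ := h (s.biUnion fun e => e.1.1) (s.biUnion fun e => e.2.1)
      (s.biUnion fun e => e.2.2) (by
        intro ψ hψ
        obtain ⟨e, -, he⟩ := Finset.mem_biUnion.1 hψ
        exact e.1.2 ψ he)
    refine ⟨Sum.elim x' z, fun e he => (hΘ e x y x' z).2 ⟨fun ψ hψ => ?_, fun ψ hψ => ?_, ?_⟩⟩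
    · exact h1 ψ (Finset.mem_biUnion.2 ⟨e, he, hψ⟩)
    · exact h2 ψ (Finset.mem_biUnion.2 ⟨e, he, hψ⟩)
    · exact (hχ e x' y).2 (h3.mono (Finset.subset_biUnion_of_mem (fun e : I => e.1.1) he)
        (Finset.subset_biUnion_of_mem (fun e : I => e.2.1) he)
        (Finset.subset_biUnion_of_mem (fun e : I => e.2.2) he)))
  obtain ⟨w, hw⟩ := hM.exists_isPartialLimit hκ hN hN (Sum.elim x y) U
  obtain ⟨x', z, rfl⟩ : ∃ x' z : N → M, w = Sum.elim x' z :=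
    ⟨_, _, (Sum.elim_comp_inl_inr w).symm⟩
  have key : ∀ (d : Finset (L.Formula N)) (t : Finset (L.Formula (N ⊕ N))) (F : Finset N),
      (∀ ψ ∈ d, ψ.Realize f) → (∀ ψ ∈ d, ψ.Realize z) ∧
        (∀ χ ∈ t, χ.Realize (Sum.elim x z) ↔ χ.Realize (Sum.elim x' z)) ∧
        FunChain d t F i x' y := by
    intro d t F hd
    obtain ⟨h1, h2, h3⟩ := (hΘ (⟨d, hd⟩, t, F) x y x' z).1 (hw _ (hU (⟨d, hd⟩, t, F)))
    exact ⟨h1, h2, (hχ _ x' y).1 h3⟩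
  have hz : ∀ ψ : L.Formula N, ψ.Realize f → ψ.Realize z := fun ψ hψ =>
    (key {ψ} ∅ ∅ (by simpa using hψ)).1 ψ (Finset.mem_singleton_self ψ)
  refine ⟨x', z, fun ψ => ⟨hz ψ, fun h2 => ?_⟩, fun χ => ?_, fun d t F hd => (key d t F hd).2.2⟩
  · by_contra h3
    exact Formula.realize_not.1 (hz ψ.not (Formula.realize_not.2 h3)) h2
  · exact (key ∅ {χ} ∅ (by simp)).2.1 χ (Finset.mem_singleton_self χ)

/-- In each step `z` has the type of `N`, so it enumerates an automorphic copy of an elementary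
submodel. The automorphism moving `x` to `x'` over `z` is thus conjugate to one fixing `N`; the
product of the steps is strong. -/
lemma exists_strongAut_of_funChain (hM : IsSaturated L M κ) (hM' : IsHomogeneous L M κ)
    (hκ : Cardinal.aleph0 ≤ κ) {N : L.ElementarySubstructure M} (hN : Cardinal.mk N < κ)
    {x y : N → M} (h : ∀ (d : Finset (L.Formula N)) (t : Finset (L.Formula (N ⊕ N)))
      (F : Finset N), (∀ ψ ∈ d, ψ.Realize ((↑) : N → M)) → FunChain d t F i x y) :
    ∃ ρ ∈ strongAut L M, ∀ n, ρ.1 (x n) = y n := by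
  have hNN : Cardinal.mk (N ⊕ N) < κ := by
    rw [Cardinal.mk_sum, Cardinal.lift_id]
    exact Cardinal.add_lt_of_lt hκ hN hN
  induction i generalizing x with
  | zero => exact ⟨1, one_mem _, fun n => h ∅ ∅ {n} (by simp) n (Finset.mem_singleton_self n)⟩
  | succ i ih =>
    obtain ⟨x', z, hz, hx', h'⟩ := exists_step_of_funChain hM hκ hNN h
    obtain ⟨τ, hτ⟩ := hM'.exists_aut hN _ _ hz
    obtain ⟨ρ, hρ⟩ := hM'.exists_aut hNN _ _ hx'
    obtain ⟨ρ', hρ', hρy⟩ := ih h'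
    have h1 : τ⁻¹ * ρ * τ ∈ strongAut L M := by
      refine Subgroup.subset_closure ⟨N, fun n hn => ?_⟩
      change τ.1.symm (ρ.1 (τ.1 n)) = n
      have h2 : τ.1 n = z ⟨n, hn⟩ := hτ ⟨n, hn⟩
      have h3 : ρ.1 (z ⟨n, hn⟩) = z ⟨n, hn⟩ := hρ (.inr ⟨n, hn⟩)
      rw [h2, h3, ← h2, Equiv.symm_apply_apply]
    have h4 : ρ ∈ strongAut L M := by
      have := (strongAut_normal L M).conj_mem _ h1 τ
      rwa [show τ * (τ⁻¹ * ρ * τ) * τ⁻¹ = ρ by group] at this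
    refine ⟨ρ' * ρ, mul_mem hρ' h4, fun n => ?_⟩
    change ρ'.1 (ρ.1 (x n)) = y n
    rw [show ρ.1 (x n) = x' n from hρ (.inl n), hρy]

end FunctionChains

/-! ### From chains of types to chains of families of elements. -/

section TypeChains

variable {L : FirstOrder.Language.{u, v}} {M : Type w} [L.Structure M] [Nonempty M]

lemma exists_enumeration {X : Type*} [Nonempty X] (G : Finset X) :
    ∃ (n : ℕ) (c : X → Fin n) (m : Fin n → X), ∀ x ∈ G, m (c x) = x := by
  classical
  let G' := insert (Classical.arbitrary X) G
  refine ⟨G'.card, fun x => G'.equivFin (if h : x ∈ G' then ⟨x, h⟩ else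
    ⟨_, Finset.mem_insert_self _ _⟩), fun i => (G'.equivFin.symm i).1, fun x hx => ?_⟩
  simp [show x ∈ G' from Finset.mem_insert_of_mem hx]

/-- A chain of types from `p` to `σ p`, for all `p`, gives a chain of families of elements. -/
lemma funChain_of_lnChain {N : Type w} [Nonempty N] (f : N → M) (σ : modelAut L M) (i : ℕ)
    (h : ∀ (s : PatSort L) (k : ℕ) (D : L.Formula (Fin k))
      (Δ : Finset (L.Formula (Fin s.n ⊕ Fin k))), (∃ z : Fin k → M, D.Realize z) →
      ∀ p : GammaType M s, LNChain (typeSpace M) D Δ i p ((actHom σ).toFun s p))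
    (d : Finset (L.Formula N)) (t : Finset (L.Formula (N ⊕ N))) (F : Finset N)
    (hd : ∀ ψ ∈ d, ψ.Realize f) : FunChain d t F i f (σ.1 ∘ f) := by
  classical
  choose χ hχ using exists_formula_funChain M d t F
  obtain ⟨Fχ, hFχ⟩ := realize_congr (χ i)
  choose Fd hFd using fun ψ : L.Formula N => realize_congr ψ
  -- Only the elements of `N` occurring in `χ i` or in `d` matter; they are coded by finitely many
  -- variables, so that the situation fits into one sort.
  obtain ⟨n, c, m, hm⟩ := exists_enumeration
    (Fχ.image (Sum.elim id id) ∪ d.biUnion Fd)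
  let m₀ : Fin n → M := f ∘ m
  let b₀ : ℕ → M := fun l => if h : l < n then m₀ ⟨l, h⟩ else Classical.arbitrary M
  have hb₀ : ∀ ν, b₀ (c ν) = m₀ (c ν) := fun ν => by simp [b₀]
  -- `Ψ l` says that a chain of length `l` leads from `x` to the parameters. A step between
  -- neighbouring types turns `Ψ l` in the second into `Ψ (l + 1)` in the first.
  let Ψ : ℕ → L.Formula (Fin n ⊕ ℕ) := fun l => (χ l).relabel (Sum.map c fun ν => (c ν : ℕ))
  have hΨ : ∀ (l : ℕ) (e : Fin n → M) (b : ℕ → M), (Ψ l).Realize (Sum.elim e b) ↔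
      FunChain d t F l (e ∘ c) fun ν => b (c ν) := by
    intro l e b
    rw [Formula.realize_relabel, ← hχ]
    refine iff_of_eq (congrArg _ ?_)
    funext ν
    cases ν <;> rfl
  let s : PatSort L := ⟨n, (Finset.range (i + 1)).image Ψ⟩
  have hs : ∀ l, l ≤ i → Ψ l ∈ s.γ := fun l hl =>
    Finset.mem_image_of_mem _ (Finset.mem_range.2 (Nat.lt_succ_of_le hl))
  let D : L.Formula (Fin n) := (fconj d).relabel c
  let Δ : Finset (L.Formula (Fin s.n ⊕ Fin n)) := t.image (Formula.relabel (Sum.map c c))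
  have hD : ∃ z : Fin n → M, D.Realize z := by
    refine ⟨m₀, Formula.realize_relabel.2 ((realize_fconj _ _).2 fun ψ hψ => ?_)⟩
    refine (hFd ψ M _ _ fun ν hν => congrArg f (hm ν ?_)).2 (hd ψ hψ)
    exact Finset.mem_union_right _ (Finset.mem_biUnion.2 ⟨ψ, hψ, hν⟩)
  have hstep : ∀ e e' : Fin n → M, SameType D Δ e e' → ∃ z : N → M, (∀ ψ ∈ d, ψ.Realize z) ∧
      ∀ χ ∈ t, χ.Realize (Sum.elim (e ∘ c) z) ↔ χ.Realize (Sum.elim (e' ∘ c) z) := by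
    rintro e e' ⟨z, hz, h⟩
    refine ⟨z ∘ c, (realize_fconj _ _).1 (Formula.realize_relabel.1 hz), fun φ hφ => ?_⟩
    have h1 := h _ (Finset.mem_image_of_mem _ hφ)
    rwa [Formula.realize_relabel, Formula.realize_relabel, Sum.elim_comp_map,
      Sum.elim_comp_map] at h1
  have key : ∀ (l : ℕ) (hl : l ≤ i) (p p' : GammaType M s) (b : ℕ → M),
      LNChain (typeSpace M) D Δ l p p' → b ∈ p'.1 ⟨Ψ 0, hs 0 (Nat.zero_le i)⟩ →
      b ∈ p.1 ⟨Ψ l, hs l hl⟩ := by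
    intro l
    induction l with
    | zero =>
      rintro - p p' b hpp hb
      obtain rfl : p = p' := hpp
      exact hb
    | succ l ih =>
      rintro hl p p' b ⟨q, hpq, hqp⟩ hb
      have h1 := ih (Nat.le_of_succ_le hl) q p' b hqp hb
      obtain ⟨W, hW1, hW2, hW⟩ := hpq.exists_ultrafilter
      refine (hW1 _ b).2 ?_
      filter_upwards [(hW2 _ b).1 h1, hW] with e he he'
      obtain ⟨z, hz, hz'⟩ := hstep _ _ he'
      exact (hΨ _ _ b).2 ⟨_, z, hz, hz', (hΨ _ _ b).1 he⟩
  -- For the type of the tuple itself, $\sigma p$ contains `Ψ 0` with parameters $\sigma b_0$.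
  -- Following the chain back, `p` contains `Ψ i` with these parameters, a statement about actual
  -- elements.
  obtain ⟨p, hp⟩ := exists_gammaType (M := M) s (pure () : Ultrafilter Unit) fun _ => m₀
  have hp' : ∀ l hl b, b ∈ p.1 ⟨Ψ l, hs l hl⟩ ↔ FunChain d t F l (m₀ ∘ c) fun ν => b (c ν) := by
    intro l hl b
    rw [← hΨ]
    exact (hp _ b).trans Filter.eventually_pure
  have h1 := key i le_rfl p _ (σ.1 ∘ b₀) (h s n D Δ hD p) (by
    have h2 : b₀ ∈ p.1 ⟨Ψ 0, hs 0 (Nat.zero_le i)⟩ := by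
      rw [hp' 0 (Nat.zero_le i)]
      exact fun ν _ => (hb₀ ν).symm
    have h3 : σ.1.symm ∘ σ.1 ∘ b₀ = b₀ := by
      funext l
      exact σ.1.symm_apply_apply _
    change σ.1.symm ∘ σ.1 ∘ b₀ ∈ p.1 _
    rwa [h3])
  rw [hp' i le_rfl, ← hχ] at h1
  rw [← hχ]
  refine (hFχ M _ _ fun ν hν => ?_).1 h1
  have h4 := hm (Sum.elim id id ν)
    (Finset.mem_union_left _ (Finset.mem_image_of_mem _ hν))
  rcases ν with ν | ν
  · exact congrArg f h4
  · exact (congrArg σ.1 (hb₀ ν)).trans (congrArg (fun a => σ.1 (f a)) h4)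

variable {κ : Cardinal.{w}}

lemma mem_strongAut_of_lnChain (hM : IsSaturated L M κ) (hM' : IsHomogeneous L M κ)
    (hκ : Cardinal.aleph0 ≤ κ) {N : L.ElementarySubstructure M} (hN : Cardinal.mk N < κ)
    (σ : modelAut L M) (i : ℕ)
    (h : ∀ (s : PatSort L) (k : ℕ) (D : L.Formula (Fin k))
      (Δ : Finset (L.Formula (Fin s.n ⊕ Fin k))), (∃ z : Fin k → M, D.Realize z) →
      ∀ p : GammaType M s, LNChain (typeSpace M) D Δ i p ((actHom σ).toFun s p)) :
    σ ∈ strongAut L M := by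
  obtain ⟨ρ, hρ, hρσ⟩ := exists_strongAut_of_funChain (x := ((↑) : N → M)) hM hM' hκ hN
    (funChain_of_lnChain _ σ i h)
  have h1 : ρ⁻¹ * σ ∈ strongAut L M := by
    refine Subgroup.subset_closure ⟨N, fun n hn => ?_⟩
    change ρ.1.symm (σ.1 n) = n
    have h2 : ρ.1 n = σ.1 n := hρσ ⟨n, hn⟩
    rw [← h2, Equiv.symm_apply_apply]
  have := mul_mem hρ h1
  rwa [mul_inv_cancel_left] at this

end TypeChains

/-! ### The homomorphism to the Lascar group. -/

section LascarHom

variable {L : FirstOrder.Language.{u, v}} {T : L.Theory} {M : Type w} [L.Structure M] [Nonempty M]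
  {J : Str.{max u v, max u v, max u v w} (patLang L)} {j : Hom J (typeSpace M)}
  {r : Hom (typeSpace M) J}

lemma exists_realize_elementarySubstructure (N : L.ElementarySubstructure M) {k : ℕ}
    {D : L.Formula (Fin k)} (h : ∃ z : Fin k → M, D.Realize z) : ∃ z : Fin k → N, D.Realize z := by
  obtain ⟨z, hz⟩ := h
  have h1 : (fexs (D.relabel (Sum.inr : Fin k → Empty ⊕ Fin k))).Realize
      (N.subtype ∘ (Empty.elim : Empty → N)) := by
    refine (realize_fexs _ _).2 ⟨z, ?_⟩
    rwa [Formula.realize_relabel, Sum.elim_comp_inr]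
  obtain ⟨z, hz⟩ := (realize_fexs _ _).1 ((N.subtype.map_formula _ _).1 h1)
  rw [Formula.realize_relabel, Sum.elim_comp_inr] at hz
  exact ⟨z, hz⟩

lemma lNat_of_restrict_eq {A : Str.{max u v, max u v, max u v w} (patLang L)}
    (hA : HasExtensions A) (N : L.ElementarySubstructure M) (f f' : Hom A (typeSpace M))
    (h : ∀ s x, (restrictHom N.subtype).toFun s (f.toFun s x) =
      (restrictHom N.subtype).toFun s (f'.toFun s x)) {s : PatSort L} {k : ℕ}
    {D : L.Formula (Fin k)} {Δ : Finset (L.Formula (Fin s.n ⊕ Fin k))}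
    (hD : ∃ z : Fin k → M, D.Realize z) (p : A.carrier s) :
    LNat (typeSpace M) D Δ (f.toFun s p) (f'.toFun s p) :=
  lNat_of_comp_eq hA f f' (restrictHom N.subtype) h (exists_realize_elementarySubstructure N hD) p

lemma mem_lascarSet_of_lNat (hM : M ⊨ T) {g : Aut J}
    (h : ∀ (s : PatSort L) (k : ℕ) (D : L.Formula (Fin k))
      (Δ : Finset (L.Formula (Fin s.n ⊕ Fin k))), (∃ z : Fin k → M, D.Realize z) →
      ∀ x : J.carrier s, LNat J D Δ x (g.app s x)) : g ∈ lascarSet J T :=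
  fun s p k D Δ hD => h s k D Δ (exists_realize_of_models hM hD) p

lemma mul_inv_mem_lascarSet (hM : M ⊨ T) {f f' : Hom J (typeSpace M)} {g g' : Aut J}
    (hg : ∀ s x, g.app s x = r.toFun s (f.toFun s x))
    (hg' : ∀ s x, g'.app s x = r.toFun s (f'.toFun s x))
    (h : ∀ (s : PatSort L) (k : ℕ) (D : L.Formula (Fin k))
      (Δ : Finset (L.Formula (Fin s.n ⊕ Fin k))), (∃ z : Fin k → M, D.Realize z) →
      ∀ x : J.carrier s, LNat (typeSpace M) D Δ (f.toFun s x) (f'.toFun s x)) :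
    g' * g⁻¹ ∈ lascarSet J T := by
  refine mem_lascarSet_of_lNat hM fun s k D Δ hD x => ?_
  have h1 := (h s k D Δ hD (g⁻¹.app s x)).hom r
  have h2 : r.toFun s (f.toFun s (g⁻¹.app s x)) = x :=
    (hg s _).symm.trans (Aut.app_inv_app g s x)
  have h3 : r.toFun s (f'.toFun s (g⁻¹.app s x)) = (g' * g⁻¹).app s x := (hg' s _).symm
  rwa [h2, h3] at h1

/-- An automorphism of the core and an automorphism of the model whose actions differ by a chain of
Lascar neighbours. -/
def Related (j : Hom J (typeSpace M)) (g : Aut J) (σ : modelAut L M) : Prop :=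
  ∃ i : ℕ, ∀ (s : PatSort L) (k : ℕ) (D : L.Formula (Fin k))
    (Δ : Finset (L.Formula (Fin s.n ⊕ Fin k))), (∃ z : Fin k → M, D.Realize z) →
    ∀ x : J.carrier s, LNChain (typeSpace M) D Δ i (j.toFun s (g.app s x))
      ((actHom σ).toFun s (j.toFun s x))

variable {g g' : Aut J} {σ σ' : modelAut L M}

omit [Nonempty M] in
lemma Related.mul (h : Related j g σ) (h' : Related j g' σ') : Related j (g * g') (σ * σ') := by
  obtain ⟨i, h⟩ := h
  obtain ⟨i', h'⟩ := h'
  exact ⟨i' + i, fun s k D Δ hD x =>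
    (h s k D Δ hD (g'.app s x)).trans ((h' s k D Δ hD x).hom (actHom σ))⟩

lemma Related.inv (h : Related j g σ) : Related j g⁻¹ σ⁻¹ := by
  obtain ⟨i, h⟩ := h
  refine ⟨i, fun s k D Δ hD x => ?_⟩
  have h1 := ((h s k D Δ hD (g⁻¹.app s x)).hom (actHom σ⁻¹)).symm_typeSpace
  have h2 : j.toFun s (g.app s (g⁻¹.app s x)) = j.toFun s x :=
    congrArg (j.toFun s) (Aut.app_inv_app g s x)
  rw [h2] at h1
  exact Eq.mp (congrArg (fun q => LNChain (typeSpace M) D Δ i q _)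
    (actHom_inv_actHom σ s (j.toFun s (g⁻¹.app s x)))) h1

/-- The homomorphisms $jr\sigma j$ and $\sigma j$ agree after $jr$, so their values are neighbours.
-/
lemma related_of_retract (hr : ∀ s x, r.toFun s (j.toFun s x) = x)
    (hg : ∀ s x, g.app s x = r.toFun s ((actHom σ).toFun s (j.toFun s x))) : Related j g σ := by
  refine ⟨1, fun s k D Δ hD x => ?_⟩
  have h := lNat_of_comp_eq (Δ := Δ) ((hasExtensions_typeSpace M).of_retract hr)
    (j.comp (r.comp ((actHom σ).comp j))) ((actHom σ).comp j) (j.comp r)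
    (fun s x => congrArg (j.toFun s) (hr s _)) hD x
  have h1 : j.toFun s (g.app s x) =
      j.toFun s (r.toFun s ((actHom σ).toFun s (j.toFun s x))) := congrArg (j.toFun s) (hg s x)
  rw [h1]
  exact h.chain

lemma related_one_of_mem_lascarSet (hT : T.IsComplete) (hM : M ⊨ T) (hg : g ∈ lascarSet J T) :
    Related j g 1 := by
  refine ⟨1, fun s k D Δ hD x => ?_⟩
  have h : LNat J D Δ x (g.app s x) := hg s x k D Δ (models_of_exists_realize hT hM hD)
  exact (h.hom j).symm_typeSpace.chain

lemma related_one_of_mem_infinitesimal (hr : ∀ s x, r.toFun s (j.toFun s x) = x)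
    (hg : g ∈ infinitesimal J) : Related j g 1 := by
  refine ⟨1 + 1, fun s k D Δ hD x => ?_⟩
  obtain ⟨y, h1, h2⟩ := exists_lNat_of_mem_infinitesimal (Δ := Δ) hr hD hg x
  exact (h2.hom j).symm_typeSpace.chain.trans (h1.hom j).chain

variable {κ : Cardinal.{w}}

/-- Each type $p$ is a neighbour of $jrp$, since both agree after $jr$. So control of $\sigma$ on
the image of $j$ gives control on all types, at the cost of one step at either end of the chain. -/
lemma Related.mem_strongAut (hM : IsSaturated L M κ) (hM' : IsHomogeneous L M κ)
    (hκ : Cardinal.aleph0 ≤ κ) {N : L.ElementarySubstructure M} (hN : Cardinal.mk N < κ)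
    (hr : ∀ s x, r.toFun s (j.toFun s x) = x) (h : Related j 1 σ) : σ ∈ strongAut L M := by
  obtain ⟨i, h⟩ := h
  refine mem_strongAut_of_lnChain hM hM' hκ hN σ (1 + (i + 1)) fun s k D Δ hD p => ?_
  have h1 : LNat (typeSpace M) D Δ p (j.toFun s (r.toFun s p)) :=
    lNat_of_comp_eq (hasExtensions_typeSpace M) ⟨fun _ x => x, fun _ _ h => h⟩ (j.comp r)
      (j.comp r) (fun s x => (congrArg (j.toFun s) (hr s _)).symm) hD p
  exact (h1.chain.trans (h s k D Δ hD (r.toFun s p))).trans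
    (h1.hom (actHom σ)).symm_typeSpace.chain

variable (haut : ∀ f : Hom J J, ∃ g : Aut J, ∀ s x, g.app s x = f.toFun s x)

include haut

/-- Over the small submodel `N`, $jg$ agrees with $\sigma vj$, and $vj$ with $j$; so $jg$, $\sigma
vj$, $\sigma j$ are successive neighbours. Composing with $r$ shows that $g$ and $r\sigma j$ differ
by a product of two elements of $L_1$, which is needed for the kernel and for uniqueness. -/
lemma exists_related (hT : M ⊨ T) (hM : IsSaturated L M κ) (hM' : IsHomogeneous L M κ)
    (hκ : Cardinal.aleph0 ≤ κ) {N : L.ElementarySubstructure M} (hN : Cardinal.mk N < κ)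
    (hr : ∀ s x, r.toFun s (j.toFun s x) = x) (g : Aut J) :
    ∃ (σ : modelAut L M) (g' : Aut J), Related j g σ ∧
      (∀ s x, g'.app s x = r.toFun s ((actHom σ).toFun s (j.toFun s x))) ∧
      g' * g⁻¹ ∈ Subgroup.closure (lascarSet J T) := by
  obtain ⟨σ, v, hv, hσ⟩ := exists_aut_of_aut hM hM' hκ hr g N hN
  have hJ : HasExtensions J := (hasExtensions_typeSpace M).of_retract hr
  let f₀ : Hom J (typeSpace M) := j.comp ⟨fun s x => g.app s x, fun R x h => (g.2 R x).2 h⟩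
  let f₁ : Hom J (typeSpace M) := (actHom σ).comp (v.comp j)
  let f₂ : Hom J (typeSpace M) := (actHom σ).comp j
  have h01 : ∀ (s : PatSort L) (k : ℕ) (D : L.Formula (Fin k))
      (Δ : Finset (L.Formula (Fin s.n ⊕ Fin k))), (∃ z : Fin k → M, D.Realize z) →
      ∀ x : J.carrier s, LNat (typeSpace M) D Δ (f₀.toFun s x) (f₁.toFun s x) :=
    fun s k D Δ hD x => lNat_of_restrict_eq hJ N f₀ f₁ hσ hD x
  have h12 : ∀ (s : PatSort L) (k : ℕ) (D : L.Formula (Fin k))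
      (Δ : Finset (L.Formula (Fin s.n ⊕ Fin k))), (∃ z : Fin k → M, D.Realize z) →
      ∀ x : J.carrier s, LNat (typeSpace M) D Δ (f₁.toFun s x) (f₂.toFun s x) :=
    fun s k D Δ hD x => (lNat_of_restrict_eq hJ N (v.comp j) j
      (fun s x => hv s (j.toFun s x)) hD x).hom (actHom σ)
  obtain ⟨g₁, hg₁⟩ := haut (r.comp f₁)
  obtain ⟨g₂, hg₂⟩ := haut (r.comp f₂)
  refine ⟨σ, g₂, ⟨1 + 1, fun s k D Δ hD x =>
    (h01 s k D Δ hD x).chain.trans (h12 s k D Δ hD x).chain⟩, hg₂, ?_⟩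
  have h1 := Subgroup.subset_closure (mul_inv_mem_lascarSet (r := r) hT
    (fun s x => (hr s (g.app s x)).symm) hg₁ h01)
  have h2 := Subgroup.subset_closure (mul_inv_mem_lascarSet (r := r) hT hg₁ hg₂ h12)
  have h3 := mul_mem h2 h1
  rwa [show g₂ * g₁⁻¹ * (g₁ * g⁻¹) = g₂ * g⁻¹ by group] at h3

/-- If $\sigma$ fixes a submodel, $f$ and $\sigma f$ agree over it and are neighbours. The statement
is made for all $f$, since for a product $\sigma\tau$ the induction uses $\tau f$. -/
lemma mul_inv_mem_closure_lascarSet (hT : M ⊨ T) (hr : ∀ s x, r.toFun s (j.toFun s x) = x)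
    (hσ : σ ∈ strongAut L M) : ∀ (f : Hom J (typeSpace M)) (g g' : Aut J),
      (∀ s x, g.app s x = r.toFun s (f.toFun s x)) →
      (∀ s x, g'.app s x = r.toFun s ((actHom σ).toFun s (f.toFun s x))) →
      g' * g⁻¹ ∈ Subgroup.closure (lascarSet J T) := by
  have hJ : HasExtensions J := (hasExtensions_typeSpace M).of_retract hr
  induction hσ using Subgroup.closure_induction with
  | mem σ h =>
    obtain ⟨N, hN⟩ := h
    intro f g g' hg hg'
    refine Subgroup.subset_closure (mul_inv_mem_lascarSet (f' := (actHom σ).comp f) hT hg hg' ?_)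
    intro s k D Δ hD x
    refine lNat_of_restrict_eq hJ N f ((actHom σ).comp f) (fun s x => ?_) hD x
    refine GammaType.ext fun φ b => ?_
    have h1 : σ.1.symm ∘ N.subtype ∘ b = N.subtype ∘ b := by
      funext l
      exact (Equiv.symm_apply_eq _).2 (hN _ (b l).2).symm
    exact iff_of_eq (congrArg (· ∈ (f.toFun s x : GammaType M s).1 φ) h1.symm)
  | one =>
    intro f g g' hg hg'
    have : g' = g := Aut.ext fun s x => (hg' s x).trans (hg s x).symm
    rw [this, mul_inv_cancel]
    exact one_mem _
  | mul σ τ _ _ hσ hτ =>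
    intro f g g' hg hg'
    obtain ⟨g₁, hg₁⟩ := haut (r.comp ((actHom τ).comp f))
    have h1 := hτ f g g₁ hg hg₁
    have h2 := hσ ((actHom τ).comp f) g₁ g' hg₁ hg'
    have h3 := mul_mem h2 h1
    rwa [show g' * g₁⁻¹ * (g₁ * g⁻¹) = g' * g⁻¹ by group] at h3
  | inv σ _ hσ =>
    intro f g g' hg hg'
    have h1 := hσ ((actHom σ⁻¹).comp f) g' g hg' fun s x => (hg s x).trans
      (congrArg (r.toFun s) (actHom_inv_actHom σ⁻¹ s (f.toFun s x)).symm)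
    have h2 := inv_mem h1
    rwa [mul_inv_rev, inv_inv] at h2

/-- The canonical homomorphism from the automorphism group of the core to the Lascar group. -/
lemma exists_lascarHom (hT : T.IsComplete) (hMT : M ⊨ T) (hM : IsSaturated L M κ)
    (hM' : IsHomogeneous L M κ) (hκ : Cardinal.aleph0 ≤ κ) {N : L.ElementarySubstructure M}
    (hN : Cardinal.mk N < κ) (hr : ∀ s x, r.toFun s (j.toFun s x) = x) :
    ∃ Ψ : Aut J →* LascarGroup L M, Function.Surjective Ψ ∧
      Ψ.ker = Subgroup.closure (lascarSet J T) ∧ infinitesimal J ≤ Ψ.ker ∧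
      ∀ g σ, Related j g σ → Ψ g = (σ : LascarGroup L M) := by
  choose σ g' hσ hg' hcl using exists_related (r := r) haut hMT hM hM' hκ hN hr
  -- Two automorphisms related to the same `g` have a quotient related to `1`, which is strong.
  have huniq : ∀ g τ, Related j g τ → (σ g : LascarGroup L M) = τ := by
    intro g τ h
    refine QuotientGroup.eq.2 (Related.mem_strongAut hM hM' hκ hN hr ?_)
    have := (hσ g).inv.mul h
    rwa [inv_mul_cancel] at this
  let Ψ : Aut J →* LascarGroup L M := MonoidHom.mk' (fun g => (σ g : LascarGroup L M))
    fun g g' => huniq _ _ ((hσ g).mul (hσ g'))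
  have hΨ : ∀ g τ, Related j g τ → Ψ g = (τ : LascarGroup L M) := huniq
  refine ⟨Ψ, fun x => ?_, le_antisymm (fun g hg => ?_) ?_, fun g hg => ?_, hΨ⟩
  · obtain ⟨τ, rfl⟩ := QuotientGroup.mk_surjective x
    obtain ⟨g, hg⟩ := haut (r.comp ((actHom τ).comp j))
    exact ⟨g, hΨ g τ (related_of_retract hr hg)⟩
  · have h1 : σ g ∈ strongAut L M := (QuotientGroup.eq_one_iff _).1 hg
    have h2 := mul_inv_mem_closure_lascarSet (T := T) haut hMT hr h1 j 1 (g' g)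
      (fun s x => (hr s x).symm) (hg' g)
    rw [inv_one, mul_one] at h2
    have h3 := mul_mem (inv_mem (hcl g)) h2
    rwa [show (g' g * g⁻¹)⁻¹ * g' g = g by group] at h3
  · rw [Subgroup.closure_le]
    exact fun g hg => hΨ g 1 (related_one_of_mem_lascarSet hT hMT hg)
  · exact hΨ g 1 (related_one_of_mem_infinitesimal hr hg)

lemma existsUnique_lascarHom (hT : T.IsComplete) (hMT : M ⊨ T) (hM : SufficientlySaturated L M)
    (hj : ∃ r : Hom (typeSpace M) J, ∀ s x, r.toFun s (j.toFun s x) = x)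
    {H : Type d} [Group H] (π : Aut J →* H) (hπ : Function.Surjective π)
    (hker : π.ker ≤ infinitesimal J) :
    ∃! Φ : H →* LascarGroup L M, Function.Surjective Φ ∧
      Φ.ker = Subgroup.closure (π '' lascarSet J T) ∧ IsInducedBy j π Φ := by
  obtain ⟨κ, hκ, hM, hM'⟩ := hM
  obtain ⟨r, hr⟩ := hj
  obtain ⟨N, hN⟩ := exists_small_elementarySubstructure (L := L) (M := M) hκ
  have hκ' := aleph0_le_of_lt hκ
  obtain ⟨Ψ, hΨ, hΨker, hΨinf, hΨrel⟩ :=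
    exists_lascarHom (r := r) haut hT hMT hM hM' hκ' hN hr
  let Φ : H →* LascarGroup L M := π.liftOfSurjective hπ ⟨Ψ, hker.trans hΨinf⟩
  have hΦ : ∀ g, Φ (π g) = Ψ g := fun g => π.liftOfRightInverse_comp_apply _ _ _ g
  refine ⟨Φ, ⟨fun x => ?_, ?_, fun r' hr' σ g hg => ?_⟩, ?_⟩
  · obtain ⟨g, rfl⟩ := hΨ x
    exact ⟨π g, hΦ g⟩
  · rw [← MonoidHom.map_closure, ← hΨker]
    ext x
    obtain ⟨g, rfl⟩ := hπ x
    refine ⟨fun h => ⟨g, ?_, rfl⟩, ?_⟩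
    · exact (hΦ g).symm.trans h
    · rintro ⟨g', h1, h2⟩
      rw [← h2]
      exact (hΦ g').trans h1
  · rw [hΦ]
    exact hΨrel g σ (related_of_retract hr' hg)
  -- Modulo the group generated by $L_1$, which lies in the kernel, every $g$ has the form $r\sigma
  -- j$, where the value is prescribed.
  · rintro Φ' ⟨-, hker', hind'⟩
    ext x
    obtain ⟨g, rfl⟩ := hπ x
    obtain ⟨σ, g', h1, h2, h3⟩ := exists_related (r := r) haut hMT hM hM' hκ' hN hr g
    have h4 : π (g' * g⁻¹) ∈ Φ'.ker := by
      rw [hker', ← MonoidHom.map_closure]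
      exact Subgroup.mem_map_of_mem π h3
    rw [MonoidHom.mem_ker, map_mul, map_inv, map_mul, map_inv, mul_inv_eq_one] at h4
    rw [← h4, hΦ, hind' r hr σ g' h2, hΨrel g σ h1]

end LascarHom

end Patterns

end

theorem mainTheorem1 {L : FirstOrder.Language.{u, v}} (T : L.Theory) (hT : T.IsComplete) :
    -- all type spaces of models of `T` have the same primitive universal theory `𝒯`
    (∀ (M : Type (max u v w)) [L.Structure M] [Nonempty M], M ⊨ T →
      (typeSpace.{u, v, max u v w} M).puTheory = patTheory.{u, v, w} T) ∧
    -- `𝒯` has a universal existentially closed model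
    (∃ J : Str.{max u v, max u v, max u v w} (patLang L),
      IsUniversalEC (patTheory.{u, v, w} T) J) ∧
    -- which is unique
    (∀ J J' : Str.{max u v, max u v, max u v w} (patLang L),
      IsUniversalEC (patTheory.{u, v, w} T) J → IsUniversalEC (patTheory.{u, v, w} T) J' →
        Nonempty (Iso J J')) ∧
    ∀ J : Str.{max u v, max u v, max u v w} (patLang L),
      IsUniversalEC (patTheory.{u, v, w} T) J →
      -- bounds on its cardinality
      (∀ (M : Type (max u v w)) [L.Structure M] [Nonempty M], M ⊨ T →
        ∀ s, Cardinal.mk (J.carrier s) ≤ Cardinal.mk (GammaType.{u, v, max u v w} M s)) ∧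
      Cardinal.mk (Σ s, J.carrier s) ≤
        Cardinal.lift.{w} (2 ^ max Cardinal.aleph0 L.card : Cardinal.{max u v}) ∧
      -- `𝒢 = Aut(J) / 𝔤` is a compact Hausdorff topological group
      CompactSpace (Aut J ⧸ infinitesimal J) ∧
      T2Space (Aut J ⧸ infinitesimal J) ∧
      IsTopologicalGroup (Aut J ⧸ infinitesimal J) ∧
      -- and so is `Aut(J_h)`
      CompactSpace (AutH J) ∧
      T2Space (AutH J) ∧
      IsTopologicalGroup (AutH J) ∧
      -- the restriction homomorphism `ρ : Aut(J) → Aut(J_h)`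
      ∃ ρ : Aut J →* AutH J,
        (∀ (g : Aut J) (h : HausdorffImaginary J) (x : h.P),
          ∃ hx : g.app h.sort x ∈ h.P,
            (ρ g).app h (Quotient.mk h.setoid x) = Quotient.mk h.setoid ⟨g.app h.sort x, hx⟩) ∧
        Continuous ρ ∧
        Function.Surjective ρ ∧
        ρ.ker ≤ infinitesimal J ∧
        -- `L₁` is closed in `Aut(J)` and in the two quotients
        IsClosed (lascarSet J T) ∧
        IsClosed (QuotientGroup.mk' (infinitesimal J) '' lascarSet J T) ∧
        IsClosed (ρ '' lascarSet J T) ∧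
        -- the canonical surjections onto the Lascar group, with kernel generated by `L₁`
        ∀ (M : Type (max u v w)) [L.Structure M] [Nonempty M], M ⊨ T →
          SufficientlySaturated L M →
          ∀ j : Hom J (typeSpace.{u, v, max u v w} M),
            (∃! Φ : Aut J ⧸ infinitesimal J →* LascarGroup L M,
              Function.Surjective Φ ∧
              Φ.ker = Subgroup.closure (QuotientGroup.mk' (infinitesimal J) '' lascarSet J T) ∧
              IsInducedBy.{u, v, max u v w} j (QuotientGroup.mk' (infinitesimal J)) Φ) ∧
            (∃! Ψ : AutH J →* LascarGroup L M,
              Function.Surjective Ψ ∧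
              Ψ.ker = Subgroup.closure (ρ '' lascarSet J T) ∧
              IsInducedBy.{u, v, max u v w} j ρ Ψ) := by
  -- A model of size at most $|L|$ provides both a core and the bound on its size.
  obtain ⟨M₀, _, _, hM₀, hcard⟩ := exists_small_model.{u, v, w} hT.1
  obtain ⟨J₀, hJ₀⟩ := exists_isCore (L := L) M₀
  have hpu := puTheory_typeSpace.{u, v, w} hT M₀ hM₀
  rw [hpu] at hJ₀
  refine ⟨fun M _ _ hM => puTheory_typeSpace.{u, v, w} hT M hM, ⟨J₀, hJ₀.isUniversalEC⟩,
    fun J J' hJ hJ' => (hJ₀.of_isUniversalEC hJ).nonempty_iso hJ', fun J hJ => ?_⟩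
  replace hJ := hJ₀.of_isUniversalEC hJ
  have hmodel : ∀ (M : Type (max u v w)) [L.Structure M] [Nonempty M], M ⊨ T →
      (typeSpace.{u, v, max u v w} M).IsModel (patTheory.{u, v, w} T) := fun M _ _ hM => by
    rw [← puTheory_typeSpace.{u, v, w} hT M hM]
    exact isModel_puTheory _
  have hle : ∀ (M : Type (max u v w)) [L.Structure M] [Nonempty M], M ⊨ T → ∀ s,
      Cardinal.mk (J.carrier s) ≤ Cardinal.mk (GammaType.{u, v, max u v w} M s) := by
    intro M _ _ hM s
    have h1 : J.IsModel (typeSpace.{u, v, max u v w} M).puTheory := by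
      rw [puTheory_typeSpace.{u, v, w} hT M hM]
      exact hJ.isModel
    obtain ⟨j⟩ := nonempty_hom_of_isModel h1
    obtain ⟨r, hr⟩ := hJ.exists_retraction (hmodel M hM) j
    exact Cardinal.mk_le_of_injective (Function.LeftInverse.injective (hr s))
  have hcore : IsCompactCore J := by
    have h1 : J.IsModel (typeSpace.{u, v, max u v w} M₀).puTheory := by
      rw [hpu]
      exact hJ.isModel
    obtain ⟨j⟩ := nonempty_hom_of_isModel h1
    obtain ⟨r, hr⟩ := hJ.exists_retraction (hmodel M₀ hM₀) j
    exact isCompactCore_of_retract hr hJ.exists_aut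
  have := hcore.compactSpace_aut
  have hL := (isClosed_lascarSet J T).isCompact
  refine ⟨hle, mk_core_le M₀ hcard (hle M₀ hM₀), hcore.compactSpace_quotient, inferInstance,
    hcore.isTopologicalGroup_quotient, hcore.compactSpace_autH, inferInstance,
    hcore.isTopologicalGroup_autH, restrictH J, fun g h x => ⟨_, restrictH_mk g h x⟩,
    continuous_restrictH, hcore.restrictH_surjective, hcore.ker_restrictH_le,
    isClosed_lascarSet J T, (hL.image QuotientGroup.continuous_mk).isClosed,
    (hL.image continuous_restrictH).isClosed, fun M _ _ hM hsat j => ?_⟩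
  have hj := hJ.exists_retraction (hmodel M hM) j
  exact ⟨existsUnique_lascarHom hJ.exists_aut hT hM hsat hj _ (QuotientGroup.mk'_surjective _)
    (QuotientGroup.ker_mk' _).le, existsUnique_lascarHom hJ.exists_aut hT hM hsat hj _
    hcore.restrictH_surjective hcore.ker_restrictH_le⟩
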